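/- Let $T$ be a rooted tree with $n\ge 1$ vertices, numbered $0,\dots,n-1$, where each vertex $i$ carries a real weight $w_i\ge 0$, a real cost $s_i$ and a real rank $r_i$, the ranks being pairwise distinct, and let $w_0$ be a real threshold with $w_i\le w_0$ for all $i$. A \emph{chain} of $T$ is a path of $T$ any two vertices of which are in the ancestor relation; the \emph{dominant} vertex of a chain is its vertex of largest rank, and the cost of the chain is $s_i$, where $i$ is its dominant vertex. A partition of the vertex set of $T$ into chains $C_1,\dots,C_k$ ($k$ arbitrary) is \emph{feasible} if $\sum_{i\in C_j}w_i\le w_0$ for every $j$; its total cost is the sum of the costs of its chains; it is \emph{optimal} if it is feasible and its total cost is minimum among all feasible partitions. The problem of finding an optimal partition can be solved in $O(n\log n)$ time. That is, there are a single program for a unit-cost random access machine (whose elementary operations are reading and writing variables and array entries, incrementing, decrementing and comparing natural numbers, adding, subtracting and comparing real numbers, and program control) and a function $\tau:\mathbb N\to\mathbb N$ with $\tau(n)=O(n\log n)$ such that, for every $n$ and every input as above on $n$ vertices, given as $n$, $w_0$, the array of parents (the root being its own parent) and the arrays of the $w_i$, $s_i$ and $r_i$, the program halts after at most $\tau(n)$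 steps and outputs the minimum total cost together with an optimal partition attaining it, the latter as an array of chain identifiers that are equal for two vertices if and only if the two vertices lie in the same chain. -/

import Mathlib

universe u

noncomputable section

namespace ChainPartition

/-! ### The optimisation problem -/

/-- An instance on `n` vertices, numbered by `Fin n`. The rooted tree is Mathlib's: the order is
the ancestor order, `⊥` is the root and `Order.pred` is the parent. -/
structure Problem (n : ℕ) where
  tree : RootedTree.{u}
  node : Fin n ≃ tree
  weight : Fin n → ℝ
  cost : Fin n → ℝ
  rank : Fin n → ℝ
  threshold : ℝ

namespace Problem

variable {n : ℕ} (I : Problem.{u} n)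

/-- The parent of a vertex; the root is sent to itself. -/
def parent (i : Fin n) : Fin n := I.node.symm (Order.pred (I.node i))

/-- `C` is the vertex set of a path of the tree any two vertices of which are in the ancestor
relation. -/
def IsTreeChain (C : Finset (Fin n)) : Prop :=
  ∃ (x y : I.tree) (p : (SimpleGraph.hasse I.tree).Walk x y), p.IsPath ∧
    (∀ i, i ∈ C ↔ I.node i ∈ p.support) ∧
    ∀ i ∈ C, ∀ j ∈ C, I.node i ≤ I.node j ∨ I.node j ≤ I.node i

/-- A partition of the vertices into chains, each of total weight at most the threshold. -/
def IsFeasible (P : Finpartition (Finset.univ : Finset (Fin n))) : Prop :=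
  ∀ C ∈ P.parts, I.IsTreeChain C ∧ ∑ i ∈ C, I.weight i ≤ I.threshold

/-- The vertex of largest rank in a nonempty set (unique when the ranks are distinct). -/
def dominant (C : Finset (Fin n)) (hC : C.Nonempty) : Fin n :=
  Classical.choose (C.exists_max_image I.rank hC)

/-- The cost of a chain is the cost of its dominant vertex. -/
def chainCost (C : Finset (Fin n)) : ℝ :=
  if hC : C.Nonempty then I.cost (I.dominant C hC) else 0

def totalCost (P : Finpartition (Finset.univ : Finset (Fin n))) : ℝ :=
  ∑ C ∈ P.parts, I.chainCost C

def IsOptimal (P : Finpartition (Finset.univ : Finset (Fin n))) : Prop :=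
  I.IsFeasible P ∧ ∀ Q, I.IsFeasible Q → I.totalCost P ≤ I.totalCost Q

end Problem

/-! ### The machine model

A unit-cost random access machine with exact real arithmetic, programmed in a structured language.
Memory consists of scalars and arrays of natural numbers (used as counters and addresses) and
scalars and arrays of reals. Natural numbers can only be incremented, decremented and compared, so
that those occurring in a run of `t` steps have `O(log (n + t))` bits; reals can only be
added, subtracted and compared. -/

structure Store where
  natVar : ℕ → ℕ
  natArr : ℕ → ℕ → ℕ
  realVar : ℕ → ℝ
  realArr : ℕ → ℕ → ℝ

namespace Store

def setNatVar (σ : Store) (x v : ℕ) : Store :=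
  { σ with natVar := Function.update σ.natVar x v }

def setNatArr (σ : Store) (a i v : ℕ) : Store :=
  { σ with natArr := Function.update σ.natArr a (Function.update (σ.natArr a) i v) }

def setRealVar (σ : Store) (x : ℕ) (v : ℝ) : Store :=
  { σ with realVar := Function.update σ.realVar x v }

def setRealArr (σ : Store) (a i : ℕ) (v : ℝ) : Store :=
  { σ with realArr := Function.update σ.realArr a (Function.update (σ.realArr a) i v) }

end Store

/-- Expressions for natural numbers; `get a e` reads entry `e` of array `a`. -/
inductive NatExp where
  | const (c : ℕ)
  | var (x : ℕ)
  | get (a : ℕ) (e : NatExp)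
  | succ (e : NatExp)
  | pred (e : NatExp)

namespace NatExp

def eval (σ : Store) : NatExp → ℕ
  | const c => c
  | var x => σ.natVar x
  | get a e => σ.natArr a (e.eval σ)
  | succ e => e.eval σ + 1
  | pred e => e.eval σ - 1

/-- The number of elementary operations in the evaluation. -/
def time : NatExp → ℕ
  | const _ => 1
  | var _ => 1
  | get _ e => e.time + 1
  | succ e => e.time + 1
  | pred e => e.time + 1

end NatExp

inductive RealExp where
  | var (x : ℕ)
  | get (a : ℕ) (e : NatExp)
  | add (e f : RealExp)
  | sub (e f : RealExp)

namespace RealExp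

def eval (σ : Store) : RealExp → ℝ
  | var x => σ.realVar x
  | get a e => σ.realArr a (e.eval σ)
  | add e f => e.eval σ + f.eval σ
  | sub e f => e.eval σ - f.eval σ

def time : RealExp → ℕ
  | var _ => 1
  | get _ e => e.time + 1
  | add e f => e.time + f.time + 1
  | sub e f => e.time + f.time + 1

end RealExp

inductive Test where
  | natEq (e f : NatExp)
  | natLt (e f : NatExp)
  | realLe (e f : RealExp)
  | not (b : Test)
  | and (b c : Test)
  | or (b c : Test)

namespace Test

def Holds (σ : Store) : Test → Prop
  | natEq e f => e.eval σ = f.eval σ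
  | natLt e f => e.eval σ < f.eval σ
  | realLe e f => e.eval σ ≤ f.eval σ
  | not b => ¬ b.Holds σ
  | and b c => b.Holds σ ∧ c.Holds σ
  | or b c => b.Holds σ ∨ c.Holds σ

def time : Test → ℕ
  | natEq e f => e.time + f.time + 1
  | natLt e f => e.time + f.time + 1
  | realLe e f => e.time + f.time + 1
  | not b => b.time + 1
  | and b c => b.time + c.time + 1
  | or b c => b.time + c.time + 1

end Test

inductive Program where
  | skip
  | setNatVar (x : ℕ) (e : NatExp)
  | setNatArr (a : ℕ) (i e : NatExp)
  | setRealVar (x : ℕ) (e : RealExp)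
  | setRealArr (a : ℕ) (i : NatExp) (e : RealExp)
  | seq (p q : Program)
  | ite (b : Test) (p q : Program)
  | while (b : Test) (p : Program)

/-- `Runs p σ t τ`: started in the store `σ`, the program `p` halts after `t` elementary steps
with the store `τ`. -/
inductive Runs : Program → Store → ℕ → Store → Prop where
  | skip (σ : Store) : Runs .skip σ 1 σ
  | setNatVar (x : ℕ) (e : NatExp) (σ : Store) :
      Runs (.setNatVar x e) σ (e.time + 1) (σ.setNatVar x (e.eval σ))
  | setNatArr (a : ℕ) (i e : NatExp) (σ : Store) :
      Runs (.setNatArr a i e) σ (i.time + e.time + 1) (σ.setNatArr a (i.eval σ) (e.eval σ))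
  | setRealVar (x : ℕ) (e : RealExp) (σ : Store) :
      Runs (.setRealVar x e) σ (e.time + 1) (σ.setRealVar x (e.eval σ))
  | setRealArr (a : ℕ) (i : NatExp) (e : RealExp) (σ : Store) :
      Runs (.setRealArr a i e) σ (i.time + e.time + 1) (σ.setRealArr a (i.eval σ) (e.eval σ))
  | seq {p q : Program} {σ τ υ : Store} {t s : ℕ} :
      Runs p σ t τ → Runs q τ s υ → Runs (.seq p q) σ (t + s) υ
  | iteTrue {b : Test} {p q : Program} {σ τ : Store} {t : ℕ} :
      b.Holds σ → Runs p σ t τ → Runs (.ite b p q) σ (b.time + 1 + t) τ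
  | iteFalse {b : Test} {p q : Program} {σ τ : Store} {t : ℕ} :
      ¬ b.Holds σ → Runs q σ t τ → Runs (.ite b p q) σ (b.time + 1 + t) τ
  | whileFalse {b : Test} {p : Program} {σ : Store} :
      ¬ b.Holds σ → Runs (.while b p) σ (b.time + 1) σ
  | whileTrue {b : Test} {p : Program} {σ τ υ : Store} {t s : ℕ} :
      b.Holds σ → Runs p σ t τ → Runs (.while b p) τ s υ →
      Runs (.while b p) σ (b.time + 1 + t + s) υ

/-! ### Input and output -/

/-- The first `n` entries of a zero-initialised array. -/
def arrayOf {α : Type*} [Zero α] {n : ℕ} (f : Fin n → α) (k : ℕ) : α :=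
  if h : k < n then f ⟨k, h⟩ else 0

/-- The initial store: the scalars `n` and the threshold, the parent array (in which the root is
its own parent), and the arrays of weights, costs and ranks. All other memory is zero. -/
def inputStore {n : ℕ} (I : Problem.{u} n) : Store where
  natVar x := if x = 0 then n else 0
  natArr a := if a = 0 then arrayOf (fun i => (I.parent i : ℕ)) else fun _ => 0
  realVar x := if x = 0 then I.threshold else 0
  realArr a :=
    if a = 0 then arrayOf I.weight
    else if a = 1 then arrayOf I.cost
    else if a = 2 then arrayOf I.rank
    else fun _ => 0

/-- The final store holds the cost of an optimal partition in real scalar `0`, and in natural-number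
array `0` a chain identifier for each vertex, two vertices having equal identifiers exactly when
they lie in the same chain of that partition. -/
def IsSolution {n : ℕ} (I : Problem.{u} n) (τ : Store) : Prop :=
  ∃ P : Finpartition (Finset.univ : Finset (Fin n)), I.IsOptimal P ∧
    τ.realVar 0 = I.totalCost P ∧
    ∀ i j : Fin n, τ.natArr 0 i = τ.natArr 0 j ↔ P.part i = P.part j

end ChainPartition

end

set_option linter.unusedSimpArgs false

noncomputable section
namespace ChainPartition

/-! ### Weakest preconditions with running time -/

/-! The proof is a duality argument. Give every vertex v a real number h(v), fixed from the leaves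
upwards: h(v) is the minimum, over all feasible chains with top v, of the cost of the chain minus
the values of h on its other vertices. Then h sums to at most the cost on every feasible chain, so
the total of h is a lower bound for every feasible partition (`sum_le_totalCost`). For each v some
chain from v down to a vertex b(v) attains equality. Taking the chain of the root, then the chain of
a highest vertex not yet covered, and so on, partitions the tree into such tight chains, so the
bound is attained (`exists_isOptimal`). Nothing is assumed about the sign of the costs or of h;
`Good` expresses the two properties of h and b at one vertex.

The work lies in finding all these minima in time O(n log n). Let P be the set of processed
vertices. The possible dominant vertices of chains are the leaders (`Act`): the vertices whose rank
is largest among their ancestors in P. The ends of chains that a leader d dominates form its group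
(`Grp`). A new vertex v absorbs the leaders below it of smaller rank and becomes the leader of the
union of their groups and v. With off(u) the sum of h over the ancestors of u in P, the value of a
leader d at v is the minimum of s(d) - off(u) over the ends u in its group, and h(v) is the smallest
value of a leader below or equal to v.

Three families of meldable heaps maintain this. The group of d is ordered by off(d) - off(u), which
is unaffected by values of h fixed above d. The leaders stored at a vertex are ordered once by rank,
to find those to absorb, and once by value. Fixing h(v) changes all values stored at v by the same
amount, which costs constant time because keys are stored relative to the parent node. As weights
are nonnegative, a chain end too heavy for v is too heavy for all ancestors of v and can be deleted
for good; only the currently best chain is ever tested. As w(v) is at most the threshold, the chain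
consisting of v alone survives at v, so the minimum is never over the empty set. Absorbed leaders
stay in the value heaps, flagged, until they come up as roots. `Core` is the invariant; it is
preserved by `Core.start`, `Core.absorb`, `Core.finish_absorb`, `Core.insert_leader`,
`Core.drop_stale`, `Core.drop_chain` and `Core.finish`, and `Core.good` yields the new h(v) and
b(v).

Each vertex causes three insertions of new heap nodes, and every iteration of an inner loop removes
at least one node in all, so there are O(n) heap operations. Melding descends into the smaller
subheap and therefore takes O(log n) steps. Natural numbers cannot be added on the machine, so sizes
of heaps are kept as real multiples of a positive unit, the difference of two ranks. Finding an
order with ancestors first and writing down the chains take linear time. -/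

/-- Started in `σ`, the program halts, and running time and final store satisfy `Q`. -/
def Ensures (p : Program) (σ : Store) (Q : ℕ → Store → Prop) : Prop :=
  ∃ t τ, Runs p σ t τ ∧ Q t τ

theorem Ensures.mono {p : Program} {σ : Store} {Q Q' : ℕ → Store → Prop}
    (h : Ensures p σ Q) (hQ : ∀ t τ, Q t τ → Q' t τ) : Ensures p σ Q' := by
  obtain ⟨t, τ, hr, hq⟩ := h
  exact ⟨t, τ, hr, hQ _ _ hq⟩

/-- The rules for the program constructs are equivalences, so that rewriting with them executes
straight-line code symbolically. -/
theorem ensures_skip {σ : Store} {Q : ℕ → Store → Prop} : Ensures .skip σ Q ↔ Q 1 σ := by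
  constructor
  · rintro ⟨t, τ, hr, hq⟩
    cases hr
    exact hq
  · exact fun h => ⟨_, _, .skip σ, h⟩

theorem ensures_setNatVar {σ : Store} {Q : ℕ → Store → Prop} {x : ℕ} {e : NatExp} :
    Ensures (.setNatVar x e) σ Q ↔ Q (e.time + 1) (σ.setNatVar x (e.eval σ)) := by
  constructor
  · rintro ⟨t, τ, hr, hq⟩
    cases hr
    exact hq
  · exact fun h => ⟨_, _, .setNatVar x e σ, h⟩

theorem ensures_setNatArr {σ : Store} {Q : ℕ → Store → Prop} {a : ℕ} {i e : NatExp} :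
    Ensures (.setNatArr a i e) σ Q ↔
      Q (i.time + e.time + 1) (σ.setNatArr a (i.eval σ) (e.eval σ)) := by
  constructor
  · rintro ⟨t, τ, hr, hq⟩
    cases hr
    exact hq
  · exact fun h => ⟨_, _, .setNatArr a i e σ, h⟩

theorem ensures_setRealVar {σ : Store} {Q : ℕ → Store → Prop} {x : ℕ} {e : RealExp} :
    Ensures (.setRealVar x e) σ Q ↔ Q (e.time + 1) (σ.setRealVar x (e.eval σ)) := by
  constructor
  · rintro ⟨t, τ, hr, hq⟩
    cases hr
    exact hq
  · exact fun h => ⟨_, _, .setRealVar x e σ, h⟩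

theorem ensures_setRealArr {σ : Store} {Q : ℕ → Store → Prop} {a : ℕ} {i : NatExp}
    {e : RealExp} :
    Ensures (.setRealArr a i e) σ Q ↔
      Q (i.time + e.time + 1) (σ.setRealArr a (i.eval σ) (e.eval σ)) := by
  constructor
  · rintro ⟨t, τ, hr, hq⟩
    cases hr
    exact hq
  · exact fun h => ⟨_, _, .setRealArr a i e σ, h⟩

theorem ensures_seq {σ : Store} {Q : ℕ → Store → Prop} {p q : Program} :
    Ensures (.seq p q) σ Q ↔
      Ensures p σ fun t τ => Ensures q τ fun s υ => Q (t + s) υ := by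
  constructor
  · rintro ⟨t, τ, hr, hq⟩
    cases hr with
    | seq h₁ h₂ => exact ⟨_, _, h₁, _, _, h₂, hq⟩
  · rintro ⟨t, τ, h₁, s, υ, h₂, hq⟩
    exact ⟨_, _, .seq h₁ h₂, hq⟩

theorem ensures_ite {σ : Store} {Q : ℕ → Store → Prop} {b : Test} {p q : Program} :
    Ensures (.ite b p q) σ Q ↔
      (b.Holds σ → Ensures p σ fun t τ => Q (b.time + 1 + t) τ) ∧
      (¬ b.Holds σ → Ensures q σ fun t τ => Q (b.time + 1 + t) τ) := by
  constructor
  · rintro ⟨t, τ, hr, hq⟩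
    cases hr with
    | iteTrue hb h => exact ⟨fun _ => ⟨_, _, h, hq⟩, fun hn => absurd hb hn⟩
    | iteFalse hb h => exact ⟨fun hn => absurd hn hb, fun _ => ⟨_, _, h, hq⟩⟩
  · rintro ⟨h₁, h₂⟩
    by_cases hb : b.Holds σ
    · obtain ⟨t, τ, hr, hq⟩ := h₁ hb
      exact ⟨_, _, .iteTrue hb hr, hq⟩
    · obtain ⟨t, τ, hr, hq⟩ := h₂ hb
      exact ⟨_, _, .iteFalse hb hr, hq⟩

theorem ensures_while {σ : Store} {Q : ℕ → Store → Prop} {b : Test} {p : Program} :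
    Ensures (.while b p) σ Q ↔
      (b.Holds σ → Ensures p σ fun t τ => Ensures (.while b p) τ fun s υ =>
        Q (b.time + 1 + t + s) υ) ∧
      (¬ b.Holds σ → Q (b.time + 1) σ) := by
  constructor
  · rintro ⟨t, τ, hr, hq⟩
    cases hr with
    | whileTrue hb h₁ h₂ => exact ⟨fun _ => ⟨_, _, h₁, _, _, h₂, hq⟩, fun hn => absurd hb hn⟩
    | whileFalse hb => exact ⟨fun hn => absurd hn hb, fun _ => hq⟩
  · rintro ⟨h₁, h₂⟩
    by_cases hb : b.Holds σ
    · obtain ⟨t, τ, hr, s, υ, hr', hq⟩ := h₁ hb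
      exact ⟨_, _, .whileTrue hb hr hr', hq⟩
    · exact ⟨_, _, .whileFalse hb, h₂ hb⟩

/-- A loop rule: each iteration is paid for by a decrease of the potential `m`. -/
theorem ensures_while_of_potential {b : Test} {p : Program} {Inv : ℕ → Store → Prop}
    (hstep : ∀ m σ, Inv m σ → b.Holds σ →
      Ensures p σ fun t τ => ∃ m', Inv m' τ ∧ t + b.time + 1 + m' ≤ m)
    {m : ℕ} {σ : Store} (h : Inv m σ) :
    Ensures (.while b p) σ fun t τ =>
      ∃ m', Inv m' τ ∧ ¬ b.Holds τ ∧ t + m' ≤ m + b.time + 1 := by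
  -- The cost of the test alone makes the potential drop strictly, so the same induction gives
  -- termination.
  induction m using Nat.strong_induction_on generalizing σ with
  | _ m ih =>
    rw [ensures_while]
    refine ⟨fun hb => ?_, fun hb => ⟨m, h, hb, by omega⟩⟩
    refine (hstep m σ h hb).mono fun t τ ⟨m', hm', ht⟩ => ?_
    refine (ih m' (by omega) hm').mono fun s υ ⟨m'', h₁, h₂, h₃⟩ => ⟨m'', h₁, h₂, by omega⟩

/-! ### Reading an updated store -/

namespace Store

variable (σ : Store) (x a i v : ℕ) (r : ℝ)

@[simp] theorem natVar_setNatVar :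
    (σ.setNatVar x v).natVar = Function.update σ.natVar x v := rfl
@[simp] theorem natArr_setNatVar : (σ.setNatVar x v).natArr = σ.natArr := rfl
@[simp] theorem realVar_setNatVar : (σ.setNatVar x v).realVar = σ.realVar := rfl
@[simp] theorem realArr_setNatVar : (σ.setNatVar x v).realArr = σ.realArr := rfl
@[simp] theorem natVar_setNatArr : (σ.setNatArr a i v).natVar = σ.natVar := rfl
@[simp] theorem natArr_setNatArr : (σ.setNatArr a i v).natArr =
    Function.update σ.natArr a (Function.update (σ.natArr a) i v) := rfl
@[simp] theorem realVar_setNatArr : (σ.setNatArr a i v).realVar = σ.realVar := rfl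
@[simp] theorem realArr_setNatArr : (σ.setNatArr a i v).realArr = σ.realArr := rfl
@[simp] theorem natVar_setRealVar : (σ.setRealVar x r).natVar = σ.natVar := rfl
@[simp] theorem natArr_setRealVar : (σ.setRealVar x r).natArr = σ.natArr := rfl
@[simp] theorem realVar_setRealVar :
    (σ.setRealVar x r).realVar = Function.update σ.realVar x r := rfl
@[simp] theorem realArr_setRealVar : (σ.setRealVar x r).realArr = σ.realArr := rfl
@[simp] theorem natVar_setRealArr : (σ.setRealArr a i r).natVar = σ.natVar := rfl
@[simp] theorem natArr_setRealArr : (σ.setRealArr a i r).natArr = σ.natArr := rfl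
@[simp] theorem realVar_setRealArr : (σ.setRealArr a i r).realVar = σ.realVar := rfl
@[simp] theorem realArr_setRealArr : (σ.setRealArr a i r).realArr =
    Function.update σ.realArr a (Function.update (σ.realArr a) i r) := rfl

end Store

infixr:60 ";;" => Program.seq

/-! ### Heaps with relative keys

A heap of kind `k` occupies the natural-number arrays `left k` and `right k` (children, `0` being
the empty heap) and the real arrays `keyDiff k` and `payDiff k` (key and payload of a node, minus
those of its parent) and `sizeArr k` (the number of nodes below, in a fixed unit). -/

abbrev left (k : ℕ) : ℕ := 3 * k + 20
abbrev right (k : ℕ) : ℕ := 3 * k + 21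
abbrev rootArr (k : ℕ) : ℕ := 3 * k + 22
abbrev keyDiff (k : ℕ) : ℕ := 3 * k + 20
abbrev payDiff (k : ℕ) : ℕ := 3 * k + 21
abbrev sizeArr (k : ℕ) : ℕ := 3 * k + 22

/-- `Heap k σ u κ α x y i S`: in the store `σ`, the node `i` is the root of a heap with node set
`S`, keys `κ` and payloads `α`, stored relative to the key `x` and the payload `y`; sizes are
counted in the unit `u`. -/
inductive Heap (k : ℕ) (σ : Store) (u : ℝ) (κ α : ℕ → ℝ) : ℝ → ℝ → ℕ → Finset ℕ → Prop where
  | nil (x y : ℝ) : Heap k σ u κ α x y 0 ∅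
  | node {x y : ℝ} {j : ℕ} {S₁ S₂ : Finset ℕ} (hj : j ≠ 0) (h₁ : j ∉ S₁) (h₂ : j ∉ S₂)
      (hd : Disjoint S₁ S₂) (hm₁ : ∀ z ∈ S₁, κ j ≤ κ z) (hm₂ : ∀ z ∈ S₂, κ j ≤ κ z)
      (hk : σ.realArr (keyDiff k) j = κ j - x) (hp : σ.realArr (payDiff k) j = α j - y)
      (hs : σ.realArr (sizeArr k) j = (S₁.card + S₂.card + 1 : ℕ) * u)
      (hl : Heap k σ u κ α (κ j) (α j) (σ.natArr (left k) j) S₁)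
      (hr : Heap k σ u κ α (κ j) (α j) (σ.natArr (right k) j) S₂) :
      Heap k σ u κ α x y j (insert j (S₁ ∪ S₂))

/-- The two stores agree on the entries of the heap node `z`. -/
def SameNode (k : ℕ) (σ τ : Store) (z : ℕ) : Prop :=
  τ.natArr (left k) z = σ.natArr (left k) z ∧ τ.natArr (right k) z = σ.natArr (right k) z ∧
  τ.realArr (keyDiff k) z = σ.realArr (keyDiff k) z ∧
  τ.realArr (payDiff k) z = σ.realArr (payDiff k) z ∧
  τ.realArr (sizeArr k) z = σ.realArr (sizeArr k) z

namespace Heap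

variable {k : ℕ} {σ τ : Store} {u x y : ℝ} {κ α κ' α' : ℕ → ℝ} {i : ℕ} {S : Finset ℕ}

theorem zero_notMem (h : Heap k σ u κ α x y i S) : 0 ∉ S := by
  induction h with
  | nil => simp
  | node hj _ _ _ _ _ _ _ _ _ _ ih₁ ih₂ => simp [ih₁, ih₂, hj.symm]

theorem eq_zero_iff (h : Heap k σ u κ α x y i S) : i = 0 ↔ S = ∅ := by
  cases h with
  | nil => simp
  | node hj => simp [hj]

theorem root_mem (h : Heap k σ u κ α x y i S) (hi : i ≠ 0) : i ∈ S := by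
  cases h with
  | nil => exact absurd rfl hi
  | node => simp

theorem root_le (h : Heap k σ u κ α x y i S) {z : ℕ} (hz : z ∈ S) : κ i ≤ κ z := by
  cases h with
  | nil => simp at hz
  | node _ _ _ _ hm₁ hm₂ =>
    simp only [Finset.mem_insert, Finset.mem_union] at hz
    rcases hz with rfl | hz | hz
    · exact le_rfl
    · exact hm₁ _ hz
    · exact hm₂ _ hz

theorem key_root (h : Heap k σ u κ α x y i S) (hi : i ≠ 0) :
    σ.realArr (keyDiff k) i = κ i - x := by
  cases h with
  | nil => exact absurd rfl hi
  | node _ _ _ _ _ _ hk => exact hk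

theorem pay_root (h : Heap k σ u κ α x y i S) (hi : i ≠ 0) :
    σ.realArr (payDiff k) i = α i - y := by
  cases h with
  | nil => exact absurd rfl hi
  | node _ _ _ _ _ _ _ hp => exact hp

/-- With a zero in entry `0`, the size of a possibly empty heap can be read without a case
distinction. -/
theorem size_root (h : Heap k σ u κ α x y i S) (h0 : σ.realArr (sizeArr k) 0 = 0) :
    σ.realArr (sizeArr k) i = S.card * u := by
  cases h with
  | nil => simp [h0]
  | node _ h₁ h₂ hd _ _ _ _ hs =>
    rw [hs, Finset.card_insert_of_notMem (by simp [h₁, h₂]), Finset.card_union_of_disjoint hd]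

/-- A heap depends only on the entries of its nodes. -/
theorem congr (h : Heap k σ u κ α x y i S) (hS : ∀ z ∈ S, SameNode k σ τ z)
    (hκ : ∀ z ∈ S, κ' z = κ z) (hα : ∀ z ∈ S, α' z = α z) :
    Heap k τ u κ' α' x y i S := by
  induction h with
  | nil => exact .nil _ _
  | @node x y j S₁ S₂ hj h₁ h₂ hd hm₁ hm₂ hk' hp' hs' hl' hr' ih₁ ih₂ =>
    simp only [Finset.mem_insert, Finset.mem_union, or_imp, forall_and, forall_eq] at hS hκ hα
    obtain ⟨⟨el, er, ek, ep, es⟩, hS₁, hS₂⟩ := hS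
    refine .node hj h₁ h₂ hd ?_ ?_ ?_ ?_ ?_ ?_ ?_
    · intro z hz; rw [hκ.1, hκ.2.1 z hz]; exact hm₁ z hz
    · intro z hz; rw [hκ.1, hκ.2.2 z hz]; exact hm₂ z hz
    · rw [ek, hκ.1, hk']
    · rw [ep, hα.1, hp']
    · rw [es, hs']
    · rw [el, hκ.1, hα.1]
      exact ih₁ hS₁ hκ.2.1 hα.2.1
    · rw [er, hκ.1, hα.1]
      exact ih₂ hS₂ hκ.2.2 hα.2.2

/-- Only the root of a heap refers to the base values. -/
theorem rebase (h : Heap k σ u κ α x y i S) {x' y' : ℝ}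
    (hS : ∀ z ∈ S, z ≠ i → SameNode k σ τ z)
    (hl : i ∈ S → τ.natArr (left k) i = σ.natArr (left k) i)
    (hr : i ∈ S → τ.natArr (right k) i = σ.natArr (right k) i)
    (hs : i ∈ S → τ.realArr (sizeArr k) i = σ.realArr (sizeArr k) i)
    (hk : i ∈ S → τ.realArr (keyDiff k) i = κ i - x')
    (hp : i ∈ S → τ.realArr (payDiff k) i = α i - y') :
    Heap k τ u κ α x' y' i S := by
  cases h with
  | nil => exact .nil _ _
  | @node _ _ _ S₁ S₂ hj h₁ h₂ hd hm₁ hm₂ hk' hp' hs' hl' hr' =>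
    have hi : i ∈ insert i (S₁ ∪ S₂) := by simp
    refine .node hj h₁ h₂ hd hm₁ hm₂ (hk hi) (hp hi) ((hs hi).trans hs') ?_ ?_
    · rw [hl hi]
      exact hl'.congr (fun z hz => hS z (by simp [hz]) fun e => h₁ (e ▸ hz))
        (fun _ _ => rfl) fun _ _ => rfl
    · rw [hr hi]
      exact hr'.congr (fun z hz => hS z (by simp [hz]) fun e => h₂ (e ▸ hz))
        (fun _ _ => rfl) fun _ _ => rfl

/-- Differences are unaffected by a common shift of keys and base. Together with `rebase`, which
moves the base back by changing only the root, this makes adding a constant to a whole heap a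
constant-time operation. -/
theorem translate (h : Heap k σ u κ α x y i S) (a b : ℝ) :
    Heap k σ u (fun z => κ z + a) (fun z => α z + b) (x + a) (y + b) i S := by
  induction h with
  | nil => exact .nil _ _
  | node hj h₁ h₂ hd hm₁ hm₂ hk' hp' hs' hl' hr' ih₁ ih₂ =>
    refine .node hj h₁ h₂ hd ?_ ?_ ?_ ?_ hs' ih₁ ih₂
    · intro z hz; simpa using hm₁ z hz
    · intro z hz; simpa using hm₂ z hz
    · rw [hk']; ring
    · rw [hp']; ring

theorem children (h : Heap k σ u κ α x y i S) (hi : i ≠ 0) :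
    ∃ S₁ S₂, S = insert i (S₁ ∪ S₂) ∧ i ∉ S₁ ∧ i ∉ S₂ ∧ Disjoint S₁ S₂ ∧
      Heap k σ u κ α (κ i) (α i) (σ.natArr (left k) i) S₁ ∧
      Heap k σ u κ α (κ i) (α i) (σ.natArr (right k) i) S₂ := by
  cases h with
  | nil => exact absurd rfl hi
  | node hj h₁ h₂ hd hm₁ hm₂ hk' hp' hs' hl' hr' => exact ⟨_, _, rfl, h₁, h₂, hd, hl', hr'⟩

end Heap
end ChainPartition

end

noncomputable section

namespace ChainPartition

/-! ### Melding two heaps -/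

open Program NatExp RealExp Test

/-- Hangs the root in variable `10` into the right slot of node `12`, and goes on with the smaller
of its subheaps and the heap in variable `11`. -/
def meldStep (k : ℕ) : Program :=
  setNatArr (right k) (.var 12) (.var 10);;
  setRealArr (keyDiff k) (.var 11)
    (.sub (.get (keyDiff k) (.var 11)) (.get (keyDiff k) (.var 10)));;
  setRealArr (payDiff k) (.var 11)
    (.sub (.get (payDiff k) (.var 11)) (.get (payDiff k) (.var 10)));;
  setRealArr (sizeArr k) (.var 10)
    (.add (.get (sizeArr k) (.var 10)) (.get (sizeArr k) (.var 11)));;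
  setNatVar 12 (.var 10);;
  ite (.realLe (.get (sizeArr k) (.get (left k) (.var 12)))
      (.get (sizeArr k) (.get (right k) (.var 12))))
    (setNatVar 10 (.get (left k) (.var 12));;
      setNatArr (left k) (.var 12) (.get (right k) (.var 12)))
    (setNatVar 10 (.get (right k) (.var 12)))

def swapRoots (k : ℕ) : Program :=
  ite (.realLe (.get (keyDiff k) (.var 10)) (.get (keyDiff k) (.var 11))) skip
    (setNatVar 14 (.var 10);; setNatVar 10 (.var 11);; setNatVar 11 (.var 14))

/-- Variable `12` is the last node of the part already melded, and its right slot awaits the rest.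
Starting with the dummy node `0` spares a special case for the first root. -/
def meldLoop (k : ℕ) : Program :=
  .while (.and (.not (.natEq (.var 10) (.const 0))) (.not (.natEq (.var 11) (.const 0))))
      (swapRoots k;; meldStep k);;
  ite (.natEq (.var 10) (.const 0)) (setNatArr (right k) (.var 12) (.var 11))
    (setNatArr (right k) (.var 12) (.var 10))

/-- Melds the heaps in variables `10` and `11`; the result is stored in the right slot of `0`. -/
def meld (k : ℕ) : Program := setNatVar 12 (.const 0);; meldLoop k

/-- What a heap operation of kind `k` leaves unchanged. -/
structure HeapFrame (k : ℕ) (σ τ : Store) : Prop where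
  natVar : ∀ x, x < 10 → τ.natVar x = σ.natVar x
  natArr : ∀ a, a ≠ left k → a ≠ right k → a ≠ rootArr k → τ.natArr a = σ.natArr a
  realVar : τ.realVar = σ.realVar
  realArr : ∀ a, a ≠ keyDiff k → a ≠ payDiff k → a ≠ sizeArr k → τ.realArr a = σ.realArr a

theorem HeapFrame.trans {k : ℕ} {σ τ υ : Store} (h : HeapFrame k σ τ) (h' : HeapFrame k τ υ) :
    HeapFrame k σ υ :=
  ⟨fun x hx => (h'.natVar x hx).trans (h.natVar x hx),
    fun a h₁ h₂ h₃ => (h'.natArr a h₁ h₂ h₃).trans (h.natArr a h₁ h₂ h₃),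
    h'.realVar.trans h.realVar,
    fun a h₁ h₂ h₃ => (h'.realArr a h₁ h₂ h₃).trans (h.realArr a h₁ h₂ h₃)⟩

theorem SameNode.trans {k : ℕ} {σ τ υ : Store} {z : ℕ} (h : SameNode k σ τ z)
    (h' : SameNode k τ υ z) : SameNode k σ υ z :=
  ⟨h'.1.trans h.1, h'.2.1.trans h.2.1, h'.2.2.1.trans h.2.2.1, h'.2.2.2.1.trans h.2.2.2.1,
    h'.2.2.2.2.trans h.2.2.2.2⟩

/-- The stores agree on the node `z` except possibly for its right slot. -/
def SameNodeLeft (k : ℕ) (σ τ : Store) (z : ℕ) : Prop :=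
  τ.natArr (left k) z = σ.natArr (left k) z ∧
  τ.realArr (keyDiff k) z = σ.realArr (keyDiff k) z ∧
  τ.realArr (payDiff k) z = σ.realArr (payDiff k) z ∧
  τ.realArr (sizeArr k) z = σ.realArr (sizeArr k) z

theorem SameNodeLeft.trans {k : ℕ} {σ τ υ : Store} {z : ℕ} (h : SameNodeLeft k σ τ z)
    (h' : SameNodeLeft k τ υ z) : SameNodeLeft k σ υ z :=
  ⟨h'.1.trans h.1, h'.2.1.trans h.2.1, h'.2.2.1.trans h.2.2.1, h'.2.2.2.trans h.2.2.2⟩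

theorem SameNode.sameNodeLeft {k : ℕ} {σ τ : Store} {z : ℕ} (h : SameNode k σ τ z) :
    SameNodeLeft k σ τ z :=
  ⟨h.1, h.2.2.1, h.2.2.2.1, h.2.2.2.2⟩

variable {k : ℕ} {σ : Store} {u x y : ℝ} {κ α : ℕ → ℝ} {a b z : ℕ} {S S' : Finset ℕ}

/-- `S₂` is the smaller subheap of `a`, whence `2 * S₂.card + 1 ≤ S.card`; `S₁` stays on the left.
`S₂` and `S'` are now both relative to the key and payload of `a`, so the same problem remains one
level down. The size written at `a` already counts `S'`. -/
theorem ensures_meldStep (hu : 0 < u) (h0 : σ.realArr (sizeArr k) 0 = 0)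
    (ha : σ.natVar 10 = a) (hb : σ.natVar 11 = b) (hz : σ.natVar 12 = z)
    (hS : Heap k σ u κ α x y a S) (hS' : Heap k σ u κ α x y b S') (ha0 : a ≠ 0) (hb0 : b ≠ 0)
    (hd : Disjoint S S') (hzS : z ∉ S) (hzS' : z ∉ S') :
    Ensures (meldStep k) σ fun t τ => t ≤ 50 ∧
      ∃ (c : ℕ) (S₁ S₂ : Finset ℕ), S = insert a (S₁ ∪ S₂) ∧ a ∉ S₁ ∧ a ∉ S₂ ∧
        Disjoint S₁ S₂ ∧ 2 * S₂.card + 1 ≤ S.card ∧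
        τ.natVar 10 = c ∧ τ.natVar 11 = b ∧ τ.natVar 12 = a ∧
        τ.natArr (right k) z = a ∧
        τ.realArr (keyDiff k) a = κ a - x ∧ τ.realArr (payDiff k) a = α a - y ∧
        τ.realArr (sizeArr k) a = (S.card + S'.card : ℕ) * u ∧
        Heap k τ u κ α (κ a) (α a) (τ.natArr (left k) a) S₁ ∧
        Heap k τ u κ α (κ a) (α a) c S₂ ∧ Heap k τ u κ α (κ a) (α a) b S' ∧
        τ.natArr (rootArr k) = σ.natArr (rootArr k) ∧ HeapFrame k σ τ ∧
        SameNodeLeft k σ τ z ∧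
        ∀ w, w ∉ S → w ∉ S' → w ≠ z → SameNode k σ τ w := by
  obtain ⟨S₁, S₂, hSe, h₁, h₂, h₁₂, hl, hr⟩ := hS.children ha0
  have haS := hS.root_mem ha0
  have hbS' := hS'.root_mem hb0
  have hab : a ≠ b := fun e => Finset.disjoint_left.1 hd haS (e ▸ hbS')
  have hza : z ≠ a := fun e => hzS (e ▸ haS)
  have hzb : z ≠ b := fun e => hzS' (e ▸ hbS')
  have hsz := hS.size_root h0
  have hsz' := hS'.size_root h0
  have hkb := hS'.key_root hb0
  have hpb := hS'.pay_root hb0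
  have hka := hS.key_root ha0
  have hpa := hS.pay_root ha0
  have hs₁ := hl.size_root h0
  have hs₂ := hr.size_root h0
  -- Neither child of `a` is `a`, so the sizes to be compared are not affected by the update at `a`.
  have hla : σ.natArr (left k) a ≠ a := fun e => h₁ (by
    have := hl.root_mem (by rw [e]; exact ha0)
    rwa [e] at this)
  have hra : σ.natArr (right k) a ≠ a := fun e => h₂ (by
    have := hr.root_mem (by rw [e]; exact ha0)
    rwa [e] at this)
  have hcard : S.card = S₁.card + S₂.card + 1 := by
    rw [hSe, Finset.card_insert_of_notMem (by simp [h₁, h₂]), Finset.card_union_of_disjoint h₁₂]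
  have sub₁ : ∀ w ∈ S₁, w ≠ a ∧ w ≠ b ∧ w ≠ z := fun w hw => by
    have hwS : w ∈ S := by rw [hSe]; simp [hw]
    exact ⟨fun e => h₁ (e ▸ hw), fun e => Finset.disjoint_left.1 hd hwS (e ▸ hbS'),
      fun e => hzS (e ▸ hwS)⟩
  have sub₂ : ∀ w ∈ S₂, w ≠ a ∧ w ≠ b ∧ w ≠ z := fun w hw => by
    have hwS : w ∈ S := by rw [hSe]; simp [hw]
    exact ⟨fun e => h₂ (e ▸ hw), fun e => Finset.disjoint_left.1 hd hwS (e ▸ hbS'),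
      fun e => hzS (e ▸ hwS)⟩
  have sub' : ∀ w ∈ S', w ≠ a ∧ w ≠ z := fun w hw =>
    ⟨fun e => Finset.disjoint_left.1 hd haS (e ▸ hw), fun e => hzS' (e ▸ hw)⟩
  simp only [meldStep, ensures_seq, ensures_setNatArr, ensures_setRealArr, ensures_setNatVar,
    ensures_ite, NatExp.eval, RealExp.eval, Test.Holds, Store.natVar_setNatVar,
    Store.natArr_setNatVar, Store.realArr_setNatVar, Store.natVar_setNatArr,
    Store.natArr_setNatArr, Store.realArr_setNatArr, Store.natVar_setRealArr,
    Store.natArr_setRealArr, Store.realArr_setRealArr, ha, hb, hz]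
  -- Since the unit is positive, comparing the stored reals compares the numbers of nodes.
  have hc : (σ.realArr (sizeArr k) (σ.natArr (left k) a) ≤
      σ.realArr (sizeArr k) (σ.natArr (right k) a)) ↔ S₁.card ≤ S₂.card := by
    rw [hs₁, hs₂, mul_le_mul_iff_left₀ hu, Nat.cast_le]
  simp [Function.update_apply, ha, hb, hz, hza, hza.symm, hab, hab.symm, hzb, hzb.symm, hla, hra,
    hc]
  refine ⟨fun hle => ⟨by simp [NatExp.time, RealExp.time, Test.time], ?_⟩,
    fun hle => ⟨by simp [NatExp.time, RealExp.time, Test.time], ?_⟩⟩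
  · refine ⟨S₂, S₁, by rw [hSe, Finset.union_comm], h₂, h₁, h₁₂.symm, by omega, ?_⟩
    refine ⟨hka, hpa, by rw [hsz, hsz']; ring, ?_, ?_, ?_, ?_, ?_, ?_⟩
    · refine hr.congr (fun w hw => ?_) (fun _ _ => rfl) fun _ _ => rfl
      obtain ⟨wa, wb, wz⟩ := sub₂ w hw
      simp [SameNode, wa, wb, wz]
    · refine hl.congr (fun w hw => ?_) (fun _ _ => rfl) fun _ _ => rfl
      obtain ⟨wa, wb, wz⟩ := sub₁ w hw
      simp [SameNode, wa, wb, wz]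
    · refine hS'.rebase (fun w hw wb => ?_) ?_ ?_ ?_ ?_ ?_
      · obtain ⟨wa, wz⟩ := sub' w hw
        simp [SameNode, wa, wb, wz]
      all_goals simp [hab.symm, hzb.symm, hka, hkb, hpa, hpb]
    · constructor
      · intro w hw
        have h10 : w ≠ 10 := by omega
        have h12 : w ≠ 12 := by omega
        simp [h10, h12]
      · intro c h₁ h₂ h₃
        simp [h₁, h₂]
      · simp
      · intro c h₁ h₂ h₃
        simp [h₁, h₂, h₃]
    · simp [SameNodeLeft, hza, hzb]
    · intro w hw hw' hwz
      have wa : w ≠ a := fun e => hw (e ▸ haS)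
      have wb : w ≠ b := fun e => hw' (e ▸ hbS')
      simp [SameNode, wa, wb, hwz]
  · refine ⟨S₁, S₂, hSe, h₁, h₂, h₁₂, by omega, ?_⟩
    refine ⟨hka, hpa, by rw [hsz, hsz']; ring, ?_, ?_, ?_, ?_, ?_, ?_⟩
    · refine hl.congr (fun w hw => ?_) (fun _ _ => rfl) fun _ _ => rfl
      obtain ⟨wa, wb, wz⟩ := sub₁ w hw
      simp [SameNode, wa, wb, wz]
    · refine hr.congr (fun w hw => ?_) (fun _ _ => rfl) fun _ _ => rfl
      obtain ⟨wa, wb, wz⟩ := sub₂ w hw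
      simp [SameNode, wa, wb, wz]
    · refine hS'.rebase (fun w hw wb => ?_) ?_ ?_ ?_ ?_ ?_
      · obtain ⟨wa, wz⟩ := sub' w hw
        simp [SameNode, wa, wb, wz]
      all_goals simp [hab.symm, hzb.symm, hka, hkb, hpa, hpb]
    · constructor
      · intro w hw
        have h10 : w ≠ 10 := by omega
        have h12 : w ≠ 12 := by omega
        simp [h10, h12]
      · intro c h₁ h₂ h₃
        simp [h₁, h₂]
      · simp
      · intro c h₁ h₂ h₃
        simp [h₁, h₂, h₃]
    · simp [SameNodeLeft, hza, hzb]
    · intro w hw hw' hwz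
      have wa : w ≠ a := fun e => hw (e ▸ haS)
      have wb : w ≠ b := fun e => hw' (e ▸ hbS')
      simp [SameNode, wa, wb, hwz]

/-- The exponents `i` and `j` bound the logarithms of the two sizes. Every step at least halves the
heap whose root is hung up, so one exponent drops by one and `i + j` steps suffice. -/
theorem ensures_meldLoop (m : ℕ) {i j : ℕ} (hm : i + j = m) (hi : S.card < 2 ^ i)
    (hj : S'.card < 2 ^ j) (hu : S.Nonempty → S'.Nonempty → 0 < u)
    (h0 : σ.realArr (sizeArr k) 0 = 0)
    (ha : σ.natVar 10 = a) (hb : σ.natVar 11 = b) (hz : σ.natVar 12 = z)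
    (hS : Heap k σ u κ α x y a S) (hS' : Heap k σ u κ α x y b S')
    (hd : Disjoint S S') (hzS : z ∉ S) (hzS' : z ∉ S') :
    Ensures (meldLoop k) σ fun t τ => t ≤ 80 * m + 40 ∧
      Heap k τ u κ α x y (τ.natArr (right k) z) (S ∪ S') ∧
      τ.natArr (rootArr k) = σ.natArr (rootArr k) ∧ HeapFrame k σ τ ∧
      SameNodeLeft k σ τ z ∧ ∀ w, w ∉ S → w ∉ S' → w ≠ z → SameNode k σ τ w := by
  induction m using Nat.strong_induction_on generalizing σ x y a b z S S' i j with
  | _ m ih =>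
  rw [meldLoop, ensures_seq, ensures_while]
  refine ⟨fun hab => ?_, fun hab => ?_⟩
  · have ha0 : a ≠ 0 := by simpa [Test.Holds, NatExp.eval, ha] using hab.1
    have hb0 : b ≠ 0 := by simpa [Test.Holds, NatExp.eval, hb] using hab.2
    have hu' : 0 < u := hu ⟨a, hS.root_mem ha0⟩ ⟨b, hS'.root_mem hb0⟩
    -- Stated for any store and any two heaps with ordered roots, to be applied both without and
    -- with an exchange of the roots.
    have key : ∀ (σ' : Store) (a b : ℕ) (S S' : Finset ℕ) (i j : ℕ), i + j = m →
        S.card < 2 ^ i → S'.card < 2 ^ j → σ'.realArr (sizeArr k) 0 = 0 →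
        σ'.natVar 10 = a → σ'.natVar 11 = b → σ'.natVar 12 = z →
        Heap k σ' u κ α x y a S → Heap k σ' u κ α x y b S' → Disjoint S S' → z ∉ S → z ∉ S' →
        a ≠ 0 → b ≠ 0 → κ a ≤ κ b →
        Ensures (meldStep k) σ' fun t τ => Ensures (meldLoop k) τ fun s υ =>
          t + s ≤ 80 * m + 10 ∧ Heap k υ u κ α x y (υ.natArr (right k) z) (S ∪ S') ∧
          υ.natArr (rootArr k) = σ'.natArr (rootArr k) ∧ HeapFrame k σ' υ ∧
          SameNodeLeft k σ' υ z ∧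
          ∀ w, w ∉ S → w ∉ S' → w ≠ z → SameNode k σ' υ w := by
      clear! σ a b S S' i j
      intro σ a b S S' i j hm hi hj h0 ha hb hz hS hS' hd hzS hzS' ha0 hb0 hle
      refine (ensures_meldStep hu' h0 ha hb hz hS hS' ha0 hb0 hd hzS hzS').mono ?_
      rintro t τ ⟨ht, c, S₁, S₂, hSe, h₁, h₂, h₁₂, hcard, hc, hb', hz', hza, hka, hpa, hsa,
        hl, hr, hb'', hroot, hframe, hzl, hsame⟩
      have haS := hS.root_mem ha0
      have haS' : a ∉ S' := fun h => Finset.disjoint_left.1 hd haS h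
      have hS₁ : S₁ ⊆ S := by rw [hSe]; intro w; simp +contextual
      have hS₂ : S₂ ⊆ S := by rw [hSe]; intro w; simp +contextual
      have hi0 : i ≠ 0 := by rintro rfl; simp at hi; simp [hi] at haS
      obtain ⟨i', rfl⟩ := Nat.exists_eq_succ_of_ne_zero hi0
      have hi' : S₂.card < 2 ^ i' := by rw [Nat.succ_eq_add_one, pow_succ] at hi; omega
      have h0S := hS.zero_notMem
      have h0S' := hS'.zero_notMem
      have h0' : τ.realArr (sizeArr k) 0 = 0 := by
        by_cases e : 0 = z
        · rw [← e] at hzl; rw [hzl.2.2.2, h0]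
        · rw [(hsame 0 h0S h0S' e).2.2.2.2, h0]
      have hd₂ : Disjoint S₂ S' := hd.mono_left hS₂
      refine (ih (i' + j) (by omega) rfl hi' hj (fun _ _ => hu') h0' hc hb' hz' hr hb''
        hd₂ h₂ haS').mono ?_
      rintro s υ ⟨hs, hH, hroot', hframe', hzl', hsame'⟩
      have hzS₂ : z ∉ S₂ := fun h => hzS (hS₂ h)
      have hza' : z ≠ a := fun e => hzS (e ▸ haS)
      have hsz := hsame' z hzS₂ hzS' hza'
      refine ⟨by omega, ?_, hroot'.trans hroot, hframe.trans hframe',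
        hzl.trans hsz.sameNodeLeft, fun w hw hw' hwz => (hsame w hw hw' hwz).trans
          (hsame' w (fun h => hw (hS₂ h)) hw' fun e => hw (e ▸ haS))⟩
      -- The heap at `a` is assembled from the untouched `S₁` on the left and the result of the
      -- recursive meld on the right.
      have hd₁ : Disjoint S₁ (S₂ ∪ S') :=
        Finset.disjoint_union_right.2 ⟨h₁₂, hd.mono_left hS₁⟩
      have hset : S ∪ S' = insert a (S₁ ∪ (S₂ ∪ S')) := by
        rw [hSe, Finset.insert_union, Finset.union_assoc]
      rw [hset, hsz.2.1, hza]
      refine .node ha0 h₁ (by simp [h₂, haS']) hd₁ (fun w hw => hS.root_le (hS₁ hw)) ?_ ?_ ?_ ?_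
        ?_ hH
      · intro w hw
        rcases Finset.mem_union.1 hw with hw | hw
        · exact hS.root_le (hS₂ hw)
        · exact hle.trans (hS'.root_le hw)
      · rw [hzl'.2.1, hka]
      · rw [hzl'.2.2.1, hpa]
      · have e : S.card = S₁.card + S₂.card + 1 := by
          rw [hSe, Finset.card_insert_of_notMem (by simp [h₁, h₂]),
            Finset.card_union_of_disjoint h₁₂]
        rw [hzl'.2.2.2, hsa, Finset.card_union_of_disjoint hd₂, e]
        congr 2
        ring
      · rw [hzl'.1]
        refine hl.congr (fun w hw => hsame' w (fun h => Finset.disjoint_left.1 h₁₂ hw h)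
          (fun h => Finset.disjoint_left.1 hd (hS₁ hw) h) fun e => h₁ (e ▸ hw))
          (fun _ _ => rfl) fun _ _ => rfl
    rw [ensures_seq, swapRoots, ensures_ite]
    have hka := hS.key_root ha0
    have hkb := hS'.key_root hb0
    refine ⟨fun hle => ?_, fun hle => ?_⟩
    · simp only [Test.Holds, RealExp.eval, NatExp.eval, ha, hb, hka, hkb] at hle
      rw [ensures_skip]
      refine (key σ a b S S' i j hm hi hj h0 ha hb hz hS hS' hd hzS hzS' ha0 hb0
        (by linarith)).mono ?_
      rintro t τ h
      rw [meldLoop, ensures_seq] at h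
      refine h.mono fun s υ h => h.mono fun r ρ h => ⟨?_, h.2⟩
      simp [Test.time, NatExp.time, RealExp.time]
      omega
    · simp only [Test.Holds, RealExp.eval, NatExp.eval, ha, hb, hka, hkb] at hle
      simp only [ensures_seq, ensures_setNatVar]
      have hc : ∀ {i S}, Heap k σ u κ α x y i S → Heap k (((σ.setNatVar 14 a).setNatVar 10 b).setNatVar 11 a) u κ α x y i S :=
        fun h => h.congr (fun w _ => by simp [SameNode]) (fun _ _ => rfl) fun _ _ => rfl
      simp [NatExp.eval, ha, hb]
      refine (key _ b a S' S j i (by omega) hj hi (by simpa using h0) (by simp) (by simp)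
        (by simpa using hz) (hc hS') (hc hS) hd.symm hzS' hzS hb0 ha0
        (by linarith)).mono ?_
      rintro t τ h
      rw [meldLoop, ensures_seq] at h
      refine h.mono fun s υ h => h.mono ?_
      rintro r ρ ⟨h₁, h₂, h₃, h₄, h₅, h₆⟩
      refine ⟨?_, by rwa [Finset.union_comm], h₃, ?_, h₅, fun w hw hw' => h₆ w hw' hw⟩
      · simp [Test.time, NatExp.time, RealExp.time]
        omega
      · refine HeapFrame.trans ?_ h₄
        refine ⟨?_, fun _ _ _ _ => rfl, rfl, fun _ _ _ _ => rfl⟩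
        intro w hw
        have e10 : w ≠ 10 := by omega
        have e11 : w ≠ 11 := by omega
        have e14 : w ≠ 14 := by omega
        simp [e10, e11, e14]
  · have hz0 : ∀ (c : ℕ), HeapFrame k σ (σ.setNatArr (right k) z c) ∧
        SameNodeLeft k σ (σ.setNatArr (right k) z c) z ∧
        ∀ w ≠ z, SameNode k σ (σ.setNatArr (right k) z c) w := by
      refine fun c => ⟨⟨fun _ _ => rfl, fun d h₁ h₂ h₃ => by simp [h₂], rfl,
        fun _ _ _ _ => rfl⟩, by simp [SameNodeLeft], fun w hw => by simp [SameNode, hw]⟩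
    simp only [ensures_ite, ensures_setNatArr, Test.Holds, NatExp.eval, ha, hb, hz]
    refine ⟨fun h => ⟨by simp [Test.time, NatExp.time], ?_, by simp, (hz0 _).1, (hz0 _).2.1,
      fun w _ _ => (hz0 _).2.2 w⟩, fun h => ⟨by simp [Test.time, NatExp.time], ?_, by simp,
      (hz0 _).1, (hz0 _).2.1, fun w _ _ => (hz0 _).2.2 w⟩⟩
    · rw [hS.eq_zero_iff.1 h, Finset.empty_union]
      simp only [Store.natArr_setNatArr, Function.update_self]
      exact hS'.congr (fun w hw => (hz0 _).2.2 w fun e => hzS' (e ▸ hw))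
        (fun _ _ => rfl) fun _ _ => rfl
    · have hb0 : b = 0 := by
        by_contra hb0
        exact hab ⟨by simpa [Test.Holds, NatExp.eval, ha] using h,
          by simpa [Test.Holds, NatExp.eval, hb] using hb0⟩
      rw [hS'.eq_zero_iff.1 hb0, Finset.union_empty]
      simp only [Store.natArr_setNatArr, Function.update_self]
      exact hS.congr (fun w hw => (hz0 _).2.2 w fun e => hzS (e ▸ hw))
        (fun _ _ => rfl) fun _ _ => rfl

theorem ensures_meld {l : ℕ} (hi : S.card < 2 ^ l)
    (hj : S'.card < 2 ^ l) (hu : S.Nonempty → S'.Nonempty → 0 < u)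
    (h0 : σ.realArr (sizeArr k) 0 = 0)
    (hS : Heap k σ u κ α x y (σ.natVar 10) S) (hS' : Heap k σ u κ α x y (σ.natVar 11) S')
    (hd : Disjoint S S') :
    Ensures (meld k) σ fun t τ => t ≤ 160 * l + 42 ∧
      Heap k τ u κ α x y (τ.natArr (right k) 0) (S ∪ S') ∧
      τ.natArr (rootArr k) = σ.natArr (rootArr k) ∧ HeapFrame k σ τ ∧
      τ.realArr (sizeArr k) 0 = 0 ∧ ∀ w, w ∉ S → w ∉ S' → w ≠ 0 → SameNode k σ τ w := by
  rw [meld, ensures_seq, ensures_setNatVar]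
  have hc : ∀ {i S}, Heap k σ u κ α x y i S →
      Heap k (σ.setNatVar 12 (NatExp.eval σ (.const 0))) u κ α x y i S :=
    fun h => h.congr (fun w _ => by simp [SameNode]) (fun _ _ => rfl) fun _ _ => rfl
  refine (ensures_meldLoop (l + l) rfl hi hj hu (by simpa using h0) (by simp) (by simp)
    (by simp [NatExp.eval]) (hc hS) (hc hS') hd hS.zero_notMem hS'.zero_notMem).mono ?_
  rintro t τ ⟨h₁, h₂, h₃, h₄, h₅, h₆⟩
  refine ⟨?_, h₂, h₃, ?_, h₅.2.2.2.trans h0, h₆⟩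
  · simp [NatExp.time]
    omega
  · refine HeapFrame.trans ?_ h₄
    refine ⟨?_, fun _ _ _ _ => rfl, rfl, fun _ _ _ _ => rfl⟩
    intro w hw
    have e12 : w ≠ 12 := by omega
    simp [e12]

end ChainPartition

end

noncomputable section

namespace ChainPartition

/-! ### Families of disjoint heaps -/

open Program NatExp RealExp Test

/-- The roots stored in the array `rootArr k` are those of disjoint heaps with node sets `S`. -/
structure HeapFam (n k : ℕ) (σ : Store) (u : ℝ) (S : ℕ → Finset ℕ) (κ α : ℕ → ℝ) : Prop where
  heap : ∀ v, Heap k σ u κ α 0 0 (σ.natArr (rootArr k) v) (S v)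
  disjoint : ∀ v w, v ≠ w → Disjoint (S v) (S w)
  subset : ∀ v, S v ⊆ Finset.Icc 1 n
  size_zero : σ.realArr (sizeArr k) 0 = 0

/-! ### Operations on one member of a family of heaps. -/

variable {n k l : ℕ} {σ τ : Store} {u : ℝ} {S : ℕ → Finset ℕ} {κ α κ' α' : ℕ → ℝ} {v w x y : ℕ}
  {A B : Finset ℕ}

theorem HeapFam.congr (h : HeapFam n k σ u S κ α)
    (hl : τ.natArr (left k) = σ.natArr (left k)) (hr : τ.natArr (right k) = σ.natArr (right k))
    (hroot : τ.natArr (rootArr k) = σ.natArr (rootArr k))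
    (hk : τ.realArr (keyDiff k) = σ.realArr (keyDiff k))
    (hp : τ.realArr (payDiff k) = σ.realArr (payDiff k))
    (hs : τ.realArr (sizeArr k) = σ.realArr (sizeArr k))
    (hκ : ∀ q, ∀ z ∈ S q, κ' z = κ z) (hα : ∀ q, ∀ z ∈ S q, α' z = α z) :
    HeapFam n k τ u S κ' α' where
  heap v := by
    rw [hroot]
    exact (h.heap v).congr (fun z _ => ⟨by rw [hl], by rw [hr], by rw [hk], by rw [hp], by rw [hs]⟩)
      (hκ v) (hα v)
  disjoint := h.disjoint
  subset := h.subset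
  size_zero := by rw [hs, h.size_zero]

/-- Melds the heaps in variables `10` and `11` into the heap with the index in variable `x`. -/
def meldTo (k x : ℕ) : Program :=
  meld k;; setNatArr (rootArr k) (.var x) (.get (right k) (.const 0))

/-- Moves the nodes of the heap with the index in variable `y` into that with the index in `x`. -/
def meldInto (k x y : ℕ) : Program :=
  setNatVar 10 (.get (rootArr k) (.var x));;
  setNatVar 11 (.get (rootArr k) (.var y));;
  setNatArr (rootArr k) (.var y) (.const 0);;
  meldTo k x

/-- Removes the root of the heap with the index in variable `x`. -/
def popHeap (k x : ℕ) : Program :=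
  setNatVar 13 (.get (rootArr k) (.var x));;
  setNatVar 10 (.get (left k) (.var 13));;
  setNatVar 11 (.get (right k) (.var 13));;
  setRealArr (keyDiff k) (.var 10)
    (.add (.get (keyDiff k) (.var 10)) (.get (keyDiff k) (.var 13)));;
  setRealArr (payDiff k) (.var 10)
    (.add (.get (payDiff k) (.var 10)) (.get (payDiff k) (.var 13)));;
  setRealArr (keyDiff k) (.var 11)
    (.add (.get (keyDiff k) (.var 11)) (.get (keyDiff k) (.var 13)));;
  setRealArr (payDiff k) (.var 11)
    (.add (.get (payDiff k) (.var 11)) (.get (payDiff k) (.var 13)));;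
  meldTo k x

/-- Inserts the node in variable `y` into the heap with the index in variable `x`; its key is in
real variable `2`, its payload in real variable `3`. -/
def insertHeap (k x y : ℕ) : Program :=
  setNatArr (left k) (.var y) (.const 0);;
  setNatArr (right k) (.var y) (.const 0);;
  setRealArr (keyDiff k) (.var y) (.var 2);;
  setRealArr (payDiff k) (.var y) (.var 3);;
  setRealArr (sizeArr k) (.var y) (.var 1);;
  setNatVar 10 (.get (rootArr k) (.var x));;
  setNatVar 11 (.var y);;
  meldTo k x

/-- Adds real variables `2` and `3` to all keys and payloads of the heap with the index in variable
`x`. -/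
def addHeap (k x : ℕ) : Program :=
  setNatVar 10 (.get (rootArr k) (.var x));;
  setRealArr (keyDiff k) (.var 10) (.add (.get (keyDiff k) (.var 10)) (.var 2));;
  setRealArr (payDiff k) (.var 10) (.add (.get (payDiff k) (.var 10)) (.var 3))

/-- The index `v` is exempt from the hypotheses on the family because its old heap may have been
taken apart: `A` and `B` are loose heaps, and their meld becomes the new heap at `v`. -/
theorem ensures_meldTo (hl : n < 2 ^ l) (hu : 2 ≤ n → 0 < u) (hx : x < 10) (hv : σ.natVar x = v)
    (hheap : ∀ q ≠ v, Heap k σ u κ α 0 0 (σ.natArr (rootArr k) q) (S q))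
    (hdisj : ∀ q q', q ≠ q' → q ≠ v → q' ≠ v → Disjoint (S q) (S q'))
    (hsub : ∀ q ≠ v, S q ⊆ Finset.Icc 1 n) (hsize : σ.realArr (sizeArr k) 0 = 0)
    (hA : Heap k σ u κ α 0 0 (σ.natVar 10) A) (hB : Heap k σ u κ α 0 0 (σ.natVar 11) B)
    (hAB : Disjoint A B) (hAn : A ⊆ Finset.Icc 1 n) (hBn : B ⊆ Finset.Icc 1 n)
    (hAS : ∀ q ≠ v, Disjoint A (S q)) (hBS : ∀ q ≠ v, Disjoint B (S q)) :
    Ensures (meldTo k x) σ fun t τ => t ≤ 160 * l + 50 ∧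
      HeapFam n k τ u (Function.update S v (A ∪ B)) κ α ∧ HeapFrame k σ τ := by
  have hcA : A.card < 2 ^ l := (Finset.card_le_card hAn).trans_lt (by simpa using hl)
  have hcB : B.card < 2 ^ l := (Finset.card_le_card hBn).trans_lt (by simpa using hl)
  -- Two disjoint nonempty subsets of `1, …, n` force `2 ≤ n`, the only case in which the unit is
  -- known to be positive.
  have hu' : A.Nonempty → B.Nonempty → 0 < u := by
    rintro ⟨a, ha⟩ ⟨b, hb⟩
    refine hu ?_
    have hab : a ≠ b := fun e => Finset.disjoint_left.1 hAB ha (e ▸ hb)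
    have h₁ := Finset.mem_Icc.1 (hAn ha)
    have h₂ := Finset.mem_Icc.1 (hBn hb)
    omega
  rw [meldTo, ensures_seq]
  refine (ensures_meld hcA hcB hu' hsize hA hB hAB).mono ?_
  rintro t τ ⟨ht, hH, hroot, hframe, hsize', hsame⟩
  rw [ensures_setNatArr]
  have hvx : τ.natVar x = v := (hframe.natVar x hx).trans hv
  simp only [NatExp.eval, hvx]
  refine ⟨by simp [NatExp.time]; omega, ⟨?_, ?_, ?_, ?_⟩, ?_⟩
  · intro q
    by_cases hq : q = v
    · subst hq
      simp only [Function.update_self, Store.natArr_setNatArr]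
      exact hH.congr (fun z _ => by simp [SameNode]) (fun _ _ => rfl) fun _ _ => rfl
    · simp only [Function.update_of_ne hq, Store.natArr_setNatArr, Function.update_self, hroot]
      have h0 := (hheap q hq).zero_notMem
      refine (hheap q hq).congr (fun z hz => ?_) (fun _ _ => rfl) fun _ _ => rfl
      refine (hsame z (fun h => Finset.disjoint_left.1 (hAS q hq) h hz)
        (fun h => Finset.disjoint_left.1 (hBS q hq) h hz) (fun e => h0 (e ▸ hz))).trans ?_
      simp [SameNode]
  · intro q q' hqq
    by_cases hq : q = v
    · subst hq
      rw [Function.update_self, Function.update_of_ne hqq.symm]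
      exact Finset.disjoint_union_left.2 ⟨hAS q' hqq.symm, hBS q' hqq.symm⟩
    · by_cases hq' : q' = v
      · subst hq'
        rw [Function.update_self, Function.update_of_ne hqq]
        exact (Finset.disjoint_union_left.2 ⟨hAS q hqq, hBS q hqq⟩).symm
      · rw [Function.update_of_ne hq, Function.update_of_ne hq']
        exact hdisj q q' hqq hq hq'
  · intro q
    by_cases hq : q = v
    · subst hq
      rw [Function.update_self]
      exact Finset.union_subset hAn hBn
    · rw [Function.update_of_ne hq]
      exact hsub q hq
  · simpa using hsize'
  · refine hframe.trans ⟨fun _ _ => rfl, fun a h₁ h₂ h₃ => ?_, rfl, fun _ _ _ _ => rfl⟩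
    simp [h₃]

theorem ensures_meldInto (h : HeapFam n k σ u S κ α) (hl : n < 2 ^ l) (hu : 2 ≤ n → 0 < u)
    (hx : x < 10) (hy : y < 10) (hv : σ.natVar x = v) (hw : σ.natVar y = w) (hvw : v ≠ w) :
    Ensures (meldInto k x y) σ fun t τ => t ≤ 160 * l + 100 ∧
      HeapFam n k τ u (Function.update (Function.update S w ∅) v (S v ∪ S w)) κ α ∧
      HeapFrame k σ τ := by
  have hx10 : x ≠ 10 := by omega
  have hx11 : x ≠ 11 := by omega
  have hy10 : y ≠ 10 := by omega
  have hy11 : y ≠ 11 := by omega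
  simp only [meldInto, ensures_seq, ensures_setNatVar, ensures_setNatArr, NatExp.eval,
    Store.natVar_setNatVar, Store.natArr_setNatVar, hv, hw, Function.update_of_ne hx10,
    Function.update_of_ne hx11, Function.update_of_ne hy10, Function.update_of_ne hy11]
  have hc : ∀ {a b c : ℕ} {i S}, Heap k σ u κ α 0 0 i S →
      Heap k (((σ.setNatVar 10 a).setNatVar 11 b).setNatArr (rootArr k) w c) u κ α 0 0 i S :=
    fun h => h.congr (fun z _ => by simp [SameNode]) (fun _ _ => rfl) fun _ _ => rfl
  refine (ensures_meldTo (S := Function.update S w ∅) (κ := κ) (α := α) (v := v) (A := S v)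
    (B := S w) hl hu hx
    ?_ ?_ ?_ ?_ ?_ ?_ ?_ ?_ ?_ ?_ ?_ ?_).mono ?_
  · simpa [hx10, hx11] using hv
  · intro q hq
    by_cases hqw : q = w
    · subst hqw
      simpa using Heap.nil _ _
    · simpa [hqw] using hc (h.heap q)
  · intro q q' hqq _ _
    by_cases hqw : q = w
    · simp [hqw]
    · by_cases hqw' : q' = w
      · simp [hqw']
      · rw [Function.update_of_ne hqw, Function.update_of_ne hqw']
        exact h.disjoint q q' hqq
  · intro q hq
    by_cases hqw : q = w
    · simp [hqw]
    · rw [Function.update_of_ne hqw]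
      exact h.subset q
  · simpa using h.size_zero
  · simpa using hc (h.heap v)
  · simpa using hc (h.heap w)
  · exact h.disjoint v w hvw
  · exact h.subset v
  · exact h.subset w
  · intro q hq
    by_cases hqw : q = w
    · simp [hqw]
    · rw [Function.update_of_ne hqw]
      exact h.disjoint v q hq.symm
  · intro q hq
    by_cases hqw : q = w
    · simp [hqw]
    · rw [Function.update_of_ne hqw]
      exact h.disjoint w q fun e => hqw e.symm
  · rintro t τ ⟨ht, h₁, h₂⟩
    refine ⟨by simp [NatExp.time]; omega, h₁, HeapFrame.trans ?_ h₂⟩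
    refine ⟨fun z hz => ?_, fun a h₁ h₂ h₃ => ?_, rfl, fun _ _ _ _ => rfl⟩
    · have h10 : z ≠ 10 := by omega
      have h11 : z ≠ 11 := by omega
      simp [h10, h11]
    · simp [h₃]

/-- The children store differences to the removed root; adding the entries of the root makes them
relative to `0`. An absent child is entry `0`, whose key and payload may be spoiled since `0` is a
node of no heap, while its size stays zero. -/
theorem ensures_popHeap (h : HeapFam n k σ u S κ α) (hl : n < 2 ^ l) (hu : 2 ≤ n → 0 < u)
    (hx : x < 10) (hv : σ.natVar x = v) (hr : σ.natArr (rootArr k) v ≠ 0) :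
    Ensures (popHeap k x) σ fun t τ => t ≤ 160 * l + 100 ∧
      HeapFam n k τ u (Function.update S v ((S v).erase (σ.natArr (rootArr k) v))) κ α ∧
      HeapFrame k σ τ := by
  have hx10 : x ≠ 10 := by omega
  have hx11 : x ≠ 11 := by omega
  have hx13 : x ≠ 13 := by omega
  obtain ⟨S₁, S₂, hSe, h₁, h₂, h₁₂, hhl, hhr⟩ := (h.heap v).children hr
  have hk := (h.heap v).key_root hr
  have hp := (h.heap v).pay_root hr
  obtain ⟨i, hi⟩ : ∃ i, σ.natArr (rootArr k) v = i := ⟨_, rfl⟩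
  obtain ⟨c, hc⟩ : ∃ c, σ.natArr (left k) i = c := ⟨_, rfl⟩
  obtain ⟨d, hd'⟩ : ∃ d, σ.natArr (right k) i = d := ⟨_, rfl⟩
  rw [hi] at hr hSe h₁ h₂ hhl hhr hk hp
  rw [hc] at hhl
  rw [hd'] at hhr
  have hd : ∀ q ≠ v, ∀ z ∈ S q, z ≠ 0 ∧ z ∉ S₁ ∧ z ∉ S₂ := by
    intro q hq z hz
    have : z ∉ S v := fun hz' => Finset.disjoint_left.1 (h.disjoint q v hq) hz hz'
    rw [hSe] at this
    simp only [Finset.mem_insert, Finset.mem_union, not_or] at this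
    exact ⟨fun e => (h.heap q).zero_notMem (e ▸ hz), this.2.1, this.2.2⟩
  have hlS : c = 0 ∨ c ∈ S₁ := by
    by_cases hc : c = 0
    · exact .inl hc
    · exact .inr (hhl.root_mem hc)
  have hrS : d = 0 ∨ d ∈ S₂ := by
    by_cases hc : d = 0
    · exact .inl hc
    · exact .inr (hhr.root_mem hc)
  have h0₁ := hhl.zero_notMem
  have h0₂ := hhr.zero_notMem
  have hic : i ≠ c := by
    rintro e
    rcases hlS with h | h
    · exact hr (e.trans h)
    · exact h₁ (e ▸ h)
  have hid : i ≠ d := by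
    rintro e
    rcases hrS with h | h
    · exact hr (e.trans h)
    · exact h₂ (e ▸ h)
  have hsv : S₁ ⊆ S v ∧ S₂ ⊆ S v := by
    rw [hSe]; exact ⟨fun z => by simp +contextual, fun z => by simp +contextual⟩
  simp only [popHeap, ensures_seq, ensures_setNatVar, ensures_setRealArr, NatExp.eval, RealExp.eval,
    Store.natVar_setNatVar, Store.natArr_setNatVar, Store.natVar_setRealArr, hv,
    Store.natArr_setRealArr, Store.realArr_setRealArr, Store.realArr_setNatVar]
  simp [hic, hid, hi, hc, hd']
  refine (ensures_meldTo (S := S) (κ := κ) (α := α) (v := v) (A := S₁) (B := S₂) hl hu hx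
    ?_ ?_ ?_ ?_ ?_ ?_ ?_ ?_ ?_ ?_ ?_ ?_).mono ?_
  · simpa [hx10, hx11, hx13] using hv
  · intro q hq
    simp only [Store.natArr_setRealArr, Store.natArr_setNatVar]
    refine (h.heap q).congr (fun z hz => ?_) (fun _ _ => rfl) fun _ _ => rfl
    obtain ⟨z0, z1, z2⟩ := hd q hq z hz
    have zc : z ≠ c := by rintro rfl; tauto
    have zd : z ≠ d := by rintro rfl; tauto
    simp [SameNode, zc, zd]
  · intro q q' hqq _ _
    exact h.disjoint q q' hqq
  · intro q _
    exact h.subset q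
  · simpa using h.size_zero
  · simp
    refine hhl.rebase (fun z hz zc => ?_) ?_ ?_ ?_ ?_ ?_
    · have zd : z ≠ d := by
        rintro rfl
        rcases hrS with e | e
        · exact h0₁ (e ▸ hz)
        · exact Finset.disjoint_left.1 h₁₂ hz e
      simp [SameNode, zc, zd]
    · simp
    · simp
    · simp
    · intro hc
      have hcd : c ≠ d := by
        rintro e
        rcases hrS with e' | e'
        · exact h0₁ (e' ▸ e ▸ hc)
        · exact Finset.disjoint_left.1 h₁₂ hc (e ▸ e')
      simp [hcd, hk, hhl.key_root (fun e => h0₁ (e ▸ hc))]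
    · intro hc
      have hcd : c ≠ d := by
        rintro e
        rcases hrS with e' | e'
        · exact h0₁ (e' ▸ e ▸ hc)
        · exact Finset.disjoint_left.1 h₁₂ hc (e ▸ e')
      simp [hcd, hp, hhl.pay_root (fun e => h0₁ (e ▸ hc))]
  · simp
    have hdc : d ∈ S₂ → d ≠ c := by
      rintro hd' e
      rcases hlS with e' | e'
      · exact h0₂ (e' ▸ e ▸ hd')
      · exact Finset.disjoint_left.1 h₁₂ e' (e ▸ hd')
    refine hhr.rebase (fun z hz zc => ?_) ?_ ?_ ?_ ?_ ?_
    · have zd : z ≠ c := by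
        rintro rfl
        rcases hlS with e | e
        · exact h0₂ (e ▸ hz)
        · exact Finset.disjoint_left.1 h₁₂ e hz
      simp [SameNode, zc, zd]
    · simp
    · simp
    · simp
    · intro hd'
      simp [hdc hd', hk, hhr.key_root (fun e => h0₂ (e ▸ hd'))]
    · intro hd'
      simp [hdc hd', hp, hhr.pay_root (fun e => h0₂ (e ▸ hd'))]
  · exact h₁₂
  · exact hsv.1.trans (h.subset v)
  · exact hsv.2.trans (h.subset v)
  · exact fun q hq => (h.disjoint v q hq.symm).mono_left hsv.1
  · exact fun q hq => (h.disjoint v q hq.symm).mono_left hsv.2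
  · rintro t τ ⟨ht, h₁', h₂'⟩
    refine ⟨by simp [NatExp.time, RealExp.time]; omega, ?_, HeapFrame.trans ?_ h₂'⟩
    · convert h₁' using 2
      rw [hSe, Finset.erase_insert (by simp [h₁, h₂])]
    refine ⟨fun z hz => ?_, fun a h₁ h₂ h₃ => rfl, rfl, fun a h₁ h₂ h₃ => ?_⟩
    · have h10 : z ≠ 10 := by omega
      have h11 : z ≠ 11 := by omega
      have h13 : z ≠ 13 := by omega
      simp [h10, h11, h13]
    · simp [h₁, h₂]

/-- The node becomes a heap by itself, whose size is the unit held in real variable `1`, and is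
melded in. -/
theorem ensures_insertHeap (h : HeapFam n k σ u S κ α) (hl : n < 2 ^ l) (hu : 2 ≤ n → 0 < u)
    (hx : x < 10) (hy : y < 10) (hv : σ.natVar x = v) (hw : σ.natVar y = w)
    (hwn : w ∈ Finset.Icc 1 n) (hwS : ∀ q, w ∉ S q) (hσu : σ.realVar 1 = u) :
    Ensures (insertHeap k x y) σ fun t τ => t ≤ 160 * l + 100 ∧
      HeapFam n k τ u (Function.update S v (insert w (S v)))
        (Function.update κ w (σ.realVar 2)) (Function.update α w (σ.realVar 3)) ∧
      HeapFrame k σ τ := by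
  have hx10 : x ≠ 10 := by omega
  have hx11 : x ≠ 11 := by omega
  have hy10 : y ≠ 10 := by omega
  have hw0 : w ≠ 0 := by have := Finset.mem_Icc.1 hwn; omega
  simp only [insertHeap, ensures_seq, ensures_setNatVar, ensures_setRealArr, ensures_setNatArr,
    NatExp.eval, RealExp.eval, Store.natVar_setNatVar, Store.natArr_setNatVar,
    Store.natVar_setRealArr, hv, hw, Store.natVar_setNatArr, Function.update_of_ne hy10,
    Store.natArr_setRealArr, Store.realArr_setRealArr, Store.realArr_setNatVar,
    Store.realVar_setNatArr, Store.realVar_setRealArr, hσu]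
  simp
  have hne : ∀ q, ∀ z ∈ S q, z ≠ w := fun q z hz e => hwS q (e ▸ hz)
  refine (ensures_meldTo (S := S) (v := v) (A := S v) (B := {w})
    (κ := Function.update κ w (σ.realVar 2)) (α := Function.update α w (σ.realVar 3)) hl hu hx
    ?_ ?_ ?_ ?_ ?_ ?_ ?_ ?_ ?_ ?_ ?_ ?_).mono ?_
  · simpa [hx10, hx11] using hv
  · intro q hq
    simp
    refine (h.heap q).congr (fun z hz => ?_) (fun z hz => ?_) fun z hz => ?_
    all_goals simp [SameNode, hne q z hz]
  · exact fun q q' hqq _ _ => h.disjoint q q' hqq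
  · exact fun q _ => h.subset q
  · simpa [hw0.symm] using h.size_zero
  · simp
    refine (h.heap v).congr (fun z hz => ?_) (fun z hz => ?_) fun z hz => ?_
    all_goals simp [SameNode, hne v z hz]
  · simp
    have e : ({w} : Finset ℕ) = insert w (∅ ∪ ∅) := by simp
    rw [e]
    refine .node hw0 (by simp) (by simp) (by simp) (by simp) (by simp) (by simp) (by simp)
      (by simp) ?_ ?_
    · simpa using Heap.nil _ _
    · simpa using Heap.nil _ _
  · simpa using hwS v
  · exact h.subset v
  · simpa using hwn
  · exact fun q hq => h.disjoint v q hq.symm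
  · exact fun q hq => by simpa using hwS q
  · rintro t τ ⟨ht, h₁', h₂'⟩
    refine ⟨by simp [NatExp.time, RealExp.time]; omega, ?_, HeapFrame.trans ?_ h₂'⟩
    · convert h₁' using 2
      rw [Finset.union_comm]; rfl
    refine ⟨fun z hz => ?_, fun a h₁ h₂ h₃ => ?_, rfl, fun a h₁ h₂ h₃ => ?_⟩
    · have h10 : z ≠ 10 := by omega
      have h11 : z ≠ 11 := by omega
      simp [h10, h11]
    · simp [h₁, h₂]
    · simp [h₁, h₂, h₃]

/-- Only the entries of the root change. As the heaps are disjoint, the shift is seen exactly by the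
nodes in `S v`. -/
theorem ensures_addHeap (h : HeapFam n k σ u S κ α) (hv : σ.natVar x = v) :
    Ensures (addHeap k x) σ fun t τ => t ≤ 100 ∧
      HeapFam n k τ u S (fun z => if z ∈ S v then κ z + σ.realVar 2 else κ z)
        (fun z => if z ∈ S v then α z + σ.realVar 3 else α z) ∧
      HeapFrame k σ τ ∧ τ.natArr = σ.natArr := by
  simp only [addHeap, ensures_seq, ensures_setNatVar, ensures_setRealArr,
    NatExp.eval, RealExp.eval, Store.natVar_setNatVar, Store.natVar_setRealArr, hv,
    Store.realArr_setRealArr, Store.realArr_setNatVar, Store.realVar_setNatVar,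
    Store.realVar_setRealArr]
  simp
  refine ⟨by simp [NatExp.time, RealExp.time], ⟨fun q => ?_, h.disjoint, h.subset, ?_⟩, ?_⟩
  · simp only [Store.natArr_setRealArr, Store.natArr_setNatVar]
    by_cases hq : q = v
    · subst hq
      have H := (h.heap q).translate (σ.realVar 2) (σ.realVar 3)
      have H' : Heap k _ u _ _ 0 0 (σ.natArr (rootArr k) q) (S q) := H.rebase
        (τ := ((σ.setNatVar 10 (σ.natArr (rootArr k) q)).setRealArr (keyDiff k)
          (σ.natArr (rootArr k) q)
          (σ.realArr (keyDiff k) (σ.natArr (rootArr k) q) + σ.realVar 2)).setRealArr (payDiff k)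
          (σ.natArr (rootArr k) q)
          (σ.realArr (payDiff k) (σ.natArr (rootArr k) q) + σ.realVar 3))
        (fun z _ hz => by simp [SameNode, hz]) (by simp) (by simp) (by simp)
        (fun hi => by
          simp [(h.heap q).key_root fun e => (h.heap q).zero_notMem (e ▸ hi)])
        (fun hi => by
          simp [(h.heap q).pay_root fun e => (h.heap q).zero_notMem (e ▸ hi)])
      refine H'.congr (fun z _ => ⟨rfl, rfl, rfl, rfl, rfl⟩) (fun z hz => ?_) fun z hz => ?_
      all_goals simp [hz]
    · have hn : ∀ z ∈ S q, z ∉ S v := fun z hz hz' =>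
        Finset.disjoint_left.1 (h.disjoint q v hq) hz hz'
      have hn' : ∀ z ∈ S q, z ≠ σ.natArr (rootArr k) v := by
        intro z hz e
        have h0 : z ≠ 0 := fun e => (h.heap q).zero_notMem (e ▸ hz)
        exact hn z hz (e ▸ (h.heap v).root_mem (e ▸ h0))
      refine (h.heap q).congr (fun z hz => ?_) (fun z hz => ?_) fun z hz => ?_
      · simp [SameNode, hn' z hz]
      all_goals simp [hn z hz]
  · simpa using h.size_zero
  · refine ⟨fun z hz => ?_, fun a h₁ h₂ h₃ => rfl, rfl, fun a h₁ h₂ h₃ => ?_⟩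
    · have h10 : z ≠ 10 := by omega
      simp [h10]
    · simp [h₁, h₂]

end ChainPartition

end

noncomputable section

namespace ChainPartition

/-! ### Trees on the numbers `1, …, n` -/

open scoped Classical

/-- An instance on the vertices `1, …, n`, where `0` stands for the parent of the root. -/
structure TreeData where
  n : ℕ
  par : ℕ → ℕ
  depth : ℕ → ℕ
  w : ℕ → ℝ
  s : ℕ → ℝ
  r : ℕ → ℝ
  w₀ : ℝ
  par_le : ∀ i, par i ≤ n
  par_zero : par 0 = 0
  depth_zero : depth 0 = 0
  depth_par : ∀ i ∈ Finset.Icc 1 n, depth (par i) < depth i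
  par_of_lt : ∀ i, n < i → par i = 0
  w_nonneg : ∀ i, 0 ≤ w i
  w_le : ∀ i ∈ Finset.Icc 1 n, w i ≤ w₀
  r_inj : ∀ i ∈ Finset.Icc 1 n, ∀ j ∈ Finset.Icc 1 n, r i = r j → i = j

namespace TreeData

variable (D : TreeData) {v u x q c d : ℕ} {P : Finset ℕ} {h : ℕ → ℝ}

abbrev V : Finset ℕ := Finset.Icc 1 D.n

/-- `v` is an ancestor of `u`, possibly `u` itself. -/
def Anc (v u : ℕ) : Prop := ∃ k, D.par^[k] u = v

theorem anc_refl (v : ℕ) : D.Anc v v := ⟨0, rfl⟩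

theorem anc_par (v : ℕ) : D.Anc (D.par v) v := ⟨1, rfl⟩

variable {D}

theorem Anc.trans (h₁ : D.Anc v u) (h₂ : D.Anc u x) : D.Anc v x := by
  obtain ⟨k, rfl⟩ := h₁
  obtain ⟨l, rfl⟩ := h₂
  exact ⟨k + l, by rw [Function.iterate_add_apply]⟩

/-- Both vertices are iterated parents of `x`, so the one with the larger exponent is an iterated
parent of the other. -/
theorem Anc.total (h₁ : D.Anc v x) (h₂ : D.Anc u x) : D.Anc v u ∨ D.Anc u v := by
  obtain ⟨k, rfl⟩ := h₁
  obtain ⟨l, rfl⟩ := h₂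
  rcases le_total k l with hkl | hkl
  · refine .inr ⟨l - k, ?_⟩
    rw [← Function.iterate_add_apply]
    congr 2
    omega
  · refine .inl ⟨k - l, ?_⟩
    rw [← Function.iterate_add_apply]
    congr 2
    omega

theorem anc_iff : D.Anc v u ↔ v = u ∨ D.Anc v (D.par u) := by
  constructor
  · rintro ⟨k, rfl⟩
    cases k with
    | zero => exact .inl rfl
    | succ k => exact .inr ⟨k, rfl⟩
  · rintro (rfl | h)
    · exact D.anc_refl v
    · exact h.trans (D.anc_par u)

theorem depth_par_le (i : ℕ) : D.depth (D.par i) ≤ D.depth i := by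
  by_cases hi : i ∈ D.V
  · exact (D.depth_par i hi).le
  · rw [Finset.mem_Icc, not_and_or, not_le, not_le] at hi
    rcases hi with hi | hi
    · obtain rfl : i = 0 := by omega
      rw [D.par_zero]
    · rw [D.par_of_lt i hi, D.depth_zero]
      exact Nat.zero_le _

theorem Anc.depth_le (h : D.Anc v u) : D.depth v ≤ D.depth u := by
  obtain ⟨k, rfl⟩ := h
  induction k with
  | zero => exact le_rfl
  | succ k ih =>
    rw [Function.iterate_succ_apply']
    exact (depth_par_le _).trans ih

theorem Anc.depth_lt (h : D.Anc v u) (hu : u ∈ D.V) (hne : v ≠ u) : D.depth v < D.depth u := by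
  rcases anc_iff.1 h with h | h
  · exact absurd h hne
  · exact h.depth_le.trans_lt (D.depth_par u hu)

theorem Anc.antisymm (h : D.Anc v u) (h' : D.Anc u v) (hu : u ∈ D.V) : v = u := by
  by_contra hne
  exact absurd h'.depth_le (not_le.2 (h.depth_lt hu hne))

theorem Anc.mem (h : D.Anc v u) (hu : u ∈ D.V) (hv : v ≠ 0) : v ∈ D.V := by
  rcases anc_iff.1 h with rfl | ⟨k, rfl⟩
  · exact hu
  · rw [Finset.mem_Icc]
    refine ⟨Nat.one_le_iff_ne_zero.2 hv, ?_⟩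
    rw [← Function.iterate_succ_apply D.par k u, Function.iterate_succ_apply']
    exact D.par_le _

theorem Anc.exists_child (h : D.Anc v u) (hne : v ≠ u) (hu : u ∈ D.V) (hv : v ≠ 0) :
    ∃ c ∈ D.V, D.par c = v ∧ D.Anc c u := by
  obtain ⟨k, rfl⟩ := h
  cases k with
  | zero => exact absurd rfl hne
  | succ k =>
    rw [Function.iterate_succ_apply'] at hv ⊢
    refine ⟨D.par^[k] u, Anc.mem ⟨k, rfl⟩ hu ?_, rfl, k, rfl⟩
    intro e
    rw [e, D.par_zero] at hv
    exact hv rfl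

theorem ne_zero_of_mem (hv : v ∈ D.V) : v ≠ 0 := by
  have := Finset.mem_Icc.1 hv
  omega

theorem par_ne (hv : v ∈ D.V) : D.par v ≠ v := fun e => by
  have := D.depth_par v hv
  rw [e] at this
  exact lt_irrefl _ this

theorem not_anc_zero (hv : v ∈ D.V) : ¬ D.Anc v 0 := by
  rintro ⟨k, hk⟩
  have : D.par^[k] 0 = 0 := Function.iterate_fixed D.par_zero k
  exact ne_zero_of_mem hv (hk.symm.trans this)

variable (D)

/-- The ancestors of `u` in `P`. -/
def up (P : Finset ℕ) (u : ℕ) : Finset ℕ := P.filter fun x => D.Anc x u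

/-- The sum of `h` over the ancestors of `u` in `P`. -/
def off (h : ℕ → ℝ) (P : Finset ℕ) (u : ℕ) : ℝ := ∑ x ∈ D.up P u, h x

/-- The vertices on the way from `v` down to `u`. -/
def path (v u : ℕ) : Finset ℕ := D.V.filter fun x => D.Anc v x ∧ D.Anc x u

/-- The sum of the weights from the root to `u`. -/
def pw (u : ℕ) : ℝ := D.off D.w D.V u

/-- `d` has the largest rank on the way from `v` to `u`. -/
def IsDom (d v u : ℕ) : Prop := d ∈ D.path v u ∧ ∀ x ∈ D.path v u, D.r x ≤ D.r d

/-- A set of vertices containing with a vertex all its descendants. -/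
structure IsLower (P : Finset ℕ) : Prop where
  subset : P ⊆ D.V
  mem : ∀ v ∈ P, ∀ u ∈ D.V, D.Anc v u → u ∈ P

/-- All proper descendants of `v`, but not `v`, are in the lower set `P`. -/
structure IsNext (P : Finset ℕ) (v : ℕ) : Prop extends D.IsLower P where
  mem_V : v ∈ D.V
  notMem : v ∉ P
  mem_of_anc : ∀ u ∈ D.V, D.Anc v u → u ≠ v → u ∈ P

variable {D}

theorem mem_path : x ∈ D.path v u ↔ x ∈ D.V ∧ D.Anc v x ∧ D.Anc x u := by
  simp [path]

theorem exists_isDom (hv : D.Anc v u) (hv' : v ∈ D.V) : ∃ d, D.IsDom d v u := by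
  obtain ⟨d, hd, hmax⟩ := (D.path v u).exists_max_image D.r
    ⟨v, mem_path.2 ⟨hv', D.anc_refl v, hv⟩⟩
  exact ⟨d, hd, hmax⟩

theorem off_insert (hv : v ∉ P) :
    D.off h (insert v P) u = (if D.Anc v u then h v else 0) + D.off h P u := by
  unfold off up
  rw [Finset.filter_insert]
  split_ifs with hA
  · rw [Finset.sum_insert (by simp [hv])]
  · rw [zero_add]

theorem off_congr {h' : ℕ → ℝ} (hh : ∀ x ∈ P, h' x = h x) : D.off h' P u = D.off h P u :=
  Finset.sum_congr rfl fun x hx => hh x (Finset.mem_of_mem_filter x hx)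

theorem pw_zero : D.pw 0 = 0 := by
  unfold pw off
  refine Finset.sum_eq_zero fun x hx => ?_
  simp only [up, Finset.mem_filter] at hx
  exact absurd hx.2 (not_anc_zero hx.1)

theorem pw_par (hv : v ∈ D.V) : D.pw v = D.pw (D.par v) + D.w v := by
  have e : D.up D.V v = insert v (D.up D.V (D.par v)) := by
    ext x
    simp only [up, Finset.mem_filter, Finset.mem_insert]
    rw [anc_iff]
    constructor
    · tauto
    · rintro (rfl | h)
      · exact ⟨hv, .inl rfl⟩
      · tauto
  have hn : v ∉ D.up D.V (D.par v) := by
    simp only [up, Finset.mem_filter, not_and]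
    intro _ h
    exact par_ne hv ((D.anc_par v).antisymm h hv)
  unfold pw off
  rw [e, Finset.sum_insert hn, add_comm]

/-- This is where nonnegativity of the weights enters: for a fixed end, a chain does not become
lighter when its top moves up. -/
theorem Anc.pw_le (h : D.Anc v u) : D.pw (D.par v) ≤ D.pw (D.par u) := by
  unfold pw off
  refine Finset.sum_le_sum_of_subset_of_nonneg ?_ fun x _ _ => D.w_nonneg x
  intro x hx
  simp only [up, Finset.mem_filter] at hx ⊢
  refine ⟨hx.1, ?_⟩
  rcases anc_iff.1 h with rfl | h
  · exact hx.2
  · exact (hx.2.trans (D.anc_par v)).trans h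

/-- The ancestors of `u` are those of the parent of `v` together with the path. So the weight of a
chain is available from two sums from the root; `D.w v` is added back because the top belongs to the
chain. -/
theorem pw_sub (hvu : D.Anc v u) (hv : v ∈ D.V) :
    D.pw u - D.pw v + D.w v = ∑ x ∈ D.path v u, D.w x := by
  have e : D.up D.V u = D.path v u ∪ D.up D.V (D.par v) := by
    ext x
    simp only [up, path, Finset.mem_filter, Finset.mem_union]
    constructor
    · rintro ⟨hx, hxu⟩
      rcases hvu.total hxu with h | h
      · exact .inl ⟨hx, h, hxu⟩
      · rcases anc_iff.1 h with rfl | h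
        · exact .inl ⟨hx, D.anc_refl x, hxu⟩
        · exact .inr ⟨hx, h⟩
    · rintro (h | h)
      · exact ⟨h.1, h.2.2⟩
      · exact ⟨h.1, (h.2.trans (D.anc_par v)).trans hvu⟩
  have hd : Disjoint (D.path v u) (D.up D.V (D.par v)) := by
    rw [Finset.disjoint_left]
    intro x hx hx'
    simp only [up, path, Finset.mem_filter] at hx hx'
    exact par_ne hv ((D.anc_par v).antisymm (hx.2.1.trans hx'.2) hv)
  have h1 : D.pw u = ∑ x ∈ D.path v u, D.w x + D.pw (D.par v) := by
    unfold pw off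
    rw [e, Finset.sum_union hd]
  rw [pw_par hv, h1]
  ring

/-! ### Chains starting at the next vertex to be processed. -/

namespace IsNext

theorem not_anc (hn : D.IsNext P v) (hx : x ∈ P) : ¬ D.Anc x v :=
  fun h => hn.notMem (hn.mem x hx v hn.mem_V h)

theorem up_self (hn : D.IsNext P v) : D.up P v = ∅ := by
  rw [up, Finset.filter_eq_empty_iff]
  exact fun x hx => hn.not_anc hx

theorem off_self (hn : D.IsNext P v) : D.off h P v = 0 := by
  rw [off, hn.up_self, Finset.sum_empty]

theorem anc_of_anc (hn : D.IsNext P v) (hx : x ∈ P) (hxu : D.Anc x u) (hvu : D.Anc v u) :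
    D.Anc v x := by
  rcases hxu.total hvu with h | h
  · exact absurd h (hn.not_anc hx)
  · exact h

/-- Below its top, a chain from `v` consists of processed vertices only, and all processed ancestors
of its end are on it. Hence `off` is the sum of `h` over the rest of the chain. -/
theorem path_eq (hn : D.IsNext P v) (hvu : D.Anc v u) : D.path v u = insert v (D.up P u) := by
  ext x
  simp only [path, up, Finset.mem_filter, Finset.mem_insert]
  constructor
  · rintro ⟨hx, hvx, hxu⟩
    by_cases e : x = v
    · exact .inl e
    · exact .inr ⟨hn.mem_of_anc x hx hvx e, hxu⟩
  · rintro (rfl | ⟨hx, hxu⟩)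
    · exact ⟨hn.mem_V, D.anc_refl x, hvu⟩
    · exact ⟨hn.subset hx, hn.anc_of_anc hx hxu hvu, hxu⟩

theorem sum_path (hn : D.IsNext P v) (hvu : D.Anc v u) :
    ∑ x ∈ D.path v u, h x = h v + D.off h P u := by
  rw [hn.path_eq hvu, Finset.sum_insert (by simp [up, hn.notMem]), off]

/-- The tops that matter in the future lie above `v`. This is what allows an end too heavy for `v`
to be deleted for good. -/
theorem anc_of_notMem (hn : D.IsNext P v) (hq : q ∈ D.V) (hqP : q ∉ P) (hqu : D.Anc q u)
    (hvu : D.Anc v u) : D.Anc q v := by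
  rcases hqu.total hvu with h | h
  · exact h
  · by_cases e : q = v
    · exact e ▸ D.anc_refl q
    · exact absurd (hn.mem_of_anc q hq h e) hqP

theorem isLower_insert (hn : D.IsNext P v) : D.IsLower (insert v P) where
  subset := Finset.insert_subset hn.mem_V hn.subset
  mem := by
    intro x hx u hu hxu
    rw [Finset.mem_insert] at hx ⊢
    rcases hx with rfl | hx
    · by_cases e : u = x
      · exact .inl e
      · exact .inr (hn.mem_of_anc u hu hxu e)
    · exact .inr (hn.mem x hx u hu hxu)

end IsNext

end TreeData
end ChainPartition

end

noncomputable section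

namespace ChainPartition
namespace TreeData

/-! ### The state of the bottom-up computation -/

open scoped Classical
open Function (update)

variable (D : TreeData)

/-- `d` has the largest rank among its ancestors in `P`. -/
def Act (P : Finset ℕ) (d : ℕ) : Prop := d ∈ P ∧ ∀ x ∈ P, D.Anc x d → D.r x ≤ D.r d

/-- `d` has the largest rank on the way from `d` to its descendant `u`. -/
def Grp (d u : ℕ) : Prop :=
  u ∈ D.V ∧ D.Anc d u ∧ ∀ x ∈ D.V, D.Anc d x → D.Anc x u → D.r x ≤ D.r d

/-- `d` lies below a child of `q` that belongs to `P`. -/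
def Own (P : Finset ℕ) (q d : ℕ) : Prop := d ∈ P ∧ ∃ c ∈ P, D.par c = q ∧ D.Anc c d

/-- `h` and `b` are correct at `v`: `b` is the end of a chain from `v` of cost the sum of `h`, and
the sum of `h` is a lower bound for the cost of every other chain from `v`. -/
structure Good (h : ℕ → ℝ) (b v : ℕ) : Prop where
  mem : b ∈ D.V
  anc : D.Anc v b
  le : D.pw b - D.pw v + D.w v ≤ D.w₀
  eq : ∃ d, D.IsDom d v b ∧ ∑ x ∈ D.path v b, h x = D.s d
  sum_le : ∀ u ∈ D.V, D.Anc v u → D.pw u - D.pw v + D.w v ≤ D.w₀ → ∀ d, D.IsDom d v u →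
    ∑ x ∈ D.path v u, h x ≤ D.s d

/-- The contents of the three families of heaps when the vertices in `P` have been processed: `A`
tells which vertices are the leaders of a group of chains, `G d` is the group of `d`, and `O q d`
says that the group of `d` is stored at `q`. The heap `SR q` holds the leaders stored at `q` by rank,
`SV q` those with a chain left by value, and `SC d` the ends of the chains in the group of `d` that
may still be feasible. -/
structure Core (h : ℕ → ℝ) (P : Finset ℕ) (A : ℕ → Prop) (G O : ℕ → ℕ → Prop)
    (SR SV SC : ℕ → Finset ℕ) (κR αR κV κC : ℕ → ℝ) : Prop where
  r_mem : ∀ q ∉ P, ∀ d, d ∈ SR q ↔ A d ∧ O q d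
  r_empty : ∀ q ∈ P, SR q = ∅
  r_key : ∀ q, ∀ d ∈ SR q, κR d = D.r d
  r_pay : ∀ q, ∀ d ∈ SR q, αR d = -D.off h P d
  c_empty : ∀ d, ¬ A d → SC d = ∅
  c_mem : ∀ d, A d → ∀ u ∈ SC d, G d u ∧ κC u = D.off h P d - D.off h P u
  c_dead : ∀ d, A d → ∀ u, G d u → u ∉ SC d → ∀ q ∈ D.V, q ∉ P → D.Anc q u →
    D.w₀ < D.pw u - D.pw q + D.w q
  v_empty : ∀ q ∈ P, SV q = ∅
  v_sub : ∀ q, ∀ d ∈ SV q, d ∈ P ∨ O q d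
  v_key : ∀ q, ∀ d ∈ SV q, A d → O q d ∧ (∀ u ∈ SC d, κV d ≤ D.s d - D.off h P u) ∧
    ∃ u ∈ SC d, κV d = D.s d - D.off h P u
  v_mem : ∀ q ∉ P, ∀ d, A d → O q d → (SC d).Nonempty → d ∈ SV q

/-- Leaders while the groups of `B` have been merged into that of `v`. -/
def ActB (P B : Finset ℕ) (v d : ℕ) : Prop := (D.Act P d ∧ d ∉ B) ∨ d = v

def GrpB (B : Finset ℕ) (v d u : ℕ) : Prop :=
  (d = v ∧ (u = v ∨ ∃ d' ∈ B, D.Grp d' u)) ∨ (d ≠ v ∧ D.Grp d u)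

/-- `v` has no processed parent or child that would store it yet, so it counts as stored at itself
until its heaps are passed to its parent. -/
def OwnV (P : Finset ℕ) (v q d : ℕ) : Prop := D.Own P q d ∨ (q = v ∧ d = v)

variable {D} {h : ℕ → ℝ} {P : Finset ℕ} {A A' : ℕ → Prop} {G G' O : ℕ → ℕ → Prop}
  {SR SV SC : ℕ → Finset ℕ} {κR αR κV κC : ℕ → ℝ} {v u d q : ℕ} {B : Finset ℕ}

/-- All proper descendants of `v` are processed, so what is stored at `v` is everything processed
below it. -/
theorem IsNext.own_iff (hn : D.IsNext P v) : D.Own P v d ↔ d ∈ P ∧ D.Anc v d := by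
  constructor
  · rintro ⟨hd, c, _, rfl, hcd⟩
    exact ⟨hd, (D.anc_par c).trans hcd⟩
  · rintro ⟨hd, hvd⟩
    have hdv : d ≠ v := fun e => hn.notMem (e ▸ hd)
    obtain ⟨c, hc, hcv, hcd⟩ := hvd.exists_child hdv.symm (hn.subset hd)
      (ne_zero_of_mem hn.mem_V)
    refine ⟨hd, c, hn.mem_of_anc c hc (hcv ▸ D.anc_par c) ?_, hcv, hcd⟩
    rintro rfl
    exact par_ne hc hcv

theorem Core.congr (H : D.Core h P A G O SR SV SC κR αR κV κC) (hA : ∀ d, A' d ↔ A d)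
    (hG : ∀ d, A d → ∀ u, G' d u ↔ G d u) :
    D.Core h P A' G' O SR SV SC κR αR κV κC where
  r_mem q hq d := by rw [H.r_mem q hq, hA]
  r_empty := H.r_empty
  r_key := H.r_key
  r_pay := H.r_pay
  c_empty d hd := H.c_empty d (by rwa [← hA])
  c_mem d hd u hu := by
    rw [hA] at hd
    rw [hG d hd]
    exact H.c_mem d hd u hu
  c_dead d hd u hu := by
    rw [hA] at hd
    rw [hG d hd] at hu
    exact H.c_dead d hd u hu
  v_empty := H.v_empty
  v_sub := H.v_sub
  v_key q d hd hAd := H.v_key q d hd ((hA d).1 hAd)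
  v_mem q hq d hAd := H.v_mem q hq d ((hA d).1 hAd)

/-! ### Preservation of the invariant. -/

/-- A new vertex starts its own group. -/
theorem Core.start (H : D.Core h P (D.Act P) D.Grp (D.Own P) SR SV SC κR αR κV κC)
    (hn : D.IsNext P v) :
    D.Core h P (D.ActB P ∅ v) (D.GrpB ∅ v) (D.Own P) SR SV
      (update SC v (insert v (SC v))) κR αR κV (update κC v 0) := by
  have hv : ¬ D.Act P v := fun h => hn.notMem h.1
  have hSv : SC v = ∅ := H.c_empty v hv
  have hne : ∀ {d}, d ∈ P → d ≠ v := fun hd e => hn.notMem (e ▸ hd)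
  have hA : ∀ {d}, d ≠ v → (D.ActB P ∅ v d ↔ D.Act P d) := fun hd => by simp [ActB, hd]
  constructor
  · intro q hq d
    rw [H.r_mem q hq]
    refine and_congr_left fun hO => ?_
    rw [hA (hne hO.1)]
  · exact H.r_empty
  · exact H.r_key
  · exact H.r_pay
  · intro d hd
    have hdv : d ≠ v := fun e => hd (.inr e)
    rw [Function.update_of_ne hdv]
    exact H.c_empty d fun h => hd (.inl ⟨h, by simp⟩)
  · intro d hd u hu
    by_cases hdv : d = v
    · subst hdv
      rw [Function.update_self, hSv] at hu
      obtain rfl : u = d := by simpa using hu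
      refine ⟨.inl ⟨rfl, .inl rfl⟩, ?_⟩
      rw [Function.update_self, sub_self]
    · rw [Function.update_of_ne hdv] at hu
      have hAd := (hA hdv).1 hd
      obtain ⟨h₁, h₂⟩ := H.c_mem d hAd u hu
      refine ⟨.inr ⟨hdv, h₁⟩, ?_⟩
      -- `v` itself lies in no old group, as no processed vertex is its ancestor; so the new key at
      -- `v` disturbs nothing.
      rw [Function.update_of_ne, h₂]
      rintro rfl
      exact hn.not_anc hAd.1 h₁.2.1
  · intro d hd u hG hu
    by_cases hdv : d = v
    · subst hdv
      simp [GrpB] at hG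
      subst hG
      simp at hu
    · rw [Function.update_of_ne hdv] at hu
      rcases hG with hG | hG
      · exact absurd hG.1 hdv
      · exact H.c_dead d ((hA hdv).1 hd) u hG.2 hu
  · exact H.v_empty
  · exact H.v_sub
  · intro q d hd hAd
    have hdP : d ∈ P := (H.v_sub q d hd).elim id fun h => h.1
    have hdv : d ≠ v := hne hdP
    rw [Function.update_of_ne hdv]
    exact H.v_key q d hd ((hA hdv).1 hAd)
  · intro q hq d hAd hO
    have hdv : d ≠ v := hne hO.1
    rw [Function.update_of_ne hdv]
    exact H.v_mem q hq d ((hA hdv).1 hAd) hO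

/-- The group of `d` is merged into that of `v`. -/
theorem Core.absorb (H : D.Core h P (D.ActB P B v) (D.GrpB B v) (D.Own P) SR SV SC κR αR κV κC)
    (hn : D.IsNext P v) (hd : d ∈ SR v) (hdis : ∀ q, q ≠ v → d ∉ SR q)
    (hdisC : ∀ e, e ≠ d → Disjoint (SC e) (SC d)) :
    D.Core h P (D.ActB P (insert d B) v) (D.GrpB (insert d B) v) (D.Own P)
      (update SR v ((SR v).erase d)) SV (update (update SC d ∅) v (SC v ∪ SC d)) κR αR κV
      (fun z => if z ∈ SC d then κC z + αR d else κC z) := by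
  have hne : ∀ {d}, d ∈ P → d ≠ v := fun hd e => hn.notMem (e ▸ hd)
  obtain ⟨hAd, hOd⟩ := (H.r_mem v hn.notMem d).1 hd
  have hdv : d ≠ v := hne hOd.1
  obtain ⟨hAd', hdB⟩ : D.Act P d ∧ d ∉ B := hAd.resolve_right hdv
  have hpay := H.r_pay v d hd
  have hA : ∀ {e}, e ≠ v → (D.ActB P (insert d B) v e ↔ D.ActB P B v e ∧ e ≠ d) := fun he => by
    simp [ActB, he]
    tauto
  have hsub : ∀ q, (update SR v ((SR v).erase d)) q ⊆ SR q := fun q => by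
    by_cases hq : q = v
    · subst hq
      rw [Function.update_self]
      exact Finset.erase_subset _ _
    · rw [Function.update_of_ne hq]
  constructor
  · intro q hq e
    by_cases hqv : q = v
    · subst hqv
      rw [Function.update_self, Finset.mem_erase, H.r_mem q hq]
      constructor
      · rintro ⟨h₁, h₂, h₃⟩
        exact ⟨(hA (hne h₃.1)).2 ⟨h₂, h₁⟩, h₃⟩
      · rintro ⟨h₁, h₂⟩
        have := (hA (hne h₂.1)).1 h₁
        exact ⟨this.2, this.1, h₂⟩
    · rw [Function.update_of_ne hqv]
      constructor
      · intro he
        have hed : e ≠ d := fun e' => hdis q hqv (e' ▸ he)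
        obtain ⟨h₁, h₂⟩ := (H.r_mem q hq e).1 he
        exact ⟨(hA (hne h₂.1)).2 ⟨h₁, hed⟩, h₂⟩
      · rintro ⟨h₁, h₂⟩
        exact (H.r_mem q hq e).2 ⟨((hA (hne h₂.1)).1 h₁).1, h₂⟩
  · intro q hq
    exact Finset.subset_empty.1 ((hsub q).trans (H.r_empty q hq).subset)
  · exact fun q e he => H.r_key q e (hsub q he)
  · exact fun q e he => H.r_pay q e (hsub q he)
  · intro e he
    have hev : e ≠ v := fun h => he (.inr h)
    rw [Function.update_of_ne hev]
    by_cases hed : e = d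
    · rw [hed, Function.update_self]
    · rw [Function.update_of_ne hed]
      refine H.c_empty e fun h => he ((hA hev).2 ⟨h, hed⟩)
  · intro e he u hu
    by_cases hev : e = v
    · subst hev
      rw [Function.update_self, Finset.mem_union] at hu
      by_cases hud : u ∈ SC d
      · obtain ⟨h₁, h₂⟩ := H.c_mem d hAd u hud
        have h₁' : D.Grp d u := (h₁.resolve_left fun h => hdv h.1).2
        refine ⟨.inl ⟨rfl, .inr ⟨d, by simp, h₁'⟩⟩, ?_⟩
        -- The key off(d) - off(u) plus the payload -off(d) is -off(u), which is the key relative to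
        -- `v` because `v` has no ancestor in `P`.
        rw [if_pos hud, h₂, hpay, hn.off_self]
        ring
      · obtain ⟨h₁, h₂⟩ := H.c_mem e (.inr rfl) u (hu.resolve_right hud)
        refine ⟨?_, by rw [if_neg hud, h₂]⟩
        rcases h₁ with ⟨_, h₁ | ⟨d', hd', h₁⟩⟩ | h₁
        · exact .inl ⟨rfl, .inl h₁⟩
        · exact .inl ⟨rfl, .inr ⟨d', by simp [hd'], h₁⟩⟩
        · exact absurd rfl h₁.1
    · obtain ⟨h₁, h₂⟩ := (hA hev).1 he
      rw [Function.update_of_ne hev, Function.update_of_ne h₂] at hu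
      rw [if_neg fun h => Finset.disjoint_left.1 (hdisC e h₂) hu h]
      obtain ⟨h₃, h₄⟩ := H.c_mem e h₁ u hu
      exact ⟨.inr (h₃.resolve_left fun h => hev h.1), h₄⟩
  · intro e he u hG hu
    by_cases hev : e = v
    · subst hev
      rw [Function.update_self, Finset.mem_union, not_or] at hu
      rcases hG with ⟨_, rfl | ⟨d', hd', hG⟩⟩ | hG
      · exact H.c_dead u (.inr rfl) u (.inl ⟨rfl, .inl rfl⟩) hu.1
      · rcases Finset.mem_insert.1 hd' with rfl | hd'
        · exact H.c_dead d' hAd u (.inr ⟨hdv, hG⟩) hu.2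
        · exact H.c_dead e (.inr rfl) u (.inl ⟨rfl, .inr ⟨d', hd', hG⟩⟩) hu.1
      · exact absurd rfl hG.1
    · obtain ⟨h₁, h₂⟩ := (hA hev).1 he
      rw [Function.update_of_ne hev, Function.update_of_ne h₂] at hu
      exact H.c_dead e h₁ u (.inr (hG.resolve_left fun h => hev h.1)) hu
  · exact H.v_empty
  · exact H.v_sub
  · intro q e he hAe
    have heP : e ∈ P := (H.v_sub q e he).elim id fun h => h.1
    have hev : e ≠ v := hne heP
    obtain ⟨h₁, h₂⟩ := (hA hev).1 hAe
    rw [Function.update_of_ne hev, Function.update_of_ne h₂]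
    exact H.v_key q e he h₁
  · intro q hq e hAe hO
    have hev : e ≠ v := hne hO.1
    obtain ⟨h₁, h₂⟩ := (hA hev).1 hAe
    rw [Function.update_of_ne hev, Function.update_of_ne h₂]
    exact H.v_mem q hq e h₁ hO

/-- When the leaders of smaller rank have been absorbed, the groups are those for `insert v P`. -/
theorem Core.finish_absorb
    (H : D.Core h P (D.ActB P B v) (D.GrpB B v) (D.Own P) SR SV SC κR αR κV κC)
    (hn : D.IsNext P v) (hB : ∀ d ∈ B, D.Act P d ∧ D.Own P v d ∧ D.r d ≤ D.r v)
    (hR : ∀ d ∈ SR v, D.r v < D.r d) :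
    (∀ d, D.Act (insert v P) d ↔ D.ActB P B v d) ∧
      D.Core h P (D.Act (insert v P)) D.Grp (D.Own P) SR SV SC κR αR κV κC := by
  have hne : ∀ {d}, d ∈ P → d ≠ v := fun hd e => hn.notMem (e ▸ hd)
  have hmemB : ∀ d, D.Act P d → D.Own P v d → D.r d ≤ D.r v → d ∈ B := by
    intro d hA hO hr
    by_contra hdB
    exact absurd (hR d ((H.r_mem v hn.notMem d).2 ⟨.inl ⟨hA, hdB⟩, hO⟩)) (not_lt.2 hr)
  have hact : ∀ d, D.Act (insert v P) d ↔ D.ActB P B v d := by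
    intro d
    constructor
    · rintro ⟨hd, hmax⟩
      rcases Finset.mem_insert.1 hd with rfl | hd
      · exact .inr rfl
      · refine .inl ⟨⟨hd, fun x hx => hmax x (by simp [hx])⟩, fun hdB => ?_⟩
        obtain ⟨_, hO, hr⟩ := hB d hdB
        have hr' := hmax v (by simp) (hn.own_iff.1 hO).2
        -- An absorbed vertex that were still a leader would have the same rank as `v`; distinctness
        -- of the ranks excludes this.
        exact hne hd (D.r_inj d (hn.subset hd) v hn.mem_V (le_antisymm hr hr'))
    · rintro (⟨hA, hdB⟩ | rfl)
      · refine ⟨by simp [hA.1], fun x hx hxd => ?_⟩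
        rcases Finset.mem_insert.1 hx with rfl | hx
        · by_contra hr
          exact hdB (hmemB d hA (hn.own_iff.2 ⟨hA.1, hxd⟩) (not_le.1 hr).le)
        · exact hA.2 x hx hxd
      · refine ⟨by simp, fun x hx hxd => ?_⟩
        rcases Finset.mem_insert.1 hx with rfl | hx
        · exact le_rfl
        · exact absurd hxd (hn.not_anc hx)
  refine ⟨hact, H.congr hact fun d hd u => ?_⟩
  · by_cases hdv : d = v
    · subst hdv
      have e : D.GrpB B d d u ↔ (u = d ∨ ∃ d' ∈ B, D.Grp d' u) := by simp [GrpB]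
      rw [e]
      constructor
      · rintro ⟨hu, hdu, hmax⟩
        by_cases hud : u = d
        · exact .inl hud
        -- The processed ancestor `m` of `u` of largest rank is a leader with `u` in its group. Its
        -- rank is at most that of the new vertex, so it has been absorbed.
        · obtain ⟨m, hm, hmm⟩ := (D.up P u).exists_max_image D.r
            ⟨u, by simp [up, hn.mem_of_anc u hu hdu hud, D.anc_refl]⟩
          simp only [up, Finset.mem_filter] at hm hmm
          have hdm := hn.anc_of_anc hm.1 hm.2 hdu
          refine .inr ⟨m, hmemB m ⟨hm.1, fun x hx hxm => hmm x ⟨hx, hxm.trans hm.2⟩⟩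
            (hn.own_iff.2 ⟨hm.1, hdm⟩) (hmax m (hn.subset hm.1) hdm hm.2), hu, hm.2,
            fun x hx hmx hxu => hmm x ⟨hn.mem m hm.1 x hx hmx, hxu⟩⟩
      · rintro (rfl | ⟨m, hm, hG⟩)
        · refine ⟨hn.mem_V, D.anc_refl u, fun x hx hux hxu => ?_⟩
          rw [hux.antisymm hxu hx]
        · obtain ⟨hA, hO, hr⟩ := hB m hm
          have hdm := (hn.own_iff.1 hO).2
          refine ⟨hG.1, hdm.trans hG.2.1, fun x hx hdx hxu => ?_⟩
          rcases hxu.total hG.2.1 with h | h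
          · by_cases hxd : x = d
            · rw [hxd]
            · exact (hA.2 x (hn.mem_of_anc x hx hdx hxd) h).trans hr
          · exact (hG.2.2 x hx h hxu).trans hr
    · simp [GrpB, hdv]

/-- The group of `v` becomes available at `v`. -/
theorem Core.insert_leader
    (H : D.Core h P (D.Act (insert v P)) D.Grp (D.Own P) SR SV SC κR αR κV κC)
    (hn : D.IsNext P v) {k : ℝ} (hk : ∀ u ∈ SC v, k ≤ D.s v - D.off h P u)
    (hk' : ∃ u ∈ SC v, k = D.s v - D.off h P u) :
    D.Core h P (D.Act (insert v P)) D.Grp (D.OwnV P v) (update SR v (insert v (SR v)))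
      (update SV v (insert v (SV v))) SC (update κR v (D.r v)) (update αR v 0) (update κV v k)
      κC := by
  have hne : ∀ {d}, d ∈ P → d ≠ v := fun hd e => hn.notMem (e ▸ hd)
  have hAv : D.Act (insert v P) v := by
    refine ⟨by simp, fun x hx hxd => ?_⟩
    rcases Finset.mem_insert.1 hx with rfl | hx
    · exact le_rfl
    · exact absurd hxd (hn.not_anc hx)
  have hvR : ∀ q, v ∉ SR q := fun q hq => by
    by_cases hqP : q ∈ P
    · simp [H.r_empty q hqP] at hq
    · exact hne ((H.r_mem q hqP v).1 hq).2.1 rfl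
  have hvV : ∀ q, v ∉ SV q := fun q hq => hne ((H.v_sub q v hq).elim id fun h => h.1) rfl
  have hmR : ∀ {q d}, d ∈ (update SR v (insert v (SR v))) q → d ∈ SR q ∨ (q = v ∧ d = v) := by
    intro q d hd
    by_cases hq : q = v
    · subst hq
      simp at hd
      tauto
    · rw [Function.update_of_ne hq] at hd
      exact .inl hd
  have hmV : ∀ {q d}, d ∈ (update SV v (insert v (SV v))) q ↔ d ∈ SV q ∨ (q = v ∧ d = v) := by
    intro q d
    by_cases hq : q = v
    · subst hq
      simp
      tauto
    · rw [Function.update_of_ne hq]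
      simp [hq]
  constructor
  · intro q hq d
    by_cases hqv : q = v
    · subst hqv
      rw [Function.update_self, Finset.mem_insert, H.r_mem q hq]
      constructor
      · rintro (rfl | h)
        · exact ⟨hAv, .inr ⟨rfl, rfl⟩⟩
        · exact ⟨h.1, .inl h.2⟩
      · rintro ⟨h₁, h₂ | h₂⟩
        · exact .inr ⟨h₁, h₂⟩
        · exact .inl h₂.2
    · rw [Function.update_of_ne hqv, H.r_mem q hq]
      simp [OwnV, hqv]
  · intro q hq
    rw [Function.update_of_ne (hne hq)]
    exact H.r_empty q hq
  · intro q d hd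
    rcases hmR hd with hd | ⟨rfl, rfl⟩
    · rw [Function.update_of_ne (fun e : d = v => hvR q (e ▸ hd))]
      exact H.r_key q d hd
    · rw [Function.update_self]
  · intro q d hd
    rcases hmR hd with hd | ⟨rfl, rfl⟩
    · rw [Function.update_of_ne (fun e : d = v => hvR q (e ▸ hd))]
      exact H.r_pay q d hd
    · rw [Function.update_self, hn.off_self, neg_zero]
  · exact H.c_empty
  · exact H.c_mem
  · exact H.c_dead
  · intro q hq
    rw [Function.update_of_ne (hne hq)]
    exact H.v_empty q hq
  · intro q d hd
    rcases hmV.1 hd with hd | hd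
    · exact (H.v_sub q d hd).imp id .inl
    · exact .inr (.inr hd)
  · intro q d hd hA
    rcases hmV.1 hd with hd | ⟨rfl, rfl⟩
    · rw [Function.update_of_ne (fun e : d = v => hvV q (e ▸ hd))]
      obtain ⟨h₁, h₂⟩ := H.v_key q d hd hA
      exact ⟨.inl h₁, h₂⟩
    · rw [Function.update_self]
      exact ⟨.inr ⟨rfl, rfl⟩, hk, hk'⟩
  · intro q hq d hA hO hS
    rw [hmV]
    rcases hO with hO | hO
    · exact .inl (H.v_mem q hq d hA hO hS)
    · exact .inr hO

/-- A leader that has been absorbed may be dropped. -/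
theorem Core.drop_stale (H : D.Core h P A G O SR SV SC κR αR κV κC) (hd : ¬ A d) :
    D.Core h P A G O SR (update SV v ((SV v).erase d)) SC κR αR κV κC := by
  have hm : ∀ {q e}, e ∈ (update SV v ((SV v).erase d)) q ↔ e ∈ SV q ∧ (q = v → e ≠ d) := by
    intro q e
    by_cases hq : q = v
    · subst hq
      simp
      tauto
    · simp [hq]
  constructor
  · exact H.r_mem
  · exact H.r_empty
  · exact H.r_key
  · exact H.r_pay
  · exact H.c_empty
  · exact H.c_mem
  · exact H.c_dead
  · intro q hq
    rw [Finset.eq_empty_iff_forall_notMem]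
    intro e he
    simpa [H.v_empty q hq] using (hm.1 he).1
  · exact fun q e he => H.v_sub q e (hm.1 he).1
  · exact fun q e he => H.v_key q e (hm.1 he).1
  · exact fun q hq e hA hO hS =>
      hm.2 ⟨H.v_mem q hq e hA hO hS, fun _ hed => hd (hed ▸ hA)⟩

/-- Removal of the end `u` of an infeasible chain from the group of `d`. -/
theorem Core.drop_chain (H : D.Core h P A G O SR SV SC κR αR κV κC)
    {SV' : ℕ → Finset ℕ} {κV' : ℕ → ℝ} (hAd : A d) (hdV : d ∈ SV v) (hvP : v ∉ P)
    (hdis : ∀ q, q ≠ v → d ∉ SV q) (hSV : ∀ q, ∀ e ≠ d, e ∈ SV' q ↔ e ∈ SV q)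
    (hκV : ∀ e ≠ d, κV' e = κV e)
    (hdV' : ∀ q, d ∈ SV' q → q = v ∧ ((SC d).erase u).Nonempty ∧
      (∀ z ∈ (SC d).erase u, κV' d ≤ D.s d - D.off h P z) ∧
      ∃ z ∈ (SC d).erase u, κV' d = D.s d - D.off h P z)
    (hdV'' : ((SC d).erase u).Nonempty → d ∈ SV' v)
    (hdead : ∀ q ∈ D.V, q ∉ P → D.Anc q u → D.w₀ < D.pw u - D.pw q + D.w q) :
    D.Core h P A G O SR SV' (update SC d ((SC d).erase u)) κR αR κV' κC := by
  have hO := (H.v_key v d hdV hAd).1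
  constructor
  · exact H.r_mem
  · exact H.r_empty
  · exact H.r_key
  · exact H.r_pay
  · intro e he
    have hed : e ≠ d := fun h => he (h ▸ hAd)
    rw [Function.update_of_ne hed]
    exact H.c_empty e he
  · intro e he z hz
    by_cases hed : e = d
    · subst hed
      rw [Function.update_self] at hz
      exact H.c_mem e he z (Finset.mem_of_mem_erase hz)
    · rw [Function.update_of_ne hed] at hz
      exact H.c_mem e he z hz
  · intro e he z hG hz
    by_cases hed : e = d
    · subst hed
      rw [Function.update_self, Finset.mem_erase, not_and] at hz
      by_cases hzu : z = u
      · rw [hzu]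
        exact hdead
      · exact H.c_dead e he z hG (hz hzu)
    · rw [Function.update_of_ne hed] at hz
      exact H.c_dead e he z hG hz
  · intro q hq
    rw [Finset.eq_empty_iff_forall_notMem]
    intro e he
    by_cases hed : e = d
    · subst hed
      exact hvP ((hdV' q he).1 ▸ hq)
    · rw [hSV q e hed, H.v_empty q hq] at he
      simp at he
  · intro q e he
    by_cases hed : e = d
    · subst hed
      rw [(hdV' q he).1]
      exact .inr hO
    · exact H.v_sub q e ((hSV q e hed).1 he)
  · intro q e he hA
    by_cases hed : e = d
    · subst hed
      obtain ⟨h₁, _, h₂⟩ := hdV' q he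
      rw [Function.update_self, h₁]
      exact ⟨hO, h₂⟩
    · rw [Function.update_of_ne hed, hκV e hed]
      exact H.v_key q e ((hSV q e hed).1 he) hA
  · intro q hq e hA hO' hS
    by_cases hed : e = d
    · subst hed
      rw [Function.update_self] at hS
      by_cases hqv : q = v
      · rw [hqv]
        exact hdV'' hS
      · exact absurd (H.v_mem q hq e hA hO' (hS.mono (Finset.erase_subset _ _))) (hdis q hqv)
    · rw [Function.update_of_ne hed] at hS
      exact (hSV q e hed).2 (H.v_mem q hq e hA hO' hS)

/-- Separates the heaps stored at `v` from those at the other unprocessed vertices: only the former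
are affected by the value of `v`. -/
theorem IsNext.not_anc_of_own (hn : D.IsNext P v) (hq : q ∉ P) (hqv : q ≠ v)
    (hO : D.Own P q d) : ¬ D.Anc v d := by
  rintro hvd
  obtain ⟨_, c, hc, rfl, hcd⟩ := hO
  have hvc := hn.anc_of_anc hc hcd hvd
  rcases anc_iff.1 hvc with rfl | h
  · exact hn.notMem hc
  · by_cases h0 : D.par c = 0
    · rw [h0] at h
      exact not_anc_zero hn.mem_V h
    · exact hq (hn.mem_of_anc _ ((D.anc_par c).mem (hn.subset hc) h0) h hqv)

theorem IsNext.par_notMem (hn : D.IsNext P v) : D.par v ∉ P :=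
  fun h => hn.not_anc h (D.anc_par v)

/-- The value of `v` is the smallest key, and the corresponding chain is optimal. -/
theorem Core.good (H : D.Core h P (D.Act (insert v P)) D.Grp (D.OwnV P v) SR SV SC κR αR κV κC)
    (hn : D.IsNext P v) (hd : d ∈ SV v) (hA : D.Act (insert v P) d)
    (hmin : ∀ e ∈ SV v, κV d ≤ κV e) (hu : u ∈ SC d) (humin : ∀ z ∈ SC d, κC u ≤ κC z)
    (hw : D.pw u - D.pw v + D.w v ≤ D.w₀) :
    D.Good (update h v (κV d)) u v := by
  have hoff : ∀ z, D.off (update h v (κV d)) P z = D.off h P z := fun z =>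
    off_congr fun x hx => Function.update_of_ne (fun e : x = v => hn.notMem (e ▸ hx)) _ _
  obtain ⟨hO, hk, z, hz, hkz⟩ := H.v_key v d hd hA
  obtain ⟨hG, hκ⟩ := H.c_mem d hA u hu
  -- Within a group the keys `κC` differ from the values of the chains by a constant, so the
  -- minimiser `u` of `κC` attains the value of `d`.
  have hκd : κV d = D.s d - D.off h P u := by
    refine le_antisymm (hk u hu) ?_
    have := humin z hz
    rw [hκ, (H.c_mem d hA z hz).2] at this
    linarith
  have hvd : D.Anc v d := by
    rcases hO with hO | ⟨_, rfl⟩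
    · exact (hn.own_iff.1 hO).2
    · exact D.anc_refl d
  have hvu : D.Anc v u := hvd.trans hG.2.1
  have hdV : d ∈ D.V := hn.isLower_insert.subset hA.1
  refine ⟨hG.1, hvu, hw, ⟨d, ⟨mem_path.2 ⟨hdV, hvd, hG.2.1⟩, fun x hx => ?_⟩, ?_⟩, ?_⟩
  · obtain ⟨hx, hvx, hxu⟩ := mem_path.1 hx
    rcases hxu.total hG.2.1 with h | h
    · exact hA.2 x (hn.isLower_insert.mem v (by simp) x hx hvx) h
    · exact hG.2.2 x hx h hxu
  · rw [hn.sum_path hvu, hoff, Function.update_self, hκd]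
    ring
  · intro z hz hvz hwz e he
    rw [hn.sum_path hvz, hoff, Function.update_self]
    obtain ⟨heV, hve, hez⟩ := mem_path.1 he.1
    -- The ancestors of `e` in `insert v P` all lie on the chain from `v`, so its dominant vertex
    -- `e` is a leader.
    have heA : D.Act (insert v P) e := by
      refine ⟨hn.isLower_insert.mem v (by simp) e heV hve, fun x hx hxe => ?_⟩
      refine he.2 x (mem_path.2 ⟨hn.isLower_insert.subset hx, ?_, hxe.trans hez⟩)
      rcases Finset.mem_insert.1 hx with rfl | hx
      · exact D.anc_refl x
      · exact hn.anc_of_anc hx (hxe.trans hez) hvz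
    have heG : D.Grp e z := ⟨hz, hez, fun x hx hex hxz =>
      he.2 x (mem_path.2 ⟨hx, hve.trans hex, hxz⟩)⟩
    -- A feasible end has not been deleted, since `c_dead` makes deleted ends too heavy for every
    -- unprocessed ancestor, `v` included.
    have hzS : z ∈ SC e := by
      by_contra hzS
      exact absurd hwz (not_le.2 (H.c_dead e heA z heG hzS v hn.mem_V hn.notMem hvz))
    have heO : D.OwnV P v v e := by
      by_cases hev : e = v
      · exact .inr ⟨rfl, hev⟩
      · exact .inl (hn.own_iff.2 ⟨hn.mem_of_anc e heV hve hev, hve⟩)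
    have heS := H.v_mem v hn.notMem e heA heO ⟨z, hzS⟩
    have h₁ := (H.v_key v e heS heA).2.1 z hzS
    have h₂ := hmin e heS
    linarith

/-- The heaps of `v` are passed on to its parent. -/
theorem Core.finish (H : D.Core h P (D.Act (insert v P)) D.Grp (D.OwnV P v) SR SV SC κR αR κV κC)
    (hn : D.IsNext P v) (y : ℝ) {κR' αR' κV' : ℕ → ℝ} (hκR : ∀ z, κR' z = κR z)
    (hαR : ∀ q, ∀ z ∈ SR q, αR' z = if q = v then αR z - y else αR z)
    (hκV : ∀ q, ∀ z ∈ SV q, κV' z = if q = v then κV z - y else κV z) :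
    D.Core (update h v y) (insert v P) (D.Act (insert v P)) D.Grp (D.Own (insert v P))
      (update (update SR v ∅) (D.par v) (SR (D.par v) ∪ SR v))
      (update (update SV v ∅) (D.par v) (SV (D.par v) ∪ SV v)) SC κR' αR' κV' κC := by
  -- Fixing the value `y` at `v` raises `off` by `y` at the descendants of `v` and nowhere else.
  have hoff : ∀ z, D.off (update h v y) (insert v P) z =
      (if D.Anc v z then y else 0) + D.off h P z := fun z => by
    rw [off_insert hn.notMem, Function.update_self,
      off_congr fun x hx => Function.update_of_ne (fun e : x = v => hn.notMem (e ▸ hx)) _ _]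
  have hpv : D.par v ≠ v := par_ne hn.mem_V
  have hm : ∀ (S : ℕ → Finset ℕ) (q d : ℕ),
      d ∈ (update (update S v ∅) (D.par v) (S (D.par v) ∪ S v)) q ↔
        q ≠ v ∧ (d ∈ S q ∨ (q = D.par v ∧ d ∈ S v)) := by
    intro S q d
    by_cases hq : q = D.par v
    · subst hq
      simp [hpv]
    · rw [Function.update_of_ne hq]
      by_cases hqv : q = v
      · subst hqv
        simp
      · simp [hqv, hq]
  have hOwn : ∀ q ∉ insert v P, ∀ d, D.Own (insert v P) q d ↔
      D.OwnV P v q d ∨ (q = D.par v ∧ D.OwnV P v v d) := by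
    intro q hq d
    rw [Finset.mem_insert, not_or] at hq
    constructor
    · rintro ⟨hd, c, hc, rfl, hcd⟩
      rcases Finset.mem_insert.1 hc with rfl | hc
      · refine .inr ⟨rfl, ?_⟩
        rcases Finset.mem_insert.1 hd with rfl | hd
        · exact .inr ⟨rfl, rfl⟩
        · exact .inl (hn.own_iff.2 ⟨hd, hcd⟩)
      · exact .inl (.inl ⟨hn.mem c hc d (hn.isLower_insert.subset hd) hcd, c, hc, rfl, hcd⟩)
    · rintro ((⟨hd, c, hc, hcq, hcd⟩ | ⟨h, _⟩) | ⟨rfl, hO | ⟨_, rfl⟩⟩)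
      · exact ⟨by simp [hd], c, by simp [hc], hcq, hcd⟩
      · exact absurd h hq.1
      · obtain ⟨hd, hvd⟩ := hn.own_iff.1 hO
        exact ⟨by simp [hd], v, by simp, rfl, hvd⟩
      · exact ⟨by simp, d, by simp, rfl, D.anc_refl d⟩
  have hOv : ∀ {d}, D.OwnV P v v d → D.Anc v d := by
    rintro d (hO | ⟨_, rfl⟩)
    · exact (hn.own_iff.1 hO).2
    · exact D.anc_refl d
  have hOn : ∀ {q d}, q ∉ P → q ≠ v → D.OwnV P v q d → ¬ D.Anc v d := by
    rintro q d hq hqv (hO | ⟨h, _⟩)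
    · exact hn.not_anc_of_own hq hqv hO
    · exact absurd h hqv
  -- A leader and the ends in its group are either all below `v` or all not, so the keys in the
  -- group, being differences of `off`, do not change.
  have hGrp : ∀ {d u}, D.Act (insert v P) d → D.Grp d u → (D.Anc v u ↔ D.Anc v d) := by
    intro d u hA hG
    refine ⟨fun hvu => ?_, fun hvd => hvd.trans hG.2.1⟩
    rcases Finset.mem_insert.1 hA.1 with rfl | hd
    · exact D.anc_refl d
    · exact hn.anc_of_anc hd hG.2.1 hvu
  have hne : ∀ {q}, q ∉ insert v P → q ∉ P ∧ q ≠ v := fun hq => by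
    rw [Finset.mem_insert, not_or] at hq
    exact hq.symm
  have hqP : ∀ {S : ℕ → Finset ℕ}, (∀ q ∈ P, S q = ∅) → ∀ {q d}, d ∈ S q → q ∉ P := by
    intro S hS q d hd hq
    simp [hS q hq] at hd
  constructor
  · intro q hq d
    obtain ⟨hq₁, hq₂⟩ := hne hq
    rw [hm, hOwn q hq d, H.r_mem q hq₁, H.r_mem v hn.notMem]
    tauto
  · intro q hq
    rw [Finset.eq_empty_iff_forall_notMem]
    intro d hd
    rw [hm] at hd
    rcases Finset.mem_insert.1 hq with rfl | hq
    · exact hd.1 rfl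
    · rcases hd.2 with hd | hd
      · simp [H.r_empty q hq] at hd
      · exact hn.par_notMem (hd.1 ▸ hq)
  · intro q d hd
    rw [hm] at hd
    rw [hκR]
    rcases hd.2 with hd | hd
    · exact H.r_key q d hd
    · exact H.r_key v d hd.2
  · intro q d hd
    rw [hm] at hd
    obtain ⟨hqv, hd | hd⟩ := hd
    · have hq := hqP H.r_empty hd
      have hA := hOn hq hqv ((H.r_mem q hq d).1 hd).2
      rw [hαR q d hd, if_neg hqv, hoff, if_neg hA, zero_add, H.r_pay q d hd]
    · have hA := hOv ((H.r_mem v hn.notMem d).1 hd.2).2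
      rw [hαR v d hd.2, if_pos rfl, hoff, if_pos hA, H.r_pay v d hd.2]
      ring
  · exact H.c_empty
  · intro d hA u hu
    obtain ⟨h₁, h₂⟩ := H.c_mem d hA u hu
    refine ⟨h₁, ?_⟩
    have e : (if D.Anc v u then y else 0) = if D.Anc v d then y else 0 := by
      simp only [hGrp hA h₁]
    rw [h₂, hoff, hoff, e]
    ring
  · intro d hA u hG hu q hqV hq
    exact H.c_dead d hA u hG hu q hqV (hne hq).1
  · intro q hq
    rw [Finset.eq_empty_iff_forall_notMem]
    intro d hd
    rw [hm] at hd
    rcases Finset.mem_insert.1 hq with rfl | hq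
    · exact hd.1 rfl
    · rcases hd.2 with hd | hd
      · simp [H.v_empty q hq] at hd
      · exact hn.par_notMem (hd.1 ▸ hq)
  · intro q d hd
    rw [hm] at hd
    left
    rw [Finset.mem_insert]
    rcases hd.2 with hd | hd
    · rcases H.v_sub q d hd with h | h | h
      · exact .inr h
      · exact .inr h.1
      · exact .inl h.2
    · rcases H.v_sub v d hd.2 with h | h | h
      · exact .inr h
      · exact .inr h.1
      · exact .inl h.2
  · intro q d hd hA
    rw [hm] at hd
    obtain ⟨hqv, hd | ⟨rfl, hd⟩⟩ := hd
    · have hq := hqP H.v_empty hd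
      obtain ⟨hO, hk, z, hz, hkz⟩ := H.v_key q d hd hA
      have hAn := hOn hq hqv hO
      have hAn' : ∀ u ∈ SC d, ¬ D.Anc v u := fun u hu => by
        rwa [hGrp hA (H.c_mem d hA u hu).1]
      refine ⟨(hOwn q (by simp [hqv, hq]) d).2 (.inl hO), fun u hu => ?_, z, hz, ?_⟩
      · rw [hκV q d hd, if_neg hqv, hoff, if_neg (hAn' u hu), zero_add]
        exact hk u hu
      · rw [hκV q d hd, if_neg hqv, hoff, if_neg (hAn' z hz), zero_add, hkz]
    · obtain ⟨hO, hk, z, hz, hkz⟩ := H.v_key v d hd hA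
      have hAn := hOv hO
      have hAn' : ∀ u ∈ SC d, D.Anc v u := fun u hu => by
        rwa [hGrp hA (H.c_mem d hA u hu).1]
      refine ⟨(hOwn _ (by simp [hqv, hn.par_notMem]) d).2 (.inr ⟨rfl, hO⟩), fun u hu => ?_,
        z, hz, ?_⟩
      · rw [hκV v d hd, if_pos rfl, hoff, if_pos (hAn' u hu)]
        linarith [hk u hu]
      · rw [hκV v d hd, if_pos rfl, hoff, if_pos (hAn' z hz), hkz]
        ring
  · intro q hq d hA hO hS
    obtain ⟨hq₁, hq₂⟩ := hne hq
    rw [hm]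
    refine ⟨hq₂, ?_⟩
    rcases (hOwn q hq d).1 hO with hO' | ⟨rfl, hO'⟩
    · exact .inl (H.v_mem q hq₁ d hA hO' hS)
    · exact .inr ⟨rfl, H.v_mem v hn.notMem d hA hO' hS⟩

end TreeData
end ChainPartition

end

noncomputable section

namespace ChainPartition

/-! ### Processing a vertex

Natural variables: `0` number of vertices, `1` counter, `2` current vertex. Real variables: `0`
threshold, `1` unit for sizes, `2`, `3` key and payload arguments, `5` total cost, `6` zero. Natural
arrays: `1` parents, `4` order, `5` absorbed leaders, `6` ends of optimal chains. Real arrays: `0`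
weights, `1` costs, `2` ranks, `6` weights from the root, `7` values. Heaps: `0` leaders by rank,
`1` leaders by value, `2` chains of a leader. -/

open Program NatExp RealExp Test
open Function (update)

/-- The machine has no real constants; real variable `6` keeps its initial zero and serves as the
constant. The key is zero because the chain of `v` alone has nothing below its top. -/
def startGroup : Program :=
  setRealVar 2 (.var 6);; setRealVar 3 (.var 6);; insertHeap 2 2 2

/-- The entry of a root is relative to `0` and hence is its key. The input arrays are numbered from
`0`, hence the predecessor of the vertex. -/
def absorbTest : Test :=
  .and (.not (.natEq (.get (rootArr 0) (.var 2)) (.const 0)))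
    (.realLe (.get (keyDiff 0) (.get (rootArr 0) (.var 2))) (.get 2 (.pred (.var 2))))

/-- The payload -off(d) from the rank heap is added to the whole group of the leader, after which
its keys fit those of the current vertex. The leader is only flagged in array `5`; it need not be
the root of its value heap, and only roots are removed. -/
def absorbStep : Program :=
  setNatVar 3 (.get (rootArr 0) (.var 2));;
  setRealVar 2 (.get (payDiff 0) (.var 3));;
  setRealVar 3 (.var 6);;
  popHeap 0 2;;
  setNatArr 5 (.var 3) (.const 1);;
  addHeap 2 3;;
  meldInto 2 2 3

def addLeader : Program :=
  setRealVar 2 (.get 2 (.pred (.var 2)));;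
  setRealVar 3 (.var 6);;
  insertHeap 0 2 2;;
  setRealVar 2 (.add (.get 1 (.pred (.var 2))) (.get (keyDiff 2) (.get (rootArr 2) (.var 2))));;
  insertHeap 1 2 2

/-- The best leader is stale, or its best chain is too heavy when started at the current vertex. -/
def pruneTest : Test :=
  .or (.natEq (.get 5 (.get (rootArr 1) (.var 2))) (.const 1))
    (.not (.realLe (.add (.sub (.get 6 (.get (rootArr 2) (.get (rootArr 1) (.var 2))))
      (.get 6 (.var 2))) (.get 0 (.pred (.var 2)))) (.var 0)))

/-- The value minus the key of the best end is s(d) - off(d), the same for all ends. It is saved in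
real variable `2`, and the key of the next best end is added to it to give the new value. -/
def dropChain : Program :=
  setRealVar 2 (.sub (.get (keyDiff 1) (.var 3)) (.get (keyDiff 2) (.get (rootArr 2) (.var 3))));;
  setRealVar 3 (.var 6);;
  popHeap 1 2;;
  popHeap 2 3;;
  ite (.natEq (.get (rootArr 2) (.var 3)) (.const 0)) skip
    (setRealVar 2 (.add (.var 2) (.get (keyDiff 2) (.get (rootArr 2) (.var 3))));;
      insertHeap 1 2 3)

def pruneStep : Program :=
  setNatVar 3 (.get (rootArr 1) (.var 2));;
  ite (.natEq (.get 5 (.var 3)) (.const 1)) (popHeap 1 2) dropChain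

/-- With y the value of the vertex, y is subtracted from the payloads of its rank heap and from the
keys of its value heap. The groups, whose keys are differences, are left alone. -/
def finishVertex : Program :=
  setRealVar 4 (.get (keyDiff 1) (.get (rootArr 1) (.var 2)));;
  setNatArr 6 (.var 2) (.get (rootArr 2) (.get (rootArr 1) (.var 2)));;
  setRealArr 7 (.var 2) (.var 4);;
  setRealVar 5 (.add (.var 5) (.var 4));;
  setNatVar 5 (.get 1 (.var 2));;
  setRealVar 2 (.var 6);;
  setRealVar 3 (.sub (.var 6) (.var 4));;
  addHeap 0 2;;
  setRealVar 2 (.var 3);;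
  setRealVar 3 (.var 6);;
  addHeap 1 2;;
  meldInto 0 5 2;;
  meldInto 1 5 2

def processVertex : Program :=
  startGroup;;
  .while absorbTest absorbStep;;
  addLeader;;
  .while pruneTest pruneStep;;
  finishVertex

/-! ### What the store holds during the computation. -/

/-- The part of the store that does not change while a vertex is processed. -/
structure Env (D : TreeData) (ord : ℕ → ℕ) (u : ℝ) (k v : ℕ) (σ : Store) : Prop where
  n_eq : σ.natVar 0 = D.n
  k_eq : σ.natVar 1 = k
  v_eq : σ.natVar 2 = v
  w₀_eq : σ.realVar 0 = D.w₀
  u_eq : σ.realVar 1 = u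
  zero_eq : σ.realVar 6 = 0
  par_eq : σ.natArr 1 = D.par
  ord_eq : σ.natArr 4 = ord
  w_eq : ∀ x ∈ D.V, σ.realArr 0 (x - 1) = D.w x
  s_eq : ∀ x ∈ D.V, σ.realArr 1 (x - 1) = D.s x
  r_eq : ∀ x ∈ D.V, σ.realArr 2 (x - 1) = D.r x
  pw_eq : ∀ x ∈ D.V, σ.realArr 6 x = D.pw x
  u_pos : 2 ≤ D.n → 0 < u

/-- The contents of the three families of heaps. -/
structure Contents where
  SR : ℕ → Finset ℕ
  SV : ℕ → Finset ℕ
  SC : ℕ → Finset ℕ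
  κR : ℕ → ℝ
  αR : ℕ → ℝ
  κV : ℕ → ℝ
  αV : ℕ → ℝ
  κC : ℕ → ℝ
  αC : ℕ → ℝ

/-- The number of nodes in a family of heaps. -/
def tot (n : ℕ) (S : ℕ → Finset ℕ) : ℕ := ∑ q ∈ Finset.range (n + 1), (S q).card

/-- The potential of the amortised analysis: each iteration of an inner loop lowers it by at least
one, and each vertex raises it by at most three. -/
def Contents.pot (g : Contents) (n : ℕ) : ℕ := tot n g.SR + tot n g.SV + tot n g.SC

structure State (D : TreeData) (ord : ℕ → ℕ) (u : ℝ) (k v : ℕ) (σ : Store) (P : Finset ℕ)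
    (A : ℕ → Prop) (G O : ℕ → ℕ → Prop) (g : Contents) : Prop where
  env : Env D ord u k v σ
  famR : HeapFam D.n 0 σ u g.SR g.κR g.αR
  famV : HeapFam D.n 1 σ u g.SV g.κV g.αV
  famC : HeapFam D.n 2 σ u g.SC g.κC g.αC
  core : D.Core (σ.realArr 7) P A G O g.SR g.SV g.SC g.κR g.αR g.κV g.κC
  absorbed : ∀ d, σ.natArr 5 d = 1 ↔ d ∈ P ∧ ¬ A d
  good : ∀ x ∈ P, D.Good (σ.realArr 7) (σ.natArr 6 x) x
  total : σ.realVar 5 = ∑ x ∈ P, σ.realArr 7 x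

variable {n k v w d i j l : ℕ} {S : ℕ → Finset ℕ} {κ α : ℕ → ℝ} {D : TreeData} {ord : ℕ → ℕ}
  {u r : ℝ} {σ τ : Store} {P B : Finset ℕ} {A : ℕ → Prop} {G O : ℕ → ℕ → Prop} {g : Contents}

/-! ### Counting heap nodes; separation of the memory of the three families. -/

theorem tot_update (hv : v ≤ n) (T : Finset ℕ) :
    tot n (update S v T) + (S v).card = tot n S + T.card := by
  have hv' : v ∈ Finset.range (n + 1) := by simp; omega
  unfold tot
  rw [← Finset.add_sum_erase _ _ hv', ← Finset.add_sum_erase _ (fun q => (S q).card) hv']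
  have : ∑ q ∈ (Finset.range (n + 1)).erase v, (update S v T q).card =
      ∑ q ∈ (Finset.range (n + 1)).erase v, (S q).card :=
    Finset.sum_congr rfl fun q hq => by rw [Function.update_of_ne (Finset.ne_of_mem_erase hq)]
  rw [this, Function.update_self]
  ring

theorem tot_erase (hv : v ≤ n) (hd : d ∈ S v) :
    tot n (update S v ((S v).erase d)) + 1 = tot n S := by
  have h₁ := tot_update (S := S) hv ((S v).erase d)
  have h₂ := Finset.card_erase_add_one hd
  omega

theorem tot_insert (hv : v ≤ n) (hd : d ∉ S v) :
    tot n (update S v (insert d (S v))) = tot n S + 1 := by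
  have h₁ := tot_update (S := S) hv (insert d (S v))
  have h₂ := Finset.card_insert_of_notMem hd
  omega

theorem tot_meld (hv : v ≤ n) (hw : w ≤ n) (hvw : v ≠ w) (hd : Disjoint (S v) (S w)) :
    tot n (update (update S w ∅) v (S v ∪ S w)) = tot n S := by
  have h₁ := tot_update (S := S) hw ∅
  have h₂ := tot_update (S := update S w ∅) hv (S v ∪ S w)
  rw [Function.update_of_ne hvw, Finset.card_union_of_disjoint hd] at h₂
  simp at h₁
  omega

/-- Different kinds occupy disjoint triples of arrays, all with numbers from `20` on. -/
theorem HeapFam.frame {k' : ℕ} (h : HeapFam n k σ u S κ α) (hf : HeapFrame k' σ τ)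
    (hk : k ≠ k') : HeapFam n k τ u S κ α := by
  refine h.congr (hf.natArr _ ?_ ?_ ?_) (hf.natArr _ ?_ ?_ ?_) (hf.natArr _ ?_ ?_ ?_)
    (hf.realArr _ ?_ ?_ ?_) (hf.realArr _ ?_ ?_ ?_) (hf.realArr _ ?_ ?_ ?_)
    (fun _ _ _ => rfl) fun _ _ _ => rfl
  all_goals
    simp only [left, right, rootArr, keyDiff, payDiff, sizeArr]
    omega

theorem HeapFrame.natArr_lt (hf : HeapFrame k σ τ) {a : ℕ} (ha : a < 20) :
    τ.natArr a = σ.natArr a := by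
  refine hf.natArr a ?_ ?_ ?_
  all_goals
    simp only [left, right, rootArr]
    omega

theorem HeapFrame.realArr_lt (hf : HeapFrame k σ τ) {a : ℕ} (ha : a < 20) :
    τ.realArr a = σ.realArr a := by
  refine hf.realArr a ?_ ?_ ?_
  all_goals
    simp only [keyDiff, payDiff, sizeArr]
    omega

theorem Env.frame {k' : ℕ} (h : Env D ord u k v σ) (hf : HeapFrame k' σ τ) :
    Env D ord u k v τ where
  n_eq := (hf.natVar 0 (by norm_num)).trans h.n_eq
  k_eq := (hf.natVar 1 (by norm_num)).trans h.k_eq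
  v_eq := (hf.natVar 2 (by norm_num)).trans h.v_eq
  w₀_eq := (congrFun hf.realVar 0).trans h.w₀_eq
  u_eq := (congrFun hf.realVar 1).trans h.u_eq
  zero_eq := (congrFun hf.realVar 6).trans h.zero_eq
  par_eq := (hf.natArr_lt (by norm_num)).trans h.par_eq
  ord_eq := (hf.natArr_lt (by norm_num)).trans h.ord_eq
  w_eq x hx := (congrFun (hf.realArr_lt (by norm_num)) _).trans (h.w_eq x hx)
  s_eq x hx := (congrFun (hf.realArr_lt (by norm_num)) _).trans (h.s_eq x hx)
  r_eq x hx := (congrFun (hf.realArr_lt (by norm_num)) _).trans (h.r_eq x hx)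
  pw_eq x hx := (congrFun (hf.realArr_lt (by norm_num)) _).trans (h.pw_eq x hx)
  u_pos := h.u_pos

theorem State.setRealVar (H : State D ord u k v σ P A G O g) (hi : 2 ≤ i) (hi' : i ≤ 4) :
    State D ord u k v (σ.setRealVar i r) P A G O g := by
  have h0 : 0 ≠ i := by omega
  have h1 : 1 ≠ i := by omega
  have h5 : 5 ≠ i := by omega
  have h6 : 6 ≠ i := by omega
  obtain ⟨⟨e₁, e₂, e₃, e₄, e₅, e₆, e₇, e₈, e₉, e₁₀, e₁₁, e₁₂, e₁₃⟩, h₁, h₂, h₃, h₄, h₅, h₆,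
    h₇⟩ := H
  refine ⟨⟨e₁, e₂, e₃, ?_, ?_, ?_, e₇, e₈, e₉, e₁₀, e₁₁, e₁₂, e₁₃⟩, ?_, ?_, ?_, h₄, h₅, h₆, ?_⟩
  · simpa [h0] using e₄
  · simpa [h1] using e₅
  · simpa [h6] using e₆
  · exact h₁.congr rfl rfl rfl rfl rfl rfl (fun _ _ _ => rfl) fun _ _ _ => rfl
  · exact h₂.congr rfl rfl rfl rfl rfl rfl (fun _ _ _ => rfl) fun _ _ _ => rfl
  · exact h₃.congr rfl rfl rfl rfl rfl rfl (fun _ _ _ => rfl) fun _ _ _ => rfl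
  · simpa [h5] using h₇

theorem State.setNatVar (H : State D ord u k v σ P A G O g) (hi : 3 ≤ i) :
    State D ord u k v (σ.setNatVar i j) P A G O g := by
  have h0 : 0 ≠ i := by omega
  have h1 : 1 ≠ i := by omega
  have h2 : 2 ≠ i := by omega
  obtain ⟨⟨e₁, e₂, e₃, e₄, e₅, e₆, e₇, e₈, e₉, e₁₀, e₁₁, e₁₂, e₁₃⟩, h₁, h₂, h₃, h₄, h₅, h₆,
    h₇⟩ := H
  refine ⟨⟨?_, ?_, ?_, e₄, e₅, e₆, e₇, e₈, e₉, e₁₀, e₁₁, e₁₂, e₁₃⟩, ?_, ?_, ?_, h₄, h₅, h₆, h₇⟩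
  · simpa [h0] using e₁
  · simpa [h1] using e₂
  · simpa [h2] using e₃
  · exact h₁.congr rfl rfl rfl rfl rfl rfl (fun _ _ _ => rfl) fun _ _ _ => rfl
  · exact h₂.congr rfl rfl rfl rfl rfl rfl (fun _ _ _ => rfl) fun _ _ _ => rfl
  · exact h₃.congr rfl rfl rfl rfl rfl rfl (fun _ _ _ => rfl) fun _ _ _ => rfl

/-- Assembles the state after a heap operation. -/
theorem State.of_frame {k' : ℕ} {A' : ℕ → Prop} {G' O' : ℕ → ℕ → Prop} {g' : Contents}
    (H : State D ord u k v σ P A G O g) (hf : HeapFrame k' σ τ)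
    (famR : HeapFam D.n 0 τ u g'.SR g'.κR g'.αR) (famV : HeapFam D.n 1 τ u g'.SV g'.κV g'.αV)
    (famC : HeapFam D.n 2 τ u g'.SC g'.κC g'.αC)
    (core : D.Core (σ.realArr 7) P A' G' O' g'.SR g'.SV g'.SC g'.κR g'.αR g'.κV g'.κC)
    (hA : ∀ d ∈ P, A' d ↔ A d) :
    State D ord u k v τ P A' G' O' g' where
  env := H.env.frame hf
  famR := famR
  famV := famV
  famC := famC
  core := by rwa [hf.realArr_lt (by norm_num)]
  absorbed d := by
    rw [hf.natArr_lt (by norm_num), H.absorbed]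
    exact and_congr_right fun hd => by rw [hA d hd]
  good x hx := by
    rw [hf.realArr_lt (by norm_num), hf.natArr_lt (by norm_num)]
    exact H.good x hx
  total := by rw [hf.realVar, hf.realArr_lt (by norm_num)]; exact H.total

/-! ### Correctness and amortised cost of the phases. -/

theorem ensures_startGroup (H : State D ord u k v σ P (D.Act P) D.Grp (D.Own P) g)
    (hn : D.IsNext P v) (hl : D.n < 2 ^ l) :
    Ensures startGroup σ fun t τ => t ≤ 160 * l + 110 ∧ ∃ g' : Contents,
      g'.pot D.n ≤ g.pot D.n + 1 ∧
      State D ord u k v τ P (D.ActB P ∅ v) (D.GrpB ∅ v) (D.Own P) g' := by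
  have hvn : v ≤ D.n := (Finset.mem_Icc.1 hn.mem_V).2
  have hvC : ∀ q, v ∉ g.SC q := fun q hq => by
    by_cases hA : D.Act P q
    · exact hn.not_anc hA.1 (H.core.c_mem q hA v hq).1.2.1
    · simp [H.core.c_empty q hA] at hq
  simp only [startGroup, ensures_seq, ensures_setRealVar, RealExp.eval, Store.realVar_setRealVar,
    H.env.zero_eq]
  rw [Function.update_of_ne (by norm_num), H.env.zero_eq]
  have H' := ((H.setRealVar (i := 2) (r := 0) (by norm_num) (by norm_num)).setRealVar (i := 3)
    (r := 0) (by norm_num) (by norm_num))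
  have h2 : ((σ.setRealVar 2 0).setRealVar 3 0).realVar 2 = 0 := by simp
  refine (ensures_insertHeap H'.famC hl H'.env.u_pos (by norm_num) (by norm_num) H'.env.v_eq
    H'.env.v_eq hn.mem_V hvC H'.env.u_eq).mono ?_
  rintro t τ ⟨ht, hfam, hf⟩
  rw [h2] at hfam
  refine ⟨by simp [RealExp.time]; omega, ⟨g.SR, g.SV, update g.SC v (insert v (g.SC v)), g.κR,
    g.αR, g.κV, g.αV, update g.κC v 0, _⟩, ?_, H'.of_frame hf (H'.famR.frame hf (by norm_num))
    (H'.famV.frame hf (by norm_num)) hfam (H.core.start hn) ?_⟩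
  · have := tot_insert (n := D.n) (S := g.SC) hvn (hvC v)
    simp only [Contents.pot]
    omega
  · intro d hd
    have : d ≠ v := fun e => hn.notMem (e ▸ hd)
    simp [TreeData.ActB, this]

theorem ensures_absorb (H : State D ord u k v σ P (D.ActB P ∅ v) (D.GrpB ∅ v) (D.Own P) g)
    (hn : D.IsNext P v) (hl : D.n < 2 ^ l) :
    Ensures (.while absorbTest absorbStep) σ fun t τ => ∃ g' : Contents,
      t + (1000 * l + 1000) * g'.pot D.n ≤ (1000 * l + 1000) * g.pot D.n + 20 ∧
      State D ord u k v τ P (D.Act (insert v P)) D.Grp (D.Own P) g' := by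
  have hvn : v ≤ D.n := (Finset.mem_Icc.1 hn.mem_V).2
  have hne : ∀ {d}, d ∈ P → d ≠ v := fun hd e => hn.notMem (e ▸ hd)
  -- The set `B` of leaders absorbed so far exists only in the proof; the potential is the number of
  -- heap nodes times the price of one iteration.
  refine (ensures_while_of_potential (b := absorbTest) (p := absorbStep)
    (Inv := fun m σ => ∃ (g : Contents) (B : Finset ℕ), m = (1000 * l + 1000) * g.pot D.n ∧
      (∀ d ∈ B, D.Act P d ∧ D.Own P v d ∧ D.r d ≤ D.r v) ∧
      State D ord u k v σ P (D.ActB P B v) (D.GrpB B v) (D.Own P) g) ?_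
    (m := (1000 * l + 1000) * g.pot D.n) (σ := σ) ⟨g, ∅, rfl, by simp, H⟩).mono ?_
  · clear! σ g
    rintro m σ ⟨g, B, rfl, hB, H⟩ ⟨hb₁, hb₂⟩
    simp only [Test.Holds, NatExp.eval, RealExp.eval, H.env.v_eq] at hb₁ hb₂
    obtain ⟨d, hd⟩ : ∃ d, σ.natArr (rootArr 0) v = d := ⟨_, rfl⟩
    rw [hd] at hb₁ hb₂
    have hroot := H.famR.heap v
    rw [hd] at hroot
    have hdS : d ∈ g.SR v := hroot.root_mem hb₁
    obtain ⟨hdA, hdO⟩ := (H.core.r_mem v hn.notMem d).1 hdS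
    have hdv := hne hdO.1
    have hrd : D.r d ≤ D.r v := by
      have := hroot.key_root hb₁
      rw [this, H.core.r_key v d hdS, H.env.r_eq v hn.mem_V] at hb₂
      linarith
    have hdn : d ≤ D.n := (Finset.mem_Icc.1 (hn.subset hdO.1)).2
    have hpay : σ.realArr (payDiff 0) d = g.αR d := by
      rw [hroot.pay_root hb₁, sub_zero]
    simp only [absorbStep, ensures_seq, ensures_setRealVar, ensures_setNatVar]
    simp only [NatExp.eval, RealExp.eval, H.env.v_eq, hd, Store.natVar_setNatVar,
      Store.realArr_setNatVar, Function.update_self, hpay, Store.realVar_setRealVar,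
      Store.realVar_setNatVar]
    rw [Function.update_of_ne (by norm_num), H.env.zero_eq]
    have H₁ := ((H.setNatVar (i := 3) (j := d) (by norm_num)).setRealVar (i := 2) (r := g.αR d)
      (by norm_num) (by norm_num)).setRealVar (i := 3) (r := 0) (by norm_num) (by norm_num)
    generalize hσ₁ : ((σ.setNatVar 3 d).setRealVar 2 (g.αR d)).setRealVar 3 0 = σ₁ at H₁
    have hd₁ : σ₁.natVar 3 = d := by rw [← hσ₁]; simp
    have hr₁ : σ₁.natArr (rootArr 0) v = d := by rw [← hσ₁]; simpa using hd
    have hk₁ : σ₁.realVar 2 = g.αR d := by rw [← hσ₁]; simp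
    refine (ensures_popHeap H₁.famR hl H₁.env.u_pos (by norm_num) H₁.env.v_eq
      (by rw [hr₁]; exact hb₁)).mono ?_
    rintro t₂ σ₂ ⟨ht₂, hR₂, hf₂⟩
    rw [hr₁] at hR₂
    have hd₂ : σ₂.natVar 3 = d := (hf₂.natVar 3 (by norm_num)).trans hd₁
    rw [ensures_setNatArr]
    simp only [NatExp.eval, hd₂]
    have hfam₃ : ∀ {k S κ α}, HeapFam D.n k σ₂ u S κ α →
        HeapFam D.n k (σ₂.setNatArr 5 d 1) u S κ α := by
      intro k S κ α h
      have h₁ : left k ≠ 5 := by simp only [left]; omega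
      have h₂ : right k ≠ 5 := by simp only [right]; omega
      have h₃ : rootArr k ≠ 5 := by simp only [rootArr]; omega
      exact h.congr (by simp [h₁]) (by simp [h₂]) (by simp [h₃]) rfl rfl rfl (fun _ _ _ => rfl)
        fun _ _ _ => rfl
    have hR₃ := hfam₃ hR₂
    have hV₃ := hfam₃ (H₁.famV.frame hf₂ (by norm_num))
    have hC₃ := hfam₃ (H₁.famC.frame hf₂ (by norm_num))
    have hE₂ := H₁.env.frame hf₂
    have hE₃ : Env D ord u k v (σ₂.setNatArr 5 d 1) := by
      obtain ⟨e₁, e₂, e₃, e₄, e₅, e₆, e₇, e₈, e₉, e₁₀, e₁₁, e₁₂, e₁₃⟩ := hE₂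
      exact ⟨e₁, e₂, e₃, e₄, e₅, e₆, by simpa using e₇, by simpa using e₈, e₉, e₁₀, e₁₁, e₁₂, e₁₃⟩
    refine (ensures_addHeap hC₃ (x := 3) (v := d) (by simpa using hd₂)).mono ?_
    rintro t₄ σ₄ ⟨ht₄, hC₄, hf₄, -⟩
    have hv2 : (σ₂.setNatArr 5 d 1).realVar 2 = g.αR d := by
      rw [Store.realVar_setNatArr, hf₂.realVar, hk₁]
    rw [hv2] at hC₄
    have hd₄ : σ₄.natVar 3 = d := (hf₄.natVar 3 (by norm_num)).trans (by simpa using hd₂)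
    have hE₄ := hE₃.frame hf₄
    refine (ensures_meldInto hC₄ hl hE₄.u_pos (by norm_num) (by norm_num) hE₄.v_eq hd₄
      hdv.symm).mono ?_
    rintro t₅ σ₅ ⟨ht₅, hC₅, hf₅⟩
    have hreal : ∀ a < 20, σ₅.realArr a = σ.realArr a := fun a ha => by
      rw [hf₅.realArr_lt ha, hf₄.realArr_lt ha, Store.realArr_setNatArr, hf₂.realArr_lt ha, ← hσ₁]
      rfl
    have hnat : ∀ a < 20, a ≠ 5 → σ₅.natArr a = σ.natArr a := fun a ha ha5 => by
      rw [hf₅.natArr_lt ha, hf₄.natArr_lt ha, Store.natArr_setNatArr, Function.update_of_ne ha5,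
        hf₂.natArr_lt ha, ← hσ₁]
      rfl
    have hnat5 : σ₅.natArr 5 = update (σ.natArr 5) d 1 := by
      rw [hf₅.natArr_lt (by norm_num), hf₄.natArr_lt (by norm_num), Store.natArr_setNatArr,
        Function.update_self, hf₂.natArr_lt (by norm_num), ← hσ₁]
      rfl
    have hvar : σ₅.realVar 5 = σ.realVar 5 := by
      rw [hf₅.realVar, hf₄.realVar, Store.realVar_setNatArr, hf₂.realVar, ← hσ₁]
      simp
    refine ⟨_, ⟨⟨update g.SR v ((g.SR v).erase d), g.SV,
      update (update g.SC d ∅) v (g.SC v ∪ g.SC d), g.κR, g.αR, g.κV, g.αV,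
      fun z => if z ∈ g.SC d then g.κC z + g.αR d else g.κC z,
      fun z => if z ∈ g.SC d then g.αC z + (σ₂.setNatArr 5 d 1).realVar 3 else g.αC z⟩,
      insert d B, rfl, ?_, ?_⟩, ?_⟩
    rotate_right
    · simp only [Contents.pot]
      have h₁ := tot_erase (n := D.n) (S := g.SR) hvn hdS
      have h₂ := tot_meld (n := D.n) (S := g.SC) hvn hdn hdv.symm (H.famC.disjoint v d hdv.symm)
      rw [h₂, ← h₁]
      simp [NatExp.time, RealExp.time, absorbTest, Test.time]
      have : (1000 * l + 1000) * (tot D.n (update g.SR v ((g.SR v).erase d)) + 1 + tot D.n g.SV +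
          tot D.n g.SC) = (1000 * l + 1000) * (tot D.n (update g.SR v ((g.SR v).erase d)) +
          tot D.n g.SV + tot D.n g.SC) + (1000 * l + 1000) := by ring
      rw [this]
      omega
    · intro e he
      rcases Finset.mem_insert.1 he with rfl | he
      · exact ⟨(hdA.resolve_right hdv).1, hdO, hrd⟩
      · exact hB e he
    · refine ⟨hE₄.frame hf₅, (hR₃.frame hf₄ (by norm_num)).frame hf₅ (by norm_num),
        (hV₃.frame hf₄ (by norm_num)).frame hf₅ (by norm_num), hC₅, ?_, ?_, ?_, ?_⟩
      · rw [hreal 7 (by norm_num)]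
        exact H.core.absorb hn hdS
          (fun q hq h => Finset.disjoint_left.1 (H.famR.disjoint q v hq) h hdS)
          fun e he => H.famC.disjoint e d he
      · intro e
        rw [hnat5]
        by_cases hed : e = d
        · subst hed
          simp [TreeData.ActB, hdv, hdO.1]
        · rw [Function.update_of_ne hed, H.absorbed]
          simp [TreeData.ActB, hed]
      · intro x hx
        rw [hreal 7 (by norm_num), hnat 6 (by norm_num) (by norm_num)]
        exact H.good x hx
      · rw [hvar, hreal 7 (by norm_num)]
        exact H.total
  · rintro t τ ⟨m, ⟨g', B, rfl, hB, H'⟩, hb, ht⟩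
    refine ⟨g', ?_, ?_⟩
    · simp [absorbTest, Test.time, NatExp.time, RealExp.time] at ht
      omega
    -- If some remaining rank were at most that of `v`, so would be that of the root, and the loop
    -- would not have ended.
    · have hR : ∀ d ∈ g'.SR v, D.r v < D.r d := by
        intro d hd
        by_contra hr
        refine hb ?_
        have hroot := H'.famR.heap v
        have h0 : τ.natArr (rootArr 0) v ≠ 0 := fun e => by
          rw [hroot.eq_zero_iff.1 e] at hd
          simp at hd
        have hmem := hroot.root_mem h0
        have hle := hroot.root_le hd
        have hk := hroot.key_root h0
        rw [H'.core.r_key v _ hd, H'.core.r_key v _ hmem] at hle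
        rw [H'.core.r_key v _ hmem] at hk
        refine ⟨?_, ?_⟩
        · simpa [Test.Holds, NatExp.eval, H'.env.v_eq] using h0
        · simp only [Test.Holds, RealExp.eval, NatExp.eval, H'.env.v_eq]
          rw [hk, H'.env.r_eq v hn.mem_V]
          linarith
      obtain ⟨hA, hcore⟩ := H'.core.finish_absorb hn hB hR
      exact ⟨H'.env, H'.famR, H'.famV, H'.famC, hcore, fun d => (H'.absorbed d).trans
        (and_congr_right fun hd => by rw [hA d]), H'.good, H'.total⟩

theorem TreeData.IsNext.act_insert (hn : D.IsNext P v) : D.Act (insert v P) v := by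
  refine ⟨by simp, fun x hx hxd => ?_⟩
  rcases Finset.mem_insert.1 hx with rfl | hx
  · exact le_rfl
  · exact absurd hxd (hn.not_anc hx)

theorem TreeData.grp_self (hv : v ∈ D.V) : D.Grp v v :=
  ⟨hv, D.anc_refl v, fun x hx h₁ h₂ => by rw [h₁.antisymm h₂ hx]⟩

/-- A vertex whose own chain is feasible is not removed from its group. -/
theorem TreeData.Core.self_mem {h : ℕ → ℝ} {SR SV SC : ℕ → Finset ℕ} {κR αR κV κC : ℕ → ℝ}
    (H : D.Core h P (D.Act (insert v P)) D.Grp O SR SV SC κR αR κV κC) (hn : D.IsNext P v) :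
    v ∈ SC v := by
  by_contra hv
  have := H.c_dead v hn.act_insert v (grp_self hn.mem_V) hv v hn.mem_V hn.notMem (D.anc_refl v)
  have := D.w_le v hn.mem_V
  linarith

theorem ensures_addLeader
    (H : State D ord u k v σ P (D.Act (insert v P)) D.Grp (D.Own P) g)
    (hn : D.IsNext P v) (hl : D.n < 2 ^ l) :
    Ensures addLeader σ fun t τ => t ≤ 320 * l + 250 ∧ ∃ g' : Contents,
      g'.pot D.n ≤ g.pot D.n + 2 ∧
      State D ord u k v τ P (D.Act (insert v P)) D.Grp (D.OwnV P v) g' := by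
  have hvn : v ≤ D.n := (Finset.mem_Icc.1 hn.mem_V).2
  have hvR : ∀ q, v ∉ g.SR q := fun q hq => by
    by_cases hqP : q ∈ P
    · simp [H.core.r_empty q hqP] at hq
    · exact hn.notMem ((H.core.r_mem q hqP v).1 hq).2.1
  have hvV : ∀ q, v ∉ g.SV q := fun q hq =>
    hn.notMem ((H.core.v_sub q v hq).elim id fun h => h.1)
  simp only [addLeader, ensures_seq, ensures_setRealVar, RealExp.eval, NatExp.eval,
    Store.realVar_setRealVar, H.env.v_eq, H.env.r_eq v hn.mem_V]
  rw [Function.update_of_ne (by norm_num), H.env.zero_eq]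
  have H₁ := ((H.setRealVar (i := 2) (r := D.r v) (by norm_num) (by norm_num)).setRealVar (i := 3)
    (r := 0) (by norm_num) (by norm_num))
  have h2 : ((σ.setRealVar 2 (D.r v)).setRealVar 3 0).realVar 2 = D.r v := by simp
  have h3 : ((σ.setRealVar 2 (D.r v)).setRealVar 3 0).realVar 3 = 0 := by simp
  refine (ensures_insertHeap H₁.famR hl H₁.env.u_pos (by norm_num) (by norm_num) H₁.env.v_eq
    H₁.env.v_eq hn.mem_V hvR H₁.env.u_eq).mono ?_
  rintro t₂ σ₂ ⟨ht₂, hR₂, hf₂⟩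
  rw [h2, h3] at hR₂
  have hE₂ := H₁.env.frame hf₂
  have hC₂ := H₁.famC.frame hf₂ (by norm_num)
  have hV₂ := H₁.famV.frame hf₂ (by norm_num)
  have hreal₂ : ∀ a < 20, σ₂.realArr a = σ.realArr a := fun a ha => hf₂.realArr_lt ha
  have hnat₂ : ∀ a < 20, σ₂.natArr a = σ.natArr a := fun a ha => hf₂.natArr_lt ha
  have hvC : v ∈ g.SC v := H.core.self_mem hn
  have hroot := hC₂.heap v
  have h0 : σ₂.natArr (rootArr 2) v ≠ 0 := fun e => by
    rw [hroot.eq_zero_iff.1 e] at hvC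
    simp at hvC
  rw [hE₂.v_eq, hE₂.s_eq v hn.mem_V, hroot.key_root h0, sub_zero]
  have hmem := hroot.root_mem h0
  have hmin := fun z (hz : z ∈ g.SC v) => hroot.root_le hz
  generalize σ₂.natArr (rootArr 2) v = c at hmem hmin
  have hcm := fun z (hz : z ∈ g.SC v) => (H.core.c_mem v hn.act_insert z hz).2
  -- As off(v) = 0, the keys in the group of `v` are -off(z), so the smallest key plus the cost of
  -- `v` is the value of `v`.
  have hcore := H.core.insert_leader hn (k := D.s v + g.κC c)
    (fun z hz => by
      have h₁ := hmin z hz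
      rw [hcm z hz, hn.off_self] at h₁
      linarith)
    ⟨c, hmem, by rw [hcm c hmem, hn.off_self]; ring⟩
  have hV₃ : HeapFam D.n 1 (σ₂.setRealVar 2 (D.s v + g.κC c)) u g.SV g.κV g.αV :=
    hV₂.congr rfl rfl rfl rfl rfl rfl (fun _ _ _ => rfl) fun _ _ _ => rfl
  refine (ensures_insertHeap hV₃ hl H₁.env.u_pos (by norm_num) (by norm_num)
    (v := v) (w := v) hE₂.v_eq hE₂.v_eq hn.mem_V hvV
    (by simpa using hE₂.u_eq)).mono ?_
  rintro t₄ σ₄ ⟨ht₄, hV₄, hf₄⟩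
  rw [Store.realVar_setRealVar, Function.update_self] at hV₄
  have hC₄ : HeapFam D.n 2 σ₄ u g.SC g.κC g.αC := HeapFam.frame (HeapFam.congr hC₂
    (τ := σ₂.setRealVar 2 (D.s v + g.κC c)) rfl rfl rfl rfl rfl rfl (fun _ _ _ => rfl)
    fun _ _ _ => rfl) hf₄ (by norm_num)
  have hR₄ := HeapFam.frame (HeapFam.congr hR₂
    (τ := σ₂.setRealVar 2 (D.s v + g.κC c)) rfl rfl rfl rfl rfl rfl (fun _ _ _ => rfl)
    fun _ _ _ => rfl) hf₄ (by norm_num)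
  have hE₃ : Env D ord u k v (σ₂.setRealVar 2 (D.s v + g.κC c)) := by
    obtain ⟨e₁, e₂, e₃, e₄, e₅, e₆, e₇, e₈, e₉, e₁₀, e₁₁, e₁₂, e₁₃⟩ := hE₂
    exact ⟨e₁, e₂, e₃, by simpa using e₄, by simpa using e₅, by simpa using e₆, e₇, e₈, e₉, e₁₀,
      e₁₁, e₁₂, e₁₃⟩
  have hreal : ∀ a < 20, σ₄.realArr a = σ.realArr a := fun a ha =>
    (hf₄.realArr_lt ha).trans (hreal₂ a ha)
  have hnat : ∀ a < 20, σ₄.natArr a = σ.natArr a := fun a ha =>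
    (hf₄.natArr_lt ha).trans (hnat₂ a ha)
  have hvar : σ₄.realVar 5 = σ.realVar 5 := by
    rw [hf₄.realVar, Store.realVar_setRealVar, Function.update_of_ne (by norm_num), hf₂.realVar]
    simp
  refine ⟨?_, ⟨update g.SR v (insert v (g.SR v)), update g.SV v (insert v (g.SV v)), g.SC, _, _, _,
    _, g.κC, g.αC⟩, ?_,
    ⟨hE₃.frame hf₄, hR₄, hV₄, hC₄, ?_, ?_, ?_, ?_⟩⟩
  · simp [NatExp.time, RealExp.time]
    omega
  · have h₁ := tot_insert (n := D.n) (S := g.SR) hvn (hvR v)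
    have h₂ := tot_insert (n := D.n) (S := g.SV) hvn (hvV v)
    simp only [Contents.pot]
    omega
  · rw [hreal 7 (by norm_num)]
    exact hcore
  · intro e
    rw [hnat 5 (by norm_num)]
    exact H.absorbed e
  · intro x hx
    rw [hreal 7 (by norm_num), hnat 6 (by norm_num)]
    exact H.good x hx
  · rw [hvar, hreal 7 (by norm_num)]
    exact H.total

/-- The best leader at `v`, when it has not been absorbed, and its best chain. -/
theorem State.best
    (H : State D ord u k v σ P (D.Act (insert v P)) D.Grp (D.OwnV P v) g)
    (hn : D.IsNext P v) (hd : σ.natArr (rootArr 1) v = d) :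
    d ≠ 0 ∧ d ∈ g.SV v ∧ d ∈ D.V ∧ (σ.natArr 5 d ≠ 1 → D.Act (insert v P) d ∧
      σ.natArr (rootArr 2) d ≠ 0 ∧ σ.natArr (rootArr 2) d ∈ g.SC d ∧
      D.Anc v (σ.natArr (rootArr 2) d) ∧ σ.natArr (rootArr 2) d ∈ D.V) := by
  have hroot := H.famV.heap v
  have hvV : v ∈ g.SV v := H.core.v_mem v hn.notMem v hn.act_insert (.inr ⟨rfl, rfl⟩)
    ⟨v, H.core.self_mem hn⟩
  rw [hd] at hroot
  have h0 : d ≠ 0 := fun e => by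
    rw [hroot.eq_zero_iff.1 e] at hvV
    simp at hvV
  have hdV := hroot.root_mem h0
  refine ⟨h0, hdV, H.famV.subset v hdV, fun h5 => ?_⟩
  have hA : D.Act (insert v P) d := by
    by_contra hA
    rcases H.core.v_sub v d hdV with h | h | h
    · exact h5 ((H.absorbed d).2 ⟨h, hA⟩)
    · exact h5 ((H.absorbed d).2 ⟨h.1, hA⟩)
    · exact hA (h.2 ▸ hn.act_insert)
  obtain ⟨hO, _, z, hz, _⟩ := H.core.v_key v d hdV hA
  have hrootC := H.famC.heap d
  have hc0 : σ.natArr (rootArr 2) d ≠ 0 := fun e => by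
    rw [hrootC.eq_zero_iff.1 e] at hz
    simp at hz
  have hcm := hrootC.root_mem hc0
  have hG := (H.core.c_mem d hA _ hcm).1
  refine ⟨hA, hc0, hcm, ?_, hG.1⟩
  rcases hO with hO | ⟨_, rfl⟩
  · exact (hn.own_iff.1 hO).2.trans hG.2.1
  · exact hG.2.1

/-- One end and the leader are removed, and the leader is inserted again unless its group is
exhausted; in all at least one node is lost. -/
theorem ensures_dropChain
    (H : State D ord u k v σ P (D.Act (insert v P)) D.Grp (D.OwnV P v) g)
    (hn : D.IsNext P v) (hl : D.n < 2 ^ l) (hd : σ.natArr (rootArr 1) v = d)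
    (hd3 : σ.natVar 3 = d) (h5 : σ.natArr 5 d ≠ 1)
    (hw : D.w₀ < D.pw (σ.natArr (rootArr 2) d) - D.pw v + D.w v) :
    Ensures dropChain σ fun t τ => t ≤ 480 * l + 400 ∧ ∃ g' : Contents,
      g'.pot D.n + 1 ≤ g.pot D.n ∧
      State D ord u k v τ P (D.Act (insert v P)) D.Grp (D.OwnV P v) g' := by
  have hvn : v ≤ D.n := (Finset.mem_Icc.1 hn.mem_V).2
  obtain ⟨hd0, hdV, hdn, hbest⟩ := H.best hn hd
  obtain ⟨hA, hc0, hcm, hvc, hcV⟩ := hbest h5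
  have hdn' : d ≤ D.n := (Finset.mem_Icc.1 hdn).2
  have hrootV := H.famV.heap v
  rw [hd] at hrootV
  have hrootC := H.famC.heap d
  have hkV := hrootV.key_root hd0
  have hkC := hrootC.key_root hc0
  have hcmin := fun z (hz : z ∈ g.SC d) => hrootC.root_le hz
  obtain ⟨c, hc⟩ : ∃ c, σ.natArr (rootArr 2) d = c := ⟨_, rfl⟩
  rw [hc] at hc0 hcm hvc hcV hw hkC hcmin
  obtain ⟨hO, hk, z, hz, hkz⟩ := H.core.v_key v d hdV hA
  have hcz := fun z (hz : z ∈ g.SC d) => (H.core.c_mem d hA z hz).2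
  have hbase : g.κV d - g.κC c = D.s d - D.off (σ.realArr 7) P d := by
    have h₁ := hk c hcm
    have h₂ := hcmin z hz
    rw [hcz z hz, hcz c hcm] at h₂
    rw [hcz c hcm]
    linarith
  -- An unprocessed ancestor `q` of `c` is an ancestor of `v`, and the chain from `q` to `c` is at
  -- least as heavy as that from `v`.
  have hdead : ∀ q ∈ D.V, q ∉ P → D.Anc q c → D.w₀ < D.pw c - D.pw q + D.w q := by
    intro q hq hqP hqc
    have h₁ := (hn.anc_of_notMem hq hqP hqc hvc).pw_le
    have h₂ := TreeData.pw_par hq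
    have h₃ := TreeData.pw_par hn.mem_V
    linarith
  have hdis : ∀ q, q ≠ v → d ∉ g.SV q := fun q hq h =>
    Finset.disjoint_left.1 (H.famV.disjoint q v hq) h hdV
  simp only [dropChain, ensures_seq, ensures_setRealVar, RealExp.eval, NatExp.eval,
    Store.realVar_setRealVar, hd3, hc, hkV, hkC, sub_zero, hbase]
  rw [Function.update_of_ne (by norm_num), H.env.zero_eq]
  have H₁ := ((H.setRealVar (i := 2) (r := D.s d - D.off (σ.realArr 7) P d) (by norm_num)
    (by norm_num)).setRealVar (i := 3) (r := 0) (by norm_num) (by norm_num))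
  generalize hσ₁ : (σ.setRealVar 2 (D.s d - D.off (σ.realArr 7) P d)).setRealVar 3 0 = σ₁ at H₁
  have hv2 : σ₁.realVar 2 = D.s d - D.off (σ.realArr 7) P d := by rw [← hσ₁]; simp
  have hv5 : σ₁.realVar 5 = σ.realVar 5 := by rw [← hσ₁]; simp
  have hd₁ : σ₁.natVar 3 = d := by rw [← hσ₁]; exact hd3
  have hnat₁ : σ₁.natArr = σ.natArr := by rw [← hσ₁]; rfl
  have hreal₁ : σ₁.realArr = σ.realArr := by rw [← hσ₁]; rfl
  refine (ensures_popHeap H₁.famV hl H₁.env.u_pos (by norm_num) H₁.env.v_eq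
    (by rw [hnat₁, hd]; exact hd0)).mono ?_
  rintro t₂ σ₂ ⟨ht₂, hV₂, hf₂⟩
  rw [hnat₁, hd] at hV₂
  have hd₂ : σ₂.natVar 3 = d := (hf₂.natVar 3 (by norm_num)).trans hd₁
  have hE₂ := H₁.env.frame hf₂
  have hC₂ := H₁.famC.frame hf₂ (by norm_num)
  have hr₂ : σ₂.natArr (rootArr 2) d = c := by
    rw [hf₂.natArr _ (by norm_num) (by norm_num) (by norm_num), hnat₁, hc]
  refine (ensures_popHeap hC₂ hl hE₂.u_pos (by norm_num) hd₂ (by rw [hr₂]; exact hc0)).mono ?_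
  rintro t₃ σ₃ ⟨ht₃, hC₃, hf₃⟩
  rw [hr₂] at hC₃
  have hd₃ : σ₃.natVar 3 = d := (hf₃.natVar 3 (by norm_num)).trans hd₂
  have hE₃ := hE₂.frame hf₃
  have hV₃ := hV₂.frame hf₃ (by norm_num)
  have hR₃ := (H₁.famR.frame hf₂ (by norm_num)).frame hf₃ (by norm_num)
  have hreal₃ : ∀ a < 20, σ₃.realArr a = σ.realArr a := fun a ha => by
    rw [hf₃.realArr_lt ha, hf₂.realArr_lt ha, hreal₁]
  have hnat₃ : ∀ a < 20, σ₃.natArr a = σ.natArr a := fun a ha => by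
    rw [hf₃.natArr_lt ha, hf₂.natArr_lt ha, hnat₁]
  have hvar₃ : σ₃.realVar = σ₁.realVar := hf₃.realVar.trans hf₂.realVar
  have hroot₃ := hC₃.heap d
  rw [Function.update_self] at hroot₃
  have hpC := tot_erase (n := D.n) (S := g.SC) hdn' hcm
  have hpV := tot_erase (n := D.n) (S := g.SV) hvn hdV
  simp only [ensures_ite, ensures_skip, ensures_seq, ensures_setRealVar, RealExp.eval,
    NatExp.eval, Test.Holds, hd₃]
  refine ⟨fun he => ?_, fun he => ?_⟩
  · have hemp := hroot₃.eq_zero_iff.1 he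
    refine ⟨?_, ⟨g.SR, update g.SV v ((g.SV v).erase d), update g.SC d ((g.SC d).erase c), g.κR,
      g.αR, g.κV, g.αV, g.κC, g.αC⟩, ?_, hE₃, hR₃, hV₃, hC₃, ?_, ?_, ?_, ?_⟩
    · simp [NatExp.time, RealExp.time, Test.time]
      omega
    · simp only [Contents.pot]
      omega
    · rw [hreal₃ 7 (by norm_num)]
      refine H.core.drop_chain (v := v) hA hdV hn.notMem hdis ?_ (fun _ _ => rfl) ?_ ?_ hdead
      · intro q e he
        by_cases hq : q = v
        · subst hq
          simp [he]
        · simp [hq]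
      · intro q hq
        by_cases hqv : q = v
        · subst hqv
          simp at hq
        · dsimp only at hq
          rw [Function.update_of_ne hqv] at hq
          exact absurd hq (hdis q hqv)
      · intro h
        rw [hemp] at h
        simp at h
    · intro e
      rw [hnat₃ 5 (by norm_num)]
      exact H.absorbed e
    · intro x hx
      rw [hreal₃ 7 (by norm_num), hnat₃ 6 (by norm_num)]
      exact H.good x hx
    · rw [hvar₃, hv5, hreal₃ 7 (by norm_num)]
      exact H.total
  · have hk₃ := hroot₃.key_root he
    have hmem₃ := hroot₃.root_mem he
    have hmin₃ := fun z (hz : z ∈ (g.SC d).erase c) => hroot₃.root_le hz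
    rw [hk₃, sub_zero, hvar₃, hv2]
    generalize σ₃.natArr (rootArr 2) d = c' at hmem₃ hmin₃
    have hkey : D.s d - D.off (σ.realArr 7) P d + g.κC c' = D.s d - D.off (σ.realArr 7) P c' := by
      rw [hcz c' (Finset.mem_of_mem_erase hmem₃)]
      ring
    rw [hkey]
    generalize hy : D.s d - D.off (σ.realArr 7) P c' = y
    have hfam : ∀ {k S κ α}, HeapFam D.n k σ₃ u S κ α →
        HeapFam D.n k (σ₃.setRealVar 2 y) u S κ α := fun h =>
      h.congr rfl rfl rfl rfl rfl rfl (fun _ _ _ => rfl) fun _ _ _ => rfl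
    have hE₄ : Env D ord u k v (σ₃.setRealVar 2 y) := by
      obtain ⟨e₁, e₂, e₃, e₄, e₅, e₆, e₇, e₈, e₉, e₁₀, e₁₁, e₁₂, e₁₃⟩ := hE₃
      exact ⟨e₁, e₂, e₃, by simpa using e₄, by simpa using e₅, by simpa using e₆, e₇, e₈, e₉, e₁₀,
        e₁₁, e₁₂, e₁₃⟩
    have hdn₄ : ∀ q, d ∉ update g.SV v ((g.SV v).erase d) q := by
      intro q
      by_cases hqv : q = v
      · subst hqv
        simp
      · rw [Function.update_of_ne hqv]
        exact hdis q hqv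
    refine (ensures_insertHeap (hfam hV₃) hl hE₄.u_pos (by norm_num) (by norm_num) hE₄.v_eq
      (w := d) hd₃ hdn hdn₄ hE₄.u_eq).mono ?_
    rintro t₅ σ₅ ⟨ht₅, hV₅, hf₅⟩
    -- The leader was taken out and put back, so the node sets of the value heaps are the old ones
    -- and only its key has changed.
    rw [Store.realVar_setRealVar, Function.update_self, Function.update_self,
      Finset.insert_erase hdV, Function.update_idem, Function.update_eq_self] at hV₅
    have hreal₅ : ∀ a < 20, σ₅.realArr a = σ.realArr a := fun a ha => by
      rw [hf₅.realArr_lt ha, Store.realArr_setRealVar, hreal₃ a ha]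
    have hnat₅ : ∀ a < 20, σ₅.natArr a = σ.natArr a := fun a ha => by
      rw [hf₅.natArr_lt ha, Store.natArr_setRealVar, hnat₃ a ha]
    refine ⟨?_, ⟨g.SR, g.SV, update g.SC d ((g.SC d).erase c), g.κR,
      g.αR, update g.κV d y, _, g.κC, g.αC⟩, ?_, hE₄.frame hf₅, (hfam hR₃).frame hf₅ (by norm_num),
      hV₅, (hfam hC₃).frame hf₅ (by norm_num), ?_, ?_, ?_, ?_⟩
    · simp [NatExp.time, RealExp.time, Test.time]
      omega
    · simp only [Contents.pot]
      omega
    · rw [hreal₅ 7 (by norm_num)]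
      refine H.core.drop_chain (v := v) hA hdV hn.notMem hdis (fun _ _ _ => Iff.rfl)
        (fun e he => Function.update_of_ne he _ _) ?_ (fun _ => hdV) hdead
      intro q hq
      have hqv : q = v := by
        by_contra hqv
        exact hdis q hqv hq
      dsimp only
      rw [Function.update_self]
      refine ⟨hqv, ⟨c', hmem₃⟩, fun z hz => ?_, c', hmem₃, hy.symm⟩
      have := hmin₃ z hz
      rw [hcz z (Finset.mem_of_mem_erase hz), hcz c' (Finset.mem_of_mem_erase hmem₃)] at this
      linarith
    · intro e
      rw [hnat₅ 5 (by norm_num)]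
      exact H.absorbed e
    · intro x hx
      rw [hreal₅ 7 (by norm_num), hnat₅ 6 (by norm_num)]
      exact H.good x hx
    · rw [hf₅.realVar, Store.realVar_setRealVar, Function.update_of_ne (by norm_num), hvar₃, hv5,
        hreal₅ 7 (by norm_num)]
      exact H.total

/-- Looking at the best chain is enough: it is the minimum over a set that contains all feasible
chains from `v`, so once it is feasible it is the best feasible one. -/
theorem ensures_prune
    (H : State D ord u k v σ P (D.Act (insert v P)) D.Grp (D.OwnV P v) g)
    (hn : D.IsNext P v) (hl : D.n < 2 ^ l) :
    Ensures (.while pruneTest pruneStep) σ fun t τ => ¬ pruneTest.Holds τ ∧ ∃ g' : Contents,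
      t + (1000 * l + 1000) * g'.pot D.n ≤ (1000 * l + 1000) * g.pot D.n + 30 ∧
      State D ord u k v τ P (D.Act (insert v P)) D.Grp (D.OwnV P v) g' := by
  have hvn : v ≤ D.n := (Finset.mem_Icc.1 hn.mem_V).2
  refine (ensures_while_of_potential (b := pruneTest) (p := pruneStep)
    (Inv := fun m σ => ∃ g : Contents, m = (1000 * l + 1000) * g.pot D.n ∧
      State D ord u k v σ P (D.Act (insert v P)) D.Grp (D.OwnV P v) g) ?_
    (m := (1000 * l + 1000) * g.pot D.n) (σ := σ) ⟨g, rfl, H⟩).mono ?_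
  · clear! σ g
    rintro m σ ⟨g, rfl, H⟩ hb
    have hb' : σ.natArr 5 (σ.natArr (rootArr 1) v) = 1 ∨
        ¬ σ.realArr 6 (σ.natArr (rootArr 2) (σ.natArr (rootArr 1) v)) - D.pw v + D.w v
          ≤ D.w₀ := by
      simpa only [pruneTest, Test.Holds, NatExp.eval, RealExp.eval, H.env.v_eq,
        H.env.pw_eq v hn.mem_V, H.env.w_eq v hn.mem_V, H.env.w₀_eq] using hb
    clear hb
    obtain ⟨d, hd⟩ : ∃ d, σ.natArr (rootArr 1) v = d := ⟨_, rfl⟩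
    rw [hd] at hb'
    obtain ⟨hd0, hdV, hdn, hbest⟩ := H.best hn hd
    simp only [pruneStep, ensures_seq, ensures_setNatVar, ensures_ite, NatExp.eval, Test.Holds,
      H.env.v_eq, hd, Store.natVar_setNatVar, Function.update_self, Store.natArr_setNatVar]
    have H₁ := H.setNatVar (i := 3) (j := d) (by norm_num)
    have hmul : ∀ p p' : ℕ, p' + 1 ≤ p → (1000 * l + 1000) * p' + (1000 * l + 1000) ≤
        (1000 * l + 1000) * p := fun p p' h => by
      calc (1000 * l + 1000) * p' + (1000 * l + 1000) = (1000 * l + 1000) * (p' + 1) := by ring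
        _ ≤ _ := Nat.mul_le_mul_left _ h
    refine ⟨fun h5 => ?_, fun h5 => ?_⟩
    · refine (ensures_popHeap H₁.famV hl H₁.env.u_pos (by norm_num) H₁.env.v_eq
        (by rw [Store.natArr_setNatVar, hd]; exact hd0)).mono ?_
      rintro t₂ σ₂ ⟨ht₂, hV₂, hf₂⟩
      rw [Store.natArr_setNatVar, hd] at hV₂
      refine ⟨_, ⟨⟨g.SR, update g.SV v ((g.SV v).erase d), g.SC, g.κR, g.αR, g.κV, g.αV, g.κC,
        g.αC⟩, rfl, H₁.of_frame hf₂ (H₁.famR.frame hf₂ (by norm_num)) hV₂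
        (H₁.famC.frame hf₂ (by norm_num)) (H₁.core.drop_stale ((H.absorbed d).1 h5).2)
        fun _ _ => Iff.rfl⟩, ?_⟩
      have hp := tot_erase (n := D.n) (S := g.SV) hvn hdV
      have := hmul (g.pot D.n)
        (tot D.n g.SR + tot D.n (update g.SV v ((g.SV v).erase d)) + tot D.n g.SC)
        (by simp only [Contents.pot]; omega)
      simp only [Contents.pot] at this ⊢
      simp [NatExp.time, RealExp.time, Test.time, pruneTest]
      omega
    · have hw := hb'.resolve_left h5
      obtain ⟨_, _, _, _, hcV⟩ := hbest h5
      rw [H.env.pw_eq _ hcV, not_le] at hw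
      refine (ensures_dropChain H₁ hn hl (by simpa using hd) (by simp) (by simpa using h5)
        (by simpa using hw)).mono ?_
      rintro t τ ⟨ht, g', hp, H'⟩
      refine ⟨_, ⟨g', rfl, H'⟩, ?_⟩
      have := hmul _ _ hp
      simp [NatExp.time, RealExp.time, Test.time, pruneTest]
      omega
  · rintro t τ ⟨m, ⟨g', rfl, H'⟩, hb, ht⟩
    refine ⟨hb, g', ?_, H'⟩
    simp [NatExp.time, RealExp.time, Test.time, pruneTest] at ht
    omega

/-- The property at `x` involves only the values of descendants of `x`, so values fixed later do not
affect it. -/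
theorem TreeData.Good.congr {h h' : ℕ → ℝ} {b x : ℕ} (H : D.Good h b x)
    (hh : ∀ y ∈ D.V, D.Anc x y → h' y = h y) : D.Good h' b x := by
  have hsum : ∀ u, ∑ y ∈ D.path x u, h' y = ∑ y ∈ D.path x u, h y := fun u =>
    Finset.sum_congr rfl fun y hy => hh y (TreeData.mem_path.1 hy).1 (TreeData.mem_path.1 hy).2.1
  refine ⟨H.mem, H.anc, H.le, ?_, ?_⟩
  · simpa only [hsum] using H.eq
  · simpa only [hsum] using H.sum_le

theorem ensures_finishVertex
    (H : State D ord u k v σ P (D.Act (insert v P)) D.Grp (D.OwnV P v) g)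
    (hn : D.IsNext P v) (hl : D.n < 2 ^ l) (hb : ¬ pruneTest.Holds σ) :
    Ensures finishVertex σ fun t τ => t ≤ 320 * l + 500 ∧ ∃ g' : Contents,
      g'.pot D.n = g.pot D.n ∧ State D ord u k v τ (insert v P) (D.Act (insert v P)) D.Grp
        (D.Own (insert v P)) g' := by
  have hvn : v ≤ D.n := (Finset.mem_Icc.1 hn.mem_V).2
  have hpv : D.par v ≠ v := TreeData.par_ne hn.mem_V
  have hb' : ¬ (σ.natArr 5 (σ.natArr (rootArr 1) v) = 1 ∨
      ¬ σ.realArr 6 (σ.natArr (rootArr 2) (σ.natArr (rootArr 1) v)) - D.pw v + D.w v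
        ≤ D.w₀) := by
    simpa only [pruneTest, Test.Holds, NatExp.eval, RealExp.eval, H.env.v_eq,
      H.env.pw_eq v hn.mem_V, H.env.w_eq v hn.mem_V, H.env.w₀_eq] using hb
  obtain ⟨d, hd⟩ : ∃ d, σ.natArr (rootArr 1) v = d := ⟨_, rfl⟩
  rw [hd, not_or, not_not] at hb'
  obtain ⟨hd0, hdV, hdn, hbest⟩ := H.best hn hd
  obtain ⟨hA, hc0, hcm, hvc, hcV⟩ := hbest hb'.1
  have hrootV := H.famV.heap v
  rw [hd] at hrootV
  have hrootC := H.famC.heap d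
  have hcmin := fun z (hz : z ∈ g.SC d) => hrootC.root_le hz
  have hdmin := fun z (hz : z ∈ g.SV v) => hrootV.root_le hz
  have hy : σ.realArr (keyDiff 1) d = g.κV d := (hrootV.key_root hd0).trans (sub_zero _)
  have hw := hb'.2
  rw [H.env.pw_eq _ hcV] at hw
  have hgood := H.core.good hn hdV hA hdmin hcm hcmin hw
  obtain ⟨c, hc⟩ : ∃ c, σ.natArr (rootArr 2) d = c := ⟨_, rfl⟩
  obtain ⟨y, hye⟩ : ∃ y, g.κV d = y := ⟨_, rfl⟩
  rw [hc, hye] at hgood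
  rw [hye] at hy
  simp only [finishVertex, ensures_seq, ensures_setNatVar, ensures_setNatArr, ensures_setRealVar,
    ensures_setRealArr, NatExp.eval, RealExp.eval, H.env.v_eq, hd, hy, hc,
    Store.natVar_setRealVar, Store.natArr_setRealVar, Store.natVar_setNatArr,
    Store.natVar_setRealArr, Store.realVar_setRealVar, Store.realVar_setNatArr,
    Store.realVar_setRealArr, Store.realVar_setNatVar, Store.natArr_setNatArr,
    Store.natArr_setRealArr, Function.update_self]
  generalize hσ₁ : Store.setRealVar _ 3 _ = σ₁
  have hnat₁ : σ₁.natArr = update σ.natArr 6 (update (σ.natArr 6) v c) := by rw [← hσ₁]; simp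
  have hreal₁ : σ₁.realArr = update σ.realArr 7 (update (σ.realArr 7) v y) := by
    rw [← hσ₁]; simp
  have hvar2 : σ₁.realVar 2 = 0 := by rw [← hσ₁]; simp [H.env.zero_eq]
  have hvar3 : σ₁.realVar 3 = -y := by rw [← hσ₁]; simp [H.env.zero_eq]
  have hvar5 : σ₁.realVar 5 = σ.realVar 5 + y := by rw [← hσ₁]; simp
  have hn5 : σ₁.natVar 5 = D.par v := by rw [← hσ₁]; simp [H.env.par_eq]
  have hfam₁ : ∀ {k S κ α}, HeapFam D.n k σ u S κ α → HeapFam D.n k σ₁ u S κ α := by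
    intro k S κ α h
    refine h.congr ?_ ?_ ?_ ?_ ?_ ?_ (fun _ _ _ => rfl) fun _ _ _ => rfl
    all_goals
      first
        | rw [hnat₁]
        | rw [hreal₁]
      refine Function.update_of_ne ?_ _ _
      simp only [left, right, rootArr, keyDiff, payDiff, sizeArr]
      omega
  have hE₁ : Env D ord u k v σ₁ := by
    obtain ⟨e₁, e₂, e₃, e₄, e₅, e₆, e₇, e₈, e₉, e₁₀, e₁₁, e₁₂, e₁₃⟩ := H.env
    refine ⟨?_, ?_, ?_, ?_, ?_, ?_, ?_, ?_, ?_, ?_, ?_, ?_, e₁₃⟩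
    · rw [← hσ₁]; simpa using e₁
    · rw [← hσ₁]; simpa using e₂
    · rw [← hσ₁]; simpa using e₃
    · rw [← hσ₁]; simpa using e₄
    · rw [← hσ₁]; simpa using e₅
    · rw [← hσ₁]; simpa using e₆
    · rw [hnat₁]; simpa using e₇
    · rw [hnat₁]; simpa using e₈
    · rw [hreal₁]; simpa using e₉
    · rw [hreal₁]; simpa using e₁₀
    · rw [hreal₁]; simpa using e₁₁
    · rw [hreal₁]; simpa using e₁₂
  clear hσ₁
  refine (ensures_addHeap (hfam₁ H.famR) hE₁.v_eq).mono ?_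
  rintro t₂ σ₂ ⟨ht₂, hR₂, hf₂, -⟩
  have hE₂ := hE₁.frame hf₂
  rw [hvar2, hvar3] at hR₂
  generalize hσ₃ : Store.setRealVar _ 3 _ = σ₃
  have hfam₃ : ∀ {k S κ α}, HeapFam D.n k σ₂ u S κ α → HeapFam D.n k σ₃ u S κ α := fun h => by
    rw [← hσ₃]
    exact h.congr rfl rfl rfl rfl rfl rfl (fun _ _ _ => rfl) fun _ _ _ => rfl
  have hE₃ : Env D ord u k v σ₃ := by
    rw [← hσ₃]
    obtain ⟨e₁, e₂, e₃, e₄, e₅, e₆, e₇, e₈, e₉, e₁₀, e₁₁, e₁₂, e₁₃⟩ := hE₂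
    exact ⟨e₁, e₂, e₃, by simpa using e₄, by simpa using e₅, by simpa using e₆, e₇, e₈, e₉, e₁₀,
      e₁₁, e₁₂, e₁₃⟩
  have hvar2 : σ₃.realVar 2 = -y := by rw [← hσ₃, ← hvar3, ← hf₂.realVar]; simp
  have hvar5 : σ₃.realVar 5 = σ.realVar 5 + y := by rw [← hσ₃, ← hvar5, ← hf₂.realVar]; simp
  have hnat₃ : ∀ a < 20, σ₃.natArr a = update σ.natArr 6 (update (σ.natArr 6) v c) a := by
    intro a ha
    rw [← hσ₃, ← hnat₁, ← hf₂.natArr_lt ha]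
    rfl
  have hreal₃ : ∀ a < 20, σ₃.realArr a = update σ.realArr 7 (update (σ.realArr 7) v y) a := by
    intro a ha
    rw [← hσ₃, ← hreal₁, ← hf₂.realArr_lt ha]
    rfl
  have hn5 : σ₃.natVar 5 = D.par v := by
    rw [← hσ₃, ← hn5, ← hf₂.natVar 5 (by norm_num)]
    rfl
  have hR₃ := hfam₃ hR₂
  have hV₃ := hfam₃ ((hfam₁ H.famV).frame hf₂ (by norm_num))
  have hC₃ := hfam₃ ((hfam₁ H.famC).frame hf₂ (by norm_num))
  clear hσ₃
  refine (ensures_addHeap hV₃ hE₃.v_eq).mono ?_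
  rintro t₄ σ₄ ⟨ht₄, hV₄, hf₄, -⟩
  rw [hvar2] at hV₄
  have hE₄ := hE₃.frame hf₄
  refine (ensures_meldInto (hR₃.frame hf₄ (by norm_num)) hl hE₄.u_pos (by norm_num) (by norm_num)
    ((hf₄.natVar 5 (by norm_num)).trans hn5) hE₄.v_eq hpv).mono ?_
  rintro t₅ σ₅ ⟨ht₅, hR₅, hf₅⟩
  have hE₅ := hE₄.frame hf₅
  refine (ensures_meldInto (hV₄.frame hf₅ (by norm_num)) hl hE₅.u_pos (by norm_num) (by norm_num)
    ((hf₅.natVar 5 (by norm_num)).trans ((hf₄.natVar 5 (by norm_num)).trans hn5)) hE₅.v_eq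
    hpv).mono ?_
  rintro t₆ σ₆ ⟨ht₆, hV₆, hf₆⟩
  have h7 : σ₆.realArr 7 = update (σ.realArr 7) v y := by
    rw [hf₆.realArr_lt (by norm_num), hf₅.realArr_lt (by norm_num), hf₄.realArr_lt (by norm_num),
      hreal₃ 7 (by norm_num), Function.update_self]
  have hnat : ∀ a < 20, σ₆.natArr a = update σ.natArr 6 (update (σ.natArr 6) v c) a := by
    intro a ha
    rw [hf₆.natArr_lt ha, hf₅.natArr_lt ha, hf₄.natArr_lt ha, hnat₃ a ha]
  have hne : ∀ {x}, x ∈ P → x ≠ v := fun hx e => hn.notMem (e ▸ hx)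
  -- Disjointness turns the condition that a node lies in the heap at `v` into the condition on the
  -- index used by `Core.finish`.
  have hcase : ∀ {S : ℕ → Finset ℕ}, (∀ p q, p ≠ q → Disjoint (S p) (S q)) → ∀ q, ∀ z ∈ S q,
      (z ∈ S v ↔ q = v) := by
    intro S hS q z hz
    refine ⟨fun h => ?_, fun h => h ▸ hz⟩
    by_contra hq
    exact Finset.disjoint_left.1 (hS q v hq) hz h
  refine ⟨?_, ⟨update (update g.SR v ∅) (D.par v) (g.SR (D.par v) ∪ g.SR v),
    update (update g.SV v ∅) (D.par v) (g.SV (D.par v) ∪ g.SV v), g.SC,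
    fun z => if z ∈ g.SR v then g.κR z + 0 else g.κR z,
    fun z => if z ∈ g.SR v then g.αR z + -y else g.αR z,
    fun z => if z ∈ g.SV v then g.κV z + -y else g.κV z,
    fun z => if z ∈ g.SV v then g.αV z + σ₃.realVar 3 else g.αV z, g.κC, g.αC⟩, ?_, hE₅.frame hf₆,
    hR₅.frame hf₆ (by norm_num), hV₆,
    ((hC₃.frame hf₄ (by norm_num)).frame hf₅ (by norm_num)).frame hf₆ (by norm_num), ?_, ?_, ?_, ?_⟩
  · simp [NatExp.time, RealExp.time, Test.time]
    omega
  · simp only [Contents.pot]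
    rw [tot_meld (D.par_le v) hvn hpv (H.famR.disjoint _ _ hpv),
      tot_meld (D.par_le v) hvn hpv (H.famV.disjoint _ _ hpv)]
  · rw [h7]
    refine H.core.finish hn y (fun z => ?_) (fun q z hz => ?_) (fun q z hz => ?_)
    · simp
    · simp only [hcase H.famR.disjoint q z hz, sub_eq_add_neg]
    · simp only [hcase H.famV.disjoint q z hz, sub_eq_add_neg]
  · intro e
    rw [hnat 5 (by norm_num), Function.update_of_ne (by norm_num), H.absorbed]
    by_cases hev : e = v
    · subst hev
      simp [hn.notMem, hn.act_insert]
    · simp [hev]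
  · intro x hx
    rw [h7, hnat 6 (by norm_num), Function.update_self]
    rcases Finset.mem_insert.1 hx with rfl | hx
    · rw [Function.update_self]
      exact hgood
    · rw [Function.update_of_ne (hne hx)]
      refine (H.good x hx).congr fun z hz hxz => ?_
      rw [Function.update_of_ne (hne (hn.mem x hx z hz hxz))]
  · rw [hf₆.realVar, hf₅.realVar, hf₄.realVar, hvar5, h7, Finset.sum_insert hn.notMem,
      Function.update_self, H.total, add_comm]
    congr 1
    exact Finset.sum_congr rfl fun x hx => by rw [Function.update_of_ne (hne hx)]

/-- Of the five units three pay for the nodes inserted, one by `startGroup` and two by `addLeader`;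
the others more than cover the phases without loops and the final tests. -/
theorem ensures_processVertex
    (H : State D ord u k v σ P (D.Act P) D.Grp (D.Own P) g)
    (hn : D.IsNext P v) (hl : D.n < 2 ^ l) :
    Ensures processVertex σ fun t τ => ∃ g' : Contents,
      t + (1000 * l + 1000) * g'.pot D.n ≤ (1000 * l + 1000) * (g.pot D.n + 5) ∧
      State D ord u k v τ (insert v P) (D.Act (insert v P)) D.Grp (D.Own (insert v P)) g' := by
  have hmul : ∀ {a b : ℕ}, a ≤ b → (1000 * l + 1000) * a ≤ (1000 * l + 1000) * b := fun h =>
    Nat.mul_le_mul_left _ h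
  simp only [processVertex, ensures_seq]
  refine (ensures_startGroup H hn hl).mono fun t₁ σ₁ ⟨ht₁, g₁, hg₁, H₁⟩ => ?_
  refine (ensures_absorb H₁ hn hl).mono fun t₂ σ₂ ⟨g₂, ht₂, H₂⟩ => ?_
  refine (ensures_addLeader H₂ hn hl).mono fun t₃ σ₃ ⟨ht₃, g₃, hg₃, H₃⟩ => ?_
  refine (ensures_prune H₃ hn hl).mono fun t₄ σ₄ ⟨hb, g₄, ht₄, H₄⟩ => ?_
  refine (ensures_finishVertex H₄ hn hl hb).mono fun t₅ σ₅ ⟨ht₅, g₅, hg₅, H₅⟩ => ?_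
  refine ⟨g₅, ?_, H₅⟩
  have h₁ := hmul hg₁
  have h₃ := hmul hg₃
  rw [hg₅]
  simp only [mul_add (1000 * l + 1000)] at h₁ h₃ ⊢
  omega

/-! ### Processing all vertices -/

/-- Array `4` lists ancestors first; running through it backwards, every vertex comes after its
descendants. -/
def processAll : Program :=
  .while (.natLt (.const 0) (.var 1))
    (setNatVar 2 (.get 4 (.var 1));; processVertex;; setNatVar 1 (.pred (.var 1)))

namespace TreeData

variable (D) in
/-- `ord 1, …, ord n` are the vertices, ancestors first. -/
structure IsOrder (ord : ℕ → ℕ) : Prop where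
  mem : ∀ k ∈ Finset.Icc 1 D.n, ord k ∈ D.V
  inj : ∀ k ∈ Finset.Icc 1 D.n, ∀ j ∈ Finset.Icc 1 D.n, ord k = ord j → k = j
  le : ∀ k ∈ Finset.Icc 1 D.n, ∀ j ∈ Finset.Icc 1 D.n, D.Anc (ord k) (ord j) → k ≤ j

variable (D) in
/-- The vertices after the `k`-th one. -/
def after (ord : ℕ → ℕ) (k : ℕ) : Finset ℕ := (Finset.Icc (k + 1) D.n).image ord

theorem IsOrder.image_eq (h : D.IsOrder ord) : (Finset.Icc 1 D.n).image ord = D.V := by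
  refine Finset.eq_of_subset_of_card_le (Finset.image_subset_iff.2 h.mem) ?_
  rw [Finset.card_image_of_injOn fun a ha b hb => h.inj a ha b hb]

theorem IsOrder.exists_eq (h : D.IsOrder ord) (hv : v ∈ D.V) :
    ∃ k ∈ Finset.Icc 1 D.n, ord k = v := by
  rw [← h.image_eq] at hv
  exact Finset.mem_image.1 hv

theorem insert_after (hk : k ∈ Finset.Icc 1 D.n) :
    insert (ord k) (D.after ord k) = D.after ord (k - 1) := by
  rw [Finset.mem_Icc] at hk
  unfold after
  rw [← Finset.image_insert]
  congr 1
  ext j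
  simp only [Finset.mem_insert, Finset.mem_Icc]
  omega

theorem IsOrder.isNext (h : D.IsOrder ord) (hk : k ∈ Finset.Icc 1 D.n) :
    D.IsNext (D.after ord k) (ord k) := by
  have hk' := Finset.mem_Icc.1 hk
  have hmem : ∀ j ∈ Finset.Icc (k + 1) D.n, j ∈ Finset.Icc 1 D.n := fun j hj => by
    rw [Finset.mem_Icc] at hj ⊢
    omega
  refine ⟨⟨?_, ?_⟩, h.mem k hk, ?_, ?_⟩
  · exact Finset.image_subset_iff.2 fun j hj => h.mem j (hmem j hj)
  · intro v hv u hu hvu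
    obtain ⟨j, hj, rfl⟩ := Finset.mem_image.1 hv
    obtain ⟨i, hi, rfl⟩ := h.exists_eq hu
    have := h.le j (hmem j hj) i hi hvu
    refine Finset.mem_image_of_mem _ ?_
    rw [Finset.mem_Icc] at hi hj ⊢
    omega
  · intro hv
    obtain ⟨j, hj, e⟩ := Finset.mem_image.1 hv
    have := h.inj j (hmem j hj) k hk e
    rw [Finset.mem_Icc] at hj
    omega
  · intro u hu hku hne
    obtain ⟨i, hi, rfl⟩ := h.exists_eq hu
    have := h.le k hk i hi hku
    refine Finset.mem_image_of_mem _ ?_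
    have hik : i ≠ k := fun e => hne (e ▸ rfl)
    rw [Finset.mem_Icc] at hi ⊢
    omega

end TreeData

theorem State.setVertex (H : State D ord u k v σ P A G O g) :
    State D ord u k j (σ.setNatVar 2 j) P A G O g := by
  obtain ⟨⟨e₁, e₂, e₃, e₄, e₅, e₆, e₇, e₈, e₉, e₁₀, e₁₁, e₁₂, e₁₃⟩, h₁, h₂, h₃, h₄, h₅, h₆,
    h₇⟩ := H
  refine ⟨⟨?_, ?_, ?_, e₄, e₅, e₆, e₇, e₈, e₉, e₁₀, e₁₁, e₁₂, e₁₃⟩, ?_, ?_, ?_, h₄, h₅, h₆, h₇⟩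
  · simpa using e₁
  · simpa using e₂
  · simp
  · exact h₁.congr rfl rfl rfl rfl rfl rfl (fun _ _ _ => rfl) fun _ _ _ => rfl
  · exact h₂.congr rfl rfl rfl rfl rfl rfl (fun _ _ _ => rfl) fun _ _ _ => rfl
  · exact h₃.congr rfl rfl rfl rfl rfl rfl (fun _ _ _ => rfl) fun _ _ _ => rfl

theorem State.setCounter (H : State D ord u k v σ P A G O g) :
    State D ord u j v (σ.setNatVar 1 j) P A G O g := by
  obtain ⟨⟨e₁, e₂, e₃, e₄, e₅, e₆, e₇, e₈, e₉, e₁₀, e₁₁, e₁₂, e₁₃⟩, h₁, h₂, h₃, h₄, h₅, h₆,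
    h₇⟩ := H
  refine ⟨⟨?_, ?_, ?_, e₄, e₅, e₆, e₇, e₈, e₉, e₁₀, e₁₁, e₁₂, e₁₃⟩, ?_, ?_, ?_, h₄, h₅, h₆, h₇⟩
  · simpa using e₁
  · simp
  · simpa using e₃
  · exact h₁.congr rfl rfl rfl rfl rfl rfl (fun _ _ _ => rfl) fun _ _ _ => rfl
  · exact h₂.congr rfl rfl rfl rfl rfl rfl (fun _ _ _ => rfl) fun _ _ _ => rfl
  · exact h₃.congr rfl rfl rfl rfl rfl rfl (fun _ _ _ => rfl) fun _ _ _ => rfl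

/-- The state with no vertex processed. -/
theorem State.of_empty (hE : Env D ord u k v σ) (hroot : ∀ k q, σ.natArr (rootArr k) q = 0)
    (hsize : ∀ k, σ.realArr (sizeArr k) 0 = 0) (h5 : ∀ d, σ.natArr 5 d = 0)
    (ht : σ.realVar 5 = 0) :
    State D ord u k v σ ∅ (D.Act ∅) D.Grp (D.Own ∅)
      ⟨fun _ => ∅, fun _ => ∅, fun _ => ∅, 0, 0, 0, 0, 0, 0⟩ := by
  have hfam : ∀ k, HeapFam D.n k σ u (fun _ => ∅) 0 0 := fun k =>
    ⟨fun v => by rw [hroot]; exact .nil _ _, by simp, by simp, hsize k⟩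
  refine ⟨hE, hfam 0, hfam 1, hfam 2, ?_, by simp [h5], by simp, by simp [ht]⟩
  constructor <;> simp [TreeData.Own, TreeData.Act]

theorem ensures_processAll (hord : D.IsOrder ord) (hl : D.n < 2 ^ l)
    (H : State D ord u D.n v σ ∅ (D.Act ∅) D.Grp (D.Own ∅) g) :
    Ensures processAll σ fun t τ =>
      t ≤ (1000 * l + 1000) * (g.pot D.n + 6 * D.n) + 10 ∧ ∃ g' v',
      State D ord u 0 v' τ D.V (D.Act D.V) D.Grp (D.Own D.V) g' := by
  have hzero : D.after ord D.n = ∅ := by simp [TreeData.after]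
  have hall : D.after ord 0 = D.V := hord.image_eq
  refine (ensures_while_of_potential
    (Inv := fun m σ => ∃ k ≤ D.n, ∃ v g, m = (1000 * l + 1000) * (g.pot D.n + 6 * k) ∧
      State D ord u k v σ (D.after ord k) (D.Act (D.after ord k)) D.Grp (D.Own (D.after ord k)) g)
    ?_ ⟨D.n, le_rfl, v, g, rfl, by rwa [hzero]⟩).mono ?_
  · rintro m σ ⟨k, hkn, v, g, rfl, H⟩ hb
    have hk0 : 0 < k := by simpa [Test.Holds, NatExp.eval, H.env.k_eq] using hb
    have hk : k ∈ Finset.Icc 1 D.n := Finset.mem_Icc.2 ⟨hk0, hkn⟩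
    simp only [ensures_seq, ensures_setNatVar, NatExp.eval, H.env.k_eq, H.env.ord_eq]
    refine (ensures_processVertex H.setVertex (hord.isNext hk) hl).mono ?_
    rintro t τ ⟨g', ht, H'⟩
    rw [TreeData.insert_after hk] at H'
    rw [H'.env.k_eq]
    refine ⟨_, ⟨k - 1, by omega, _, g', rfl, H'.setCounter⟩, ?_⟩
    obtain ⟨k, rfl⟩ : ∃ k', k = k' + 1 := ⟨k - 1, by omega⟩
    simp [Test.time, NatExp.time]
    have e : (1000 * l + 1000) * (6 * (k + 1)) = (1000 * l + 1000) * (6 * k) + (6000 * l + 6000) := by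
      ring
    simp only [mul_add (1000 * l + 1000) (g.pot D.n), mul_add (1000 * l + 1000) (g'.pot D.n)]
      at ht ⊢
    omega
  · rintro t τ ⟨m, ⟨k, hkn, v, g', rfl, H'⟩, hb, ht⟩
    obtain rfl : k = 0 := by simpa [Test.Holds, NatExp.eval, H'.env.k_eq] using hb
    rw [hall] at H'
    refine ⟨?_, g', v, H'⟩
    simp [Test.time, NatExp.time] at ht
    omega

end ChainPartition

end

noncomputable section

namespace ChainPartition

open Program NatExp RealExp Test
open Function (update)

/-! ### Ordering the vertices -/

variable {n k v w d i j h l : ℕ} {D : TreeData} {σ₀ σ τ : Store}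

/-- Array `2` holds marks and array `3` a stack with pointer in variable `5`. The dummy `0` is
marked in advance, so the climb stops above the root at the latest. -/
def climb : Program :=
  .while (.natEq (.get 2 (.var 3)) (.const 0))
    (setNatVar 5 (.succ (.var 5));; setNatArr 3 (.var 5) (.var 3);; setNatVar 3 (.get 1 (.var 3)))

/-- The stack is emptied from its upper end in the tree, so a vertex is numbered after its parent,
whose weight from the root is then known. -/
def descend : Program :=
  .while (.natLt (.const 0) (.var 5))
    (setNatVar 3 (.get 3 (.var 5));;
    setNatVar 5 (.pred (.var 5));;
    setNatArr 2 (.var 3) (.const 1);;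
    setRealArr 6 (.var 3) (.add (.get 6 (.get 1 (.var 3))) (.get 0 (.pred (.var 3))));;
    setNatVar 4 (.succ (.var 4));;
    setNatArr 4 (.var 4) (.var 3))

def orderVertices : Program :=
  setNatArr 2 (.const 0) (.const 1);;
  setNatVar 1 (.const 0);;
  .while (.natLt (.var 1) (.var 0))
    (setNatVar 1 (.succ (.var 1));; setNatVar 3 (.var 1);; climb;; descend)

/-! ### Correctness and linear time of the ordering. -/

/-- The first `k` vertices in the order have been determined; `σ₀` is the initial store. -/
structure OrderState (D : TreeData) (σ₀ σ : Store) (k : ℕ) : Prop where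
  natVar : σ.natVar 0 = σ₀.natVar 0
  count : σ.natVar 4 = k
  natArr : ∀ a, a ≠ 2 → a ≠ 3 → a ≠ 4 → σ.natArr a = σ₀.natArr a
  realVar : σ.realVar = σ₀.realVar
  realArr : ∀ a, a ≠ 6 → σ.realArr a = σ₀.realArr a
  mem : ∀ j ∈ Finset.Icc 1 k, σ.natArr 4 j ∈ D.V
  inj : ∀ i ∈ Finset.Icc 1 k, ∀ j ∈ Finset.Icc 1 k, σ.natArr 4 i = σ.natArr 4 j → i = j
  par : ∀ j ∈ Finset.Icc 1 k, D.par (σ.natArr 4 j) = 0 ∨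
    ∃ i ∈ Finset.Icc 1 k, i < j ∧ σ.natArr 4 i = D.par (σ.natArr 4 j)
  visited : ∀ x, σ.natArr 2 x ≠ 0 ↔ x = 0 ∨ ∃ j ∈ Finset.Icc 1 k, σ.natArr 4 j = x
  pw : ∀ x, σ.natArr 2 x ≠ 0 → σ.realArr 6 x = D.pw x

theorem OrderState.congr (H : OrderState D σ₀ σ k) (h0 : τ.natVar 0 = σ.natVar 0)
    (h4 : τ.natVar 4 = σ.natVar 4) (hn : ∀ a ≠ 3, τ.natArr a = σ.natArr a)
    (hv : τ.realVar = σ.realVar) (hr : τ.realArr = σ.realArr) : OrderState D σ₀ τ k := by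
  have e2 := hn 2 (by norm_num)
  have e4 := hn 4 (by norm_num)
  obtain ⟨h₁, h₂, h₃, h₄, h₅, h₆, h₇, h₈, h₉, h₁₀⟩ := H
  refine ⟨h0.trans h₁, h4.trans h₂, fun a ha₂ ha₃ ha₄ => (hn a ha₃).trans (h₃ a ha₂ ha₃ ha₄),
    hv.trans h₄, fun a ha => ?_, ?_, ?_, ?_, ?_, ?_⟩
  · rw [hr, h₅ a ha]
  · rwa [e4]
  · rwa [e4]
  · rwa [e4]
  · rwa [e4, e2]
  · rwa [e2, hr]

theorem OrderState.card_le (H : OrderState D σ₀ σ k) : k ≤ D.n := by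
  have := Finset.card_le_card_of_injOn (s := Finset.Icc 1 k) (t := D.V) (σ.natArr 4) H.mem
    fun a ha b hb => H.inj a ha b hb
  simpa using this

/-- The listed vertices are distinct and exhaust the tree. Parents come earlier, so ancestors do, by
induction along the list. -/
theorem OrderState.isOrder (H : OrderState D σ₀ σ k) (hall : ∀ x ∈ D.V, σ.natArr 2 x ≠ 0) :
    k = D.n ∧ D.IsOrder (σ.natArr 4) := by
  have hk : k = D.n := by
    refine le_antisymm H.card_le ?_
    have hsub : D.V ⊆ (Finset.Icc 1 k).image (σ.natArr 4) := fun x hx => by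
      rcases (H.visited x).1 (hall x hx) with h | h
      · exact absurd h (TreeData.ne_zero_of_mem hx)
      · exact Finset.mem_image.2 h
    have := (Finset.card_le_card hsub).trans Finset.card_image_le
    simpa using this
  subst hk
  refine ⟨rfl, H.mem, H.inj, fun k hk j hj => ?_⟩
  induction j using Nat.strong_induction_on with
  | _ j ih =>
    intro hkj
    rcases TreeData.anc_iff.1 hkj with e | hA
    · exact (H.inj k hk j hj e).le
    · rcases H.par j hj with e | ⟨i, hi, hij, e⟩
      · rw [e] at hA
        exact absurd hA (TreeData.not_anc_zero (H.mem k hk))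
      · rw [← e] at hA
        exact (ih i hij hi hA).trans hij.le

theorem TreeData.iterate_par_ne {x m : ℕ} (hx : x ∈ D.V) : D.par^[m + 1] x ≠ x := fun e =>
  TreeData.par_ne hx ((D.anc_par x).antisymm ⟨m, e⟩ hx)

theorem ensures_climb (H : OrderState D σ₀ σ k) (hpar : σ₀.natArr 1 = D.par) (hi : i ∈ D.V)
    (h3 : σ.natVar 3 = i) (h1 : σ.natVar 1 = i) (h5 : σ.natVar 5 = 0) :
    Ensures climb σ fun t τ => ∃ h, t ≤ 20 * h + 10 ∧ OrderState D σ₀ τ k ∧ τ.natVar 1 = i ∧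
      τ.natVar 5 = h ∧ τ.natArr 2 = σ.natArr 2 ∧
      (∀ j < h, τ.natArr 3 (j + 1) = D.par^[j] i) ∧ (∀ j < h, τ.natArr 2 (D.par^[j] i) = 0) ∧
      τ.natArr 2 (D.par^[h] i) ≠ 0 := by
  -- The depth bounds the climb and serves as potential; the relation `m + 20 * h = 20 * D.depth i`
  -- converts the cost into one per stacked vertex.
  refine (ensures_while_of_potential
    (Inv := fun m τ => ∃ h, m + 20 * h = 20 * D.depth i ∧ h + D.depth (D.par^[h] i) ≤ D.depth i ∧
      OrderState D σ₀ τ k ∧ τ.natVar 1 = i ∧ τ.natVar 5 = h ∧ τ.natVar 3 = D.par^[h] i ∧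
      τ.natArr 2 = σ.natArr 2 ∧
      (∀ j < h, τ.natArr 3 (j + 1) = D.par^[j] i) ∧ (∀ j < h, τ.natArr 2 (D.par^[j] i) = 0))
    ?_ (m := 20 * D.depth i) ⟨0, rfl, by simp, H, h1, h5, h3, rfl, by simp, by simp⟩).mono ?_
  · rintro m τ ⟨h, hm, hd, H', hi', hh, hc, hv, hs, hu⟩ hb
    simp only [Test.Holds, NatExp.eval, hc] at hb
    have hcV : D.par^[h] i ∈ D.V := TreeData.Anc.mem ⟨h, rfl⟩ hi fun e =>
      ((H'.visited _).2 (.inl e)) hb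
    have hdp : D.depth (D.par^[h + 1] i) < D.depth (D.par^[h] i) := by
      rw [Function.iterate_succ_apply']
      exact D.depth_par _ hcV
    have hpar' : τ.natArr 1 = D.par := (H'.natArr 1 (by norm_num) (by norm_num) (by norm_num)).trans
      hpar
    simp only [ensures_seq, ensures_setNatVar, ensures_setNatArr, NatExp.eval]
    refine ⟨20 * (D.depth i - (h + 1)), ⟨h + 1, by omega, by omega, ?_, ?_, ?_, ?_, ?_, ?_, ?_⟩, ?_⟩
    · exact H'.congr (by simp) (by simp) (fun a ha => by simp [ha]) (by simp) (by simp)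
    · simpa using hi'
    · simp [hh]
    · rw [Function.iterate_succ_apply']
      simp [hc, hpar']
    · simpa using hv
    · intro j hj
      by_cases hjh : j = h
      · subst hjh
        simp [hh, hc]
      · simpa [hjh, hh] using hs j (by omega)
    · intro j hj
      by_cases hjh : j = h
      · subst hjh
        simpa using hb
      · simpa using hu j (by omega)
    · simp [Test.time, NatExp.time]
      omega
  · rintro t τ ⟨m, ⟨h, hm, hd, H', hi', hh, hc, hv, hs, hu⟩, hb, ht⟩
    refine ⟨h, ?_, H', hi', hh, hv, hs, hu, ?_⟩
    · simp [Test.time, NatExp.time] at ht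
      omega
    · simpa [Test.Holds, NatExp.eval, hc] using hb

theorem ensures_descend (H : OrderState D σ₀ σ k) (hpar : σ₀.natArr 1 = D.par)
    (hw : ∀ x ∈ D.V, σ₀.realArr 0 (x - 1) = D.w x) (hi : i ∈ D.V) (h1 : σ.natVar 1 = i)
    (h5 : σ.natVar 5 = h)
    (hs : ∀ j < h, σ.natArr 3 (j + 1) = D.par^[j] i) (hu : ∀ j < h, σ.natArr 2 (D.par^[j] i) = 0)
    (hv : σ.natArr 2 (D.par^[h] i) ≠ 0) :
    Ensures descend σ fun t τ => t ≤ 40 * h + 10 ∧ OrderState D σ₀ τ (k + h) ∧ τ.natVar 1 = i ∧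
      τ.natVar 5 = 0 ∧ τ.natArr 2 i ≠ 0 ∧ (∀ x, σ.natArr 2 x ≠ 0 → τ.natArr 2 x ≠ 0) := by
  refine (ensures_while_of_potential
    (Inv := fun m τ => ∃ g ≤ h, m = 40 * g ∧ OrderState D σ₀ τ (k + (h - g)) ∧ τ.natVar 1 = i ∧
      τ.natVar 5 = g ∧ (∀ j < g, τ.natArr 3 (j + 1) = D.par^[j] i) ∧
      (∀ j < g, τ.natArr 2 (D.par^[j] i) = 0) ∧ τ.natArr 2 (D.par^[g] i) ≠ 0 ∧
      (∀ x, σ.natArr 2 x ≠ 0 → τ.natArr 2 x ≠ 0))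
    ?_ ⟨h, le_rfl, rfl, by simpa using H, h1, h5, hs, hu, hv, fun _ => id⟩).mono ?_
  · clear hs hu hv
    rintro m τ ⟨g, hg, rfl, H', hi', hh, hs, hu, hv, hmono⟩ hb
    have hg0 : 0 < g := by simpa [Test.Holds, NatExp.eval, hh] using hb
    obtain ⟨g, rfl⟩ : ∃ g', g = g' + 1 := ⟨g - 1, by omega⟩
    have hpar' : τ.natArr 1 = D.par := (H'.natArr 1 (by norm_num) (by norm_num) (by norm_num)).trans
      hpar
    have hy := hs g (by omega)
    have hyu := hu g (by omega)
    rw [Function.iterate_succ_apply'] at hv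
    have hyV : D.par^[g] i ∈ D.V := TreeData.Anc.mem ⟨g, rfl⟩ hi fun e =>
      ((H'.visited _).2 (.inl e)) hyu
    -- The vertices on the stack are distinct, so marking one leaves the others unmarked.
    have hne : ∀ j < g, D.par^[j] i ≠ D.par^[g] i := by
      intro j hj e
      have hjV : D.par^[j] i ∈ D.V := e ▸ hyV
      refine TreeData.iterate_par_ne (m := g - j - 1) hjV ?_
      rw [← Function.iterate_add_apply, show g - j - 1 + 1 + j = g by omega, e]
    have hw' := hw _ hyV
    generalize hye : D.par^[g] i = y at *
    have hpw := H'.pw _ hv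
    have h0 : τ.realArr 0 (y - 1) = D.w y := by rw [H'.realArr 0 (by norm_num), hw']
    have hkk : k + (h - (g + 1)) + 1 = k + (h - g) := by omega
    have hnv : ∀ j ∈ Finset.Icc 1 (k + (h - (g + 1))), τ.natArr 4 j ≠ y := fun j hj e =>
      ((H'.visited y).2 (.inr ⟨j, hj, e⟩)) hyu
    obtain ⟨K, hK⟩ : ∃ K, k + (h - (g + 1)) = K := ⟨_, rfl⟩
    rw [hK] at hkk H' hnv
    have hIcc : Finset.Icc 1 (K + 1) = insert (K + 1) (Finset.Icc 1 K) := by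
      ext; simp only [Finset.mem_Icc, Finset.mem_insert]; omega
    simp only [ensures_seq, ensures_setNatVar, ensures_setNatArr, ensures_setRealArr, NatExp.eval,
      RealExp.eval]
    simp only [Store.natVar_setNatVar, Store.natArr_setNatVar, Store.natVar_setNatArr,
      Store.natArr_setNatArr, Store.natVar_setRealArr, Store.natArr_setRealArr,
      Store.realArr_setNatVar, Store.realArr_setNatArr, Function.update_self, hh,
      Function.update_of_ne (show (3 : ℕ) ≠ 5 by norm_num),
      Function.update_of_ne (show (5 : ℕ) ≠ 3 by norm_num),
      Function.update_of_ne (show (1 : ℕ) ≠ 2 by norm_num),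
      Function.update_of_ne (show (3 : ℕ) ≠ 4 by norm_num),
      Function.update_of_ne (show (4 : ℕ) ≠ 5 by norm_num),
      Function.update_of_ne (show (4 : ℕ) ≠ 3 by norm_num), hy, H'.count, hpar', hpw, h0,
      ← TreeData.pw_par hyV, Nat.add_sub_cancel]
    refine ⟨_, ⟨g, by omega, rfl, ?_, ?_, ?_, ?_, ?_, ?_, ?_⟩, ?_⟩
    · rw [← hkk]
      obtain ⟨h₁, h₂, h₃, h₄, h₅, h₆, h₇, h₈, h₉, h₁₀⟩ := H'
      have hj : ∀ j ∈ Finset.Icc 1 K, j ≠ K + 1 := fun j hj => by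
        rw [Finset.mem_Icc] at hj; omega
      have hj' : ∀ j ∈ Finset.Icc 1 K, update (τ.natArr 4) (K + 1) y j = τ.natArr 4 j :=
        fun j hjK => Function.update_of_ne (hj j hjK) _ _
      refine ⟨by simpa using h₁, by simp, fun a ha₂ ha₃ ha₄ => by simpa [ha₂, ha₄] using h₃ a ha₂ ha₃ ha₄,
        by simpa using h₄, fun a ha => by simpa [ha] using h₅ a ha, ?_, ?_, ?_, ?_, ?_⟩
      all_goals simp only [Store.natArr_setNatVar, Store.natArr_setNatArr, Store.natArr_setRealArr,
        Store.realArr_setNatVar, Store.realArr_setNatArr, Store.realArr_setRealArr,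
        Function.update_self, Function.update_of_ne (show (4 : ℕ) ≠ 2 by norm_num),
        Function.update_of_ne (show (2 : ℕ) ≠ 4 by norm_num), hIcc]
      · intro j hj
        rcases Finset.mem_insert.1 hj with rfl | hj
        · simpa using hyV
        · rw [hj' j hj]
          exact h₆ j hj
      · intro i hi j hj e
        rcases Finset.mem_insert.1 hi with rfl | hi <;> rcases Finset.mem_insert.1 hj with rfl | hj
        · rfl
        · rw [hj' j hj, Function.update_self] at e
          exact absurd e.symm (hnv j hj)
        · rw [hj' i hi, Function.update_self] at e
          exact absurd e (hnv i hi)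
        · rw [hj' i hi, hj' j hj] at e
          exact h₇ i hi j hj e
      · intro j hj
        rcases Finset.mem_insert.1 hj with rfl | hj
        · rw [Function.update_self]
          refine ((h₉ _).1 hv).imp id ?_
          rintro ⟨i, hi, e⟩
          refine ⟨i, Finset.mem_insert_of_mem hi, ?_, (hj' i hi).trans e⟩
          rw [Finset.mem_Icc] at hi
          omega
        · rw [hj' j hj]
          refine (h₈ j hj).imp id ?_
          rintro ⟨i, hi, hij, e⟩
          exact ⟨i, Finset.mem_insert_of_mem hi, hij, (hj' i hi).trans e⟩
      · intro x
        rw [Finset.exists_mem_insert, Function.update_self]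
        by_cases hxy : x = y
        · simp [hxy]
        · rw [Function.update_of_ne hxy, h₉ x]
          refine or_congr_right ?_
          rw [or_iff_right (Ne.symm hxy)]
          exact exists_congr fun j => and_congr_right fun hj => by rw [hj' j hj]
      · intro x hx
        by_cases hxy : x = y
        · simp [hxy]
        · rw [Function.update_of_ne hxy] at hx ⊢
          exact h₁₀ x hx
    · simpa using hi'
    · simp
    · intro j hj
      simpa using hs j (by omega)
    · intro j hj
      simpa [hne j hj] using hu j (by omega)
    · simp [hye]
    · intro x hx
      by_cases hxy : x = y
      · simp [hxy]
      · simpa [hxy] using hmono x hx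
    · simp [Test.time, NatExp.time, RealExp.time]
      omega
  · rintro t τ ⟨m, ⟨g, hg, rfl, H', hi', hh, hs, hu, hv, hmono⟩, hb, ht⟩
    obtain rfl : g = 0 := by simpa [Test.Holds, NatExp.eval, hh] using hb
    refine ⟨?_, by simpa using H', hi', hh, hv, hmono⟩
    simp [Test.time, NatExp.time] at ht
    omega

theorem ensures_orderVertices (hn : σ.natVar 0 = D.n) (h4 : σ.natVar 4 = 0) (h5 : σ.natVar 5 = 0)
    (h2 : ∀ x, σ.natArr 2 x = 0) (h6 : ∀ x, σ.realArr 6 x = 0) (hpar : σ.natArr 1 = D.par)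
    (hw : ∀ x ∈ D.V, σ.realArr 0 (x - 1) = D.w x) :
    Ensures orderVertices σ fun t τ => t ≤ 120 * D.n + 20 ∧ OrderState D σ τ D.n ∧
      D.IsOrder (τ.natArr 4) := by
  simp only [orderVertices, ensures_seq, ensures_setNatVar, ensures_setNatArr, NatExp.eval]
  -- `i` vertices have been scanned and `k` numbered. A scan pays the constant overhead, and each
  -- newly numbered vertex pays once for being stacked and once for being popped.
  refine (ensures_while_of_potential
    (Inv := fun m τ => ∃ i ≤ D.n, ∃ k ≤ D.n, m = 60 * (D.n - i) + 60 * (D.n - k) ∧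
      OrderState D σ τ k ∧ τ.natVar 1 = i ∧ τ.natVar 5 = 0 ∧
      ∀ x ∈ Finset.Icc 1 i, τ.natArr 2 x ≠ 0)
    ?_ ⟨0, by simp, 0, by simp, rfl, ?_, by simp, by simpa using h5, by simp⟩).mono ?_
  · rintro m τ ⟨i, hi, k, hk, rfl, H, h1, h5, hvis⟩ hb
    have hin : i < D.n := by simpa [Test.Holds, NatExp.eval, h1, H.natVar, hn] using hb
    have hiV : i + 1 ∈ D.V := Finset.mem_Icc.2 ⟨by omega, by omega⟩
    simp only [ensures_seq, ensures_setNatVar, NatExp.eval, h1]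
    refine (ensures_climb (H.congr (by simp) (by simp) (by simp) (by simp) (by simp)) hpar hiV
      (by simp) (by simp) (by simpa using h5)).mono ?_
    rintro t₁ σ₁ ⟨h, ht₁, H₁, h1₁, h5₁, hv₁, hs, hu, hv⟩
    refine (ensures_descend H₁ hpar hw hiV h1₁ h5₁ hs hu hv).mono ?_
    rintro t₂ σ₂ ⟨ht₂, H₂, h1₂, h5₂, hi₂, hmono⟩
    have := H₂.card_le
    refine ⟨_, ⟨i + 1, by omega, k + h, this, rfl, H₂, h1₂, h5₂, ?_⟩, ?_⟩
    · intro x hx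
      by_cases hxi : x = i + 1
      · exact hxi ▸ hi₂
      · refine hmono x ?_
        rw [hv₁]
        refine hvis x ?_
        rw [Finset.mem_Icc] at hx ⊢
        omega
    · simp [Test.time, NatExp.time]
      omega
  · refine ⟨by simp, by simpa using h4, fun a ha _ _ => by simp [ha], rfl, fun _ _ => rfl,
      by simp, by simp, by simp, ?_, ?_⟩
    · intro x
      by_cases hx : x = 0
      · simp [hx]
      · simp [hx, h2]
    · intro x hx
      have : x = 0 := by
        by_contra h0
        simp [h0, h2] at hx
      rw [this, TreeData.pw_zero]
      exact h6 0
  · rintro t τ ⟨m, ⟨i, hi, k, hk, rfl, H, h1, h5, hvis⟩, hb, ht⟩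
    obtain rfl : i = D.n := by
      have : D.n ≤ i := by simpa [Test.Holds, NatExp.eval, h1, H.natVar, hn] using hb
      omega
    obtain ⟨rfl, hord⟩ := H.isOrder hvis
    refine ⟨?_, H, hord⟩
    simp [Test.time, NatExp.time] at ht ⊢
    omega

end ChainPartition

end

noncomputable section

namespace ChainPartition

open Program NatExp RealExp Test
open Function (update)
open scoped Classical

/-! ### Writing down the chains -/

variable {n k v w d i j h l : ℕ} {D : TreeData} {σ₀ σ τ : Store} {ord b : ℕ → ℕ}

def clearLabels : Program :=
  setNatVar 1 (.const 0);;
  .while (.natLt (.var 1) (.var 0))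
    (setNatVar 1 (.succ (.var 1));; setNatArr 7 (.var 1) (.const 0))

/-- Climbs from the end of the chain up to the parent of its top, whose number, never zero, is the
label. -/
def labelChain : Program :=
  .while (.not (.natEq (.var 3) (.var 5)))
    (setNatArr 7 (.var 3) (.var 2);; setNatVar 3 (.get 1 (.var 3)))

/-- With ancestors treated first, a vertex found without a label is the top of a new chain. -/
def labelAll : Program :=
  setNatVar 1 (.const 0);;
  .while (.natLt (.var 1) (.var 0))
    (setNatVar 1 (.succ (.var 1));;
    setNatVar 2 (.get 4 (.var 1));;
    ite (.natEq (.get 7 (.var 2)) (.const 0))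
      (setNatVar 3 (.get 6 (.var 2));; setNatVar 5 (.get 1 (.var 2));; labelChain) skip)

def copyLabels : Program :=
  setNatVar 1 (.const 0);;
  .while (.natLt (.var 1) (.var 0))
    (setNatArr 0 (.var 1) (.get 7 (.succ (.var 1)));; setNatVar 1 (.succ (.var 1)))

def writeOutput : Program :=
  clearLabels;; labelAll;; copyLabels;; setRealVar 0 (.var 5)

/-! ### Correctness and linear time of the labelling. -/

/-- The stores agree except for some scalars and the labels. -/
structure LabelFrame (σ τ : Store) : Prop where
  natVar : τ.natVar 0 = σ.natVar 0
  natArr : ∀ a ≠ 7, τ.natArr a = σ.natArr a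
  realVar : τ.realVar = σ.realVar

theorem ensures_clearLabels (hn : σ.natVar 0 = n) :
    Ensures clearLabels σ fun t τ => t ≤ 20 * n + 10 ∧ LabelFrame σ τ ∧
      ∀ x ∈ Finset.Icc 1 n, τ.natArr 7 x = 0 := by
  simp only [clearLabels, ensures_seq, ensures_setNatVar, NatExp.eval]
  refine (ensures_while_of_potential
    (Inv := fun m τ => ∃ i ≤ n, m = 20 * (n - i) ∧ LabelFrame σ τ ∧ τ.natVar 1 = i ∧
      ∀ x ∈ Finset.Icc 1 i, τ.natArr 7 x = 0)
    ?_ ⟨0, by simp, rfl, ⟨by simp, by simp, by simp⟩, by simp, by simp⟩).mono ?_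
  · rintro m τ ⟨i, hi, rfl, H, h1, hz⟩ hb
    have hin : i < n := by simpa [Test.Holds, NatExp.eval, h1, H.natVar, hn] using hb
    simp only [ensures_seq, ensures_setNatVar, ensures_setNatArr, NatExp.eval, h1]
    refine ⟨_, ⟨i + 1, by omega, rfl, ⟨by simpa using H.natVar, fun a ha => by
      simpa [ha] using H.natArr a ha, by simpa using H.realVar⟩, by simp, ?_⟩, ?_⟩
    · intro x hx
      by_cases hxi : x = i + 1
      · simp [hxi]
      · have : x ∈ Finset.Icc 1 i := by
          rw [Finset.mem_Icc] at hx ⊢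
          omega
        simpa [hxi] using hz x this
    · simp [Test.time, NatExp.time]
      omega
  · rintro t τ ⟨m, ⟨i, hi, rfl, H, h1, hz⟩, hb, ht⟩
    obtain rfl : i = n := by
      have : n ≤ i := by simpa [Test.Holds, NatExp.eval, h1, H.natVar, hn] using hb
      omega
    refine ⟨?_, H, hz⟩
    simp [Test.time, NatExp.time] at ht ⊢
    omega

variable (D) in
/-- The number of vertices without a label. -/
def unlabelled (ℓ : ℕ → ℕ) : ℕ := (D.V.filter fun x => ℓ x = 0).card

theorem ensures_labelChain (hpar : σ.natArr 1 = D.par) (hv : v ∈ D.V) (hd : d ∈ D.V)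
    (hvd : D.Anc v d) (h2 : σ.natVar 2 = v) (h3 : σ.natVar 3 = d) (h5 : σ.natVar 5 = D.par v)
    (hu : ∀ x ∈ D.path v d, σ.natArr 7 x = 0) :
    Ensures labelChain σ fun t τ => LabelFrame σ τ ∧ τ.natVar 1 = σ.natVar 1 ∧
      (∀ z, τ.natArr 7 z = if z ∈ D.path v d then v else σ.natArr 7 z) ∧
      t + 20 * unlabelled D (τ.natArr 7) ≤ 20 * unlabelled D (σ.natArr 7) + 10 := by
  have hv0 := TreeData.ne_zero_of_mem hv
  refine (ensures_while_of_potential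
    (Inv := fun m τ => ∃ x, m = 20 * unlabelled D (τ.natArr 7) ∧ LabelFrame σ τ ∧
      τ.natVar 1 = σ.natVar 1 ∧ τ.natVar 2 = v ∧ τ.natVar 5 = D.par v ∧ τ.natVar 3 = x ∧
      (x = D.par v ∨ x ∈ D.path v d) ∧
      ∀ z, τ.natArr 7 z = if z ∈ D.path v d ∧ ¬ D.Anc z x then v else σ.natArr 7 z)
    ?_ ⟨d, rfl, ⟨rfl, fun _ _ => rfl, rfl⟩, rfl, h2, h5, h3,
      .inr (TreeData.mem_path.2 ⟨hd, hvd, D.anc_refl d⟩), ?_⟩).mono ?_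
  · rintro m τ ⟨x, rfl, H, h1, h2, h5, h3, hx, hz⟩ hb
    have hxp : x ≠ D.par v := by simpa [Test.Holds, NatExp.eval, h3, h5] using hb
    have hxP := hx.resolve_left hxp
    obtain ⟨hxV, hvx, hxd⟩ := TreeData.mem_path.1 hxP
    have hpar' : τ.natArr 1 = D.par := (H.natArr 1 (by norm_num)).trans hpar
    simp only [ensures_seq, ensures_setNatVar, ensures_setNatArr, NatExp.eval, h3, h2,
      Store.natVar_setNatArr, Store.natArr_setNatArr,
      Function.update_of_ne (show (1 : ℕ) ≠ 7 by norm_num), hpar']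
    refine ⟨_, ⟨D.par x, rfl, ⟨by simpa using H.natVar, fun a ha => by
      simpa [ha] using H.natArr a ha, by simpa using H.realVar⟩, by simpa using h1,
      by simpa using h2, by simpa using h5, by simp, ?_, ?_⟩, ?_⟩
    · by_cases hxv : x = v
      · exact .inl (by rw [hxv])
      · have hA := (TreeData.anc_iff.1 hvx).resolve_left (Ne.symm hxv)
        have h0 : D.par x ≠ 0 := fun e => TreeData.not_anc_zero hv (e ▸ hA)
        exact .inr (TreeData.mem_path.2 ⟨(D.anc_par x).mem hxV h0, hA, (D.anc_par x).trans hxd⟩)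
    · intro z
      simp only [Store.natArr_setNatArr, Store.natArr_setNatVar, Function.update_self]
      by_cases hzx : z = x
      · subst hzx
        have hn : ¬ D.Anc z (D.par z) := fun hA =>
          TreeData.par_ne hxV ((D.anc_par z).antisymm hA hxV)
        rw [Function.update_self, if_pos ⟨hxP, hn⟩]
      · rw [Function.update_of_ne hzx, hz z]
        congr 1
        rw [TreeData.anc_iff (u := x), or_iff_right hzx]
    · have hx0 : τ.natArr 7 x = 0 := by
        rw [hz x, if_neg (by simp [D.anc_refl]), hu x hxP]
      have hcard : unlabelled D (update (τ.natArr 7) x v) + 1 = unlabelled D (τ.natArr 7) := by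
        unfold unlabelled
        rw [← Finset.card_erase_add_one (a := x) (s := D.V.filter fun y => τ.natArr 7 y = 0)
          (by simp only [Finset.mem_filter]; exact ⟨hxV, hx0⟩)]
        congr 2
        ext y
        by_cases hyx : y = x
        · simp [hyx, hv0]
        · simp [hyx]
      simp only [Store.natArr_setNatArr, Store.natArr_setNatVar, Function.update_self]
      simp [Test.time, NatExp.time]
      omega
  · intro z
    rw [if_neg]
    exact fun h => h.2 (TreeData.mem_path.1 h.1).2.2
  · rintro t τ ⟨m, ⟨x, rfl, H, h1, h2, h5, h3, hx, hz⟩, hb, ht⟩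
    have hxp : x = D.par v := by simpa [Test.Holds, NatExp.eval, h3, h5] using hb
    refine ⟨H, h1, fun z => ?_, ?_⟩
    · rw [hz z]
      congr 1
      rw [eq_iff_iff, and_iff_left_iff_imp]
      intro hzP hA
      rw [hxp] at hA
      exact TreeData.par_ne hv ((D.anc_par v).antisymm ((TreeData.mem_path.1 hzP).2.1.trans hA) hv)
    · simp [Test.time, NatExp.time] at ht ⊢
      omega

variable (D) in
/-- The label of a vertex is the top of its chain, which ends in the value of `b`. -/
def IsLabelled (b ℓ : ℕ → ℕ) (x : ℕ) : Prop :=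
  x ∈ D.path (ℓ x) (b (ℓ x)) ∧ ∀ y ∈ D.path (ℓ x) (b (ℓ x)), ℓ y = ℓ x

theorem ensures_labelAll (hord : D.IsOrder ord) (hn : σ.natVar 0 = D.n) (hpar : σ.natArr 1 = D.par)
    (h4 : σ.natArr 4 = ord) (h6 : σ.natArr 6 = b) (hb : ∀ v ∈ D.V, b v ∈ D.V ∧ D.Anc v (b v))
    (h7 : ∀ x ∈ D.V, σ.natArr 7 x = 0) :
    Ensures labelAll σ fun t τ => t ≤ 70 * D.n + 20 ∧ LabelFrame σ τ ∧
      ∀ x ∈ D.V, τ.natArr 7 x ∈ D.V ∧ IsLabelled D b (τ.natArr 7) x := by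
  have hU : unlabelled D (σ.natArr 7) ≤ D.n := by
    refine (Finset.card_filter_le _ _).trans ?_
    simp
  simp only [labelAll, ensures_seq, ensures_setNatVar, NatExp.eval]
  refine (ensures_while_of_potential
    (Inv := fun m τ => ∃ k ≤ D.n, m = 50 * (D.n - k) + 20 * unlabelled D (τ.natArr 7) ∧
      LabelFrame σ τ ∧ τ.natVar 1 = k ∧ (∀ j ∈ Finset.Icc 1 k, τ.natArr 7 (ord j) ≠ 0) ∧
      ∀ x ∈ D.V, τ.natArr 7 x ≠ 0 →
        (∃ j ∈ Finset.Icc 1 k, ord j = τ.natArr 7 x) ∧ IsLabelled D b (τ.natArr 7) x)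
    ?_ ⟨0, by simp, rfl, ⟨by simp, by simp, by simp⟩, by simp, by simp, ?_⟩).mono ?_
  · rintro m τ ⟨k, hk, rfl, H, h1, hlab, hℓ⟩ ht
    have hkn : k < D.n := by simpa [Test.Holds, NatExp.eval, h1, H.natVar, hn] using ht
    have hk1 : k + 1 ∈ Finset.Icc 1 D.n := Finset.mem_Icc.2 ⟨by omega, by omega⟩
    have hsub : ∀ j ∈ Finset.Icc 1 k, j ∈ Finset.Icc 1 (k + 1) := fun j hj => by
      rw [Finset.mem_Icc] at hj ⊢
      omega
    have hsub' : ∀ j ∈ Finset.Icc 1 k, j ∈ Finset.Icc 1 D.n := fun j hj => by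
      rw [Finset.mem_Icc] at hj ⊢
      omega
    have hlast : ∀ j ∈ Finset.Icc 1 (k + 1), j ≠ k + 1 → j ∈ Finset.Icc 1 k := fun j hj hne => by
      rw [Finset.mem_Icc] at hj ⊢
      omega
    obtain ⟨v, hv⟩ : ∃ v, ord (k + 1) = v := ⟨_, rfl⟩
    have hvV : v ∈ D.V := hv ▸ hord.mem _ hk1
    have e1 : τ.natArr 1 = D.par := (H.natArr 1 (by norm_num)).trans hpar
    have e4 : τ.natArr 4 = ord := (H.natArr 4 (by norm_num)).trans h4
    have e6 : τ.natArr 6 = b := (H.natArr 6 (by norm_num)).trans h6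
    simp only [ensures_seq, ensures_setNatVar, ensures_ite, ensures_skip, NatExp.eval, Test.Holds,
      h1, e4, hv, Store.natVar_setNatVar, Store.natArr_setNatVar, Function.update_self, e6, e1,
      Function.update_of_ne (show (2 : ℕ) ≠ 3 by norm_num)]
    refine ⟨fun h0 => ?_, fun h0 => ?_⟩
    -- Suppose `x` on the chain of `v` has a label, the top of an earlier chain. If this top is
    -- above `v`, then `v` is on that chain and has a label; if it is below `v`, it comes too early
    -- in the order.
    · have hfree : ∀ x ∈ D.path v (b v), τ.natArr 7 x = 0 := by
        intro x hx
        by_contra hne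
        obtain ⟨hxV, hvx, hxb⟩ := TreeData.mem_path.1 hx
        obtain ⟨⟨j, hj, hjc⟩, hxc, hyc⟩ := hℓ x hxV hne
        obtain ⟨-, hcx, hxc⟩ := TreeData.mem_path.1 hxc
        rcases hcx.total hvx with hA | hA
        · have := hyc v (TreeData.mem_path.2 ⟨hvV, hA, hvx.trans hxc⟩)
          exact hne (this.symm.trans h0)
        · rw [← hv, ← hjc] at hA
          have := hord.le _ hk1 j (hsub' j hj) hA
          rw [Finset.mem_Icc] at hj
          omega
      refine (ensures_labelChain (D := D) (v := v) (d := b v) (by simpa using e1) hvV (hb v hvV).1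
        (hb v hvV).2 (by simp) (by simp) (by simp) (by simpa using hfree)).mono ?_
      rintro t υ ⟨H', h1', hz, ht⟩
      simp only [Store.natArr_setNatVar] at hz ht
      have hvp : v ∈ D.path v (b v) := TreeData.mem_path.2 ⟨hvV, D.anc_refl v, (hb v hvV).2⟩
      have hin : ∀ z ∈ D.path v (b v), υ.natArr 7 z = v := fun z hz' => by rw [hz, if_pos hz']
      have hout : ∀ z, τ.natArr 7 z ≠ 0 → υ.natArr 7 z = τ.natArr 7 z := fun z hz' => by
        rw [hz, if_neg fun h => hz' (hfree z h)]
      refine ⟨_, ⟨k + 1, by omega, rfl, ⟨?_, fun a ha => ?_, ?_⟩, ?_, ?_, ?_⟩, ?_⟩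
      · rw [H'.natVar, ← H.natVar]
        simp
      · rw [H'.natArr a ha, ← H.natArr a ha]
        simp
      · rw [H'.realVar, ← H.realVar]
        simp
      · rw [h1']
        simp
      · intro j hj
        by_cases hjk : j = k + 1
        · rw [hjk, hv, hin v hvp]
          exact TreeData.ne_zero_of_mem hvV
        · have := hlab j (hlast j hj hjk)
          rwa [hout _ this]
      · intro x hxV hx
        by_cases hxp : x ∈ D.path v (b v)
        · unfold IsLabelled
          rw [hin x hxp]
          exact ⟨⟨k + 1, by simp, hv⟩, hxp, hin⟩
        · rw [hz, if_neg hxp] at hx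
          obtain ⟨⟨j, hj, hjc⟩, hxc, hyc⟩ := hℓ x hxV hx
          unfold IsLabelled
          rw [hout x hx]
          refine ⟨⟨j, hsub j hj, hjc⟩, hxc, fun y hy => ?_⟩
          have := hyc y hy
          rw [hout y (by rwa [this]), this]
      · simp [Test.time, NatExp.time]
        omega
    · refine ⟨_, ⟨k + 1, by omega, rfl, ⟨by simpa using H.natVar, by simpa using H.natArr,
        by simpa using H.realVar⟩, by simp, ?_, ?_⟩, ?_⟩
      · intro j hj
        by_cases hjk : j = k + 1
        · rw [hjk, hv]
          simpa using h0
        · simpa using hlab j (hlast j hj hjk)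
      · intro x hxV hx
        obtain ⟨⟨j, hj, hjc⟩, h⟩ := hℓ x hxV (by simpa using hx)
        exact ⟨⟨j, hsub j hj, by simpa using hjc⟩, by simpa using h⟩
      · simp [Test.time, NatExp.time]
        omega
  · intro x hx hne
    exact absurd (by simpa using h7 x hx) hne
  · rintro t τ ⟨m, ⟨k, hk, rfl, H, h1, hlab, hℓ⟩, hb, ht⟩
    obtain rfl : k = D.n := by
      have : D.n ≤ k := by simpa [Test.Holds, NatExp.eval, h1, H.natVar, hn] using hb
      omega
    refine ⟨?_, H, fun x hx => ?_⟩
    · simp [Test.time, NatExp.time] at ht ⊢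
      omega
    · obtain ⟨j, hj, rfl⟩ := hord.exists_eq hx
      obtain ⟨⟨i, hi, hi'⟩, h⟩ := hℓ _ hx (hlab j hj)
      exact ⟨hi' ▸ hord.mem i hi, h⟩

theorem ensures_copyLabels (hn : σ.natVar 0 = n) :
    Ensures copyLabels σ fun t τ => t ≤ 20 * n + 10 ∧ τ.realVar = σ.realVar ∧
      ∀ i < n, τ.natArr 0 i = σ.natArr 7 (i + 1) := by
  simp only [copyLabels, ensures_seq, ensures_setNatVar, NatExp.eval]
  refine (ensures_while_of_potential
    (Inv := fun m τ => ∃ i ≤ n, m = 20 * (n - i) ∧ τ.natVar 0 = n ∧ τ.natVar 1 = i ∧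
      τ.natArr 7 = σ.natArr 7 ∧ τ.realVar = σ.realVar ∧ ∀ j < i, τ.natArr 0 j = σ.natArr 7 (j + 1))
    ?_ ⟨0, by simp, rfl, by simpa using hn, by simp, by simp, by simp, by simp⟩).mono ?_
  · rintro m τ ⟨i, hi, rfl, h0, h1, h7, hr, hz⟩ hb
    have hin : i < n := by simpa [Test.Holds, NatExp.eval, h1, h0] using hb
    simp only [ensures_seq, ensures_setNatVar, ensures_setNatArr, NatExp.eval, h1,
      Store.natVar_setNatArr]
    refine ⟨_, ⟨i + 1, by omega, rfl, by simpa using h0, by simp, by simpa using h7,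
      by simpa using hr, ?_⟩, ?_⟩
    · intro j hj
      by_cases hji : j = i
      · simp [hji, h7]
      · simpa [hji] using hz j (by omega)
    · simp [Test.time, NatExp.time]
      omega
  · rintro t τ ⟨m, ⟨i, hi, rfl, h0, h1, h7, hr, hz⟩, hb, ht⟩
    obtain rfl : i = n := by
      have : n ≤ i := by simpa [Test.Holds, NatExp.eval, h1, h0] using hb
      omega
    refine ⟨?_, hr, hz⟩
    simp [Test.time, NatExp.time] at ht ⊢
    omega

theorem ensures_writeOutput (hord : D.IsOrder ord) (hn : σ.natVar 0 = D.n)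
    (hpar : σ.natArr 1 = D.par) (h4 : σ.natArr 4 = ord) (h6 : σ.natArr 6 = b)
    (hb : ∀ v ∈ D.V, b v ∈ D.V ∧ D.Anc v (b v)) :
    Ensures writeOutput σ fun t τ => t ≤ 200 * D.n + 60 ∧ τ.realVar 0 = σ.realVar 5 ∧
      ∃ ℓ : ℕ → ℕ, (∀ i < D.n, τ.natArr 0 i = ℓ (i + 1)) ∧
        ∀ x ∈ D.V, ℓ x ∈ D.V ∧ IsLabelled D b ℓ x := by
  simp only [writeOutput, ensures_seq, ensures_setRealVar, RealExp.eval]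
  refine (ensures_clearLabels hn).mono fun t₁ σ₁ ⟨ht₁, hf₁, hz₁⟩ => ?_
  refine (ensures_labelAll hord (hf₁.natVar.trans hn) ((hf₁.natArr 1 (by norm_num)).trans hpar)
    ((hf₁.natArr 4 (by norm_num)).trans h4) ((hf₁.natArr 6 (by norm_num)).trans h6) hb hz₁).mono
    fun t₂ σ₂ ⟨ht₂, hf₂, hℓ⟩ => ?_
  refine (ensures_copyLabels (hf₂.natVar.trans (hf₁.natVar.trans hn))).mono
    fun t₃ σ₃ ⟨ht₃, hr₃, hc⟩ => ?_
  refine ⟨?_, ?_, σ₂.natArr 7, fun i hi => by simpa using hc i hi, hℓ⟩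
  · simp [RealExp.time]
    omega
  · rw [hr₃, hf₂.realVar, hf₁.realVar]
    simp

end ChainPartition

end

noncomputable section

namespace ChainPartition

open Program NatExp RealExp Test
open Function (update)

/-! ### The whole program -/

variable {l : ℕ} {D : TreeData} {σ τ : Store}

/-- Shifts the numbering by one, so that `0` is free to stand for the empty heap and for the parent
of the root, which the input marks as its own parent. -/
def copyParents : Program :=
  .while (.natLt (.var 1) (.var 0))
    (ite (.natEq (.get 0 (.var 1)) (.var 1)) skip
      (setNatArr 1 (.succ (.var 1)) (.succ (.get 0 (.var 1))));;
    setNatVar 1 (.succ (.var 1)))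

/-- The distance of the first two ranks is positive when there are two vertices. With a single
vertex it may vanish, but then two nonempty heaps are never melded. -/
def setUnit : Program :=
  ite (.realLe (.get 2 (.const 0)) (.get 2 (.const 1)))
    (setRealVar 1 (.sub (.get 2 (.const 1)) (.get 2 (.const 0))))
    (setRealVar 1 (.sub (.get 2 (.const 0)) (.get 2 (.const 1))))

def solve : Program :=
  copyParents;; setUnit;; orderVertices;; setNatVar 1 (.var 0);; processAll;; writeOutput

/-! ### The phases put together. -/

/-- The store holds the instance `D` in the input format. -/
structure IsInput (D : TreeData) (σ : Store) : Prop where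
  natVar_zero : σ.natVar 0 = D.n
  natVar : ∀ x ≠ 0, σ.natVar x = 0
  par : ∀ i < D.n, D.par (i + 1) = if σ.natArr 0 i = i then 0 else σ.natArr 0 i + 1
  natArr : ∀ a ≠ 0, ∀ i, σ.natArr a i = 0
  realVar_zero : σ.realVar 0 = D.w₀
  realVar : ∀ x ≠ 0, σ.realVar x = 0
  w_eq : ∀ x ∈ D.V, σ.realArr 0 (x - 1) = D.w x
  s_eq : ∀ x ∈ D.V, σ.realArr 1 (x - 1) = D.s x
  r_eq : ∀ x ∈ D.V, σ.realArr 2 (x - 1) = D.r x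
  realArr : ∀ a, 3 ≤ a → ∀ i, σ.realArr a i = 0

theorem ensures_copyParents (H : IsInput D σ) :
    Ensures copyParents σ fun t τ => t ≤ 30 * D.n + 10 ∧ (∀ x ≠ 1, τ.natVar x = σ.natVar x) ∧
      τ.natArr 1 = D.par ∧ (∀ a ≠ 1, τ.natArr a = σ.natArr a) ∧ τ.realVar = σ.realVar ∧
      τ.realArr = σ.realArr := by
  refine (ensures_while_of_potential
    (Inv := fun m τ => ∃ i ≤ D.n, m = 30 * (D.n - i) ∧ τ.natVar 1 = i ∧
      (∀ x ≠ 1, τ.natVar x = σ.natVar x) ∧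
      (∀ x, τ.natArr 1 x = if x ≤ i then D.par x else 0) ∧ (∀ a ≠ 1, τ.natArr a = σ.natArr a) ∧
      τ.realVar = σ.realVar ∧ τ.realArr = σ.realArr)
    ?_ ⟨0, by simp, rfl, H.natVar 1 (by norm_num), fun _ _ => rfl, ?_, fun _ _ => rfl, rfl,
      rfl⟩).mono ?_
  · rintro m τ ⟨i, hi, rfl, h1, hv, hp, hn, hr, ha⟩ hb
    have hin : i < D.n := by simpa [Test.Holds, NatExp.eval, h1, hv, H.natVar_zero] using hb
    have e0 := hn 0 (by norm_num)
    have hpar := H.par i hin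
    simp only [ensures_seq, ensures_setNatVar, ensures_ite, ensures_skip, ensures_setNatArr,
      NatExp.eval, Test.Holds, h1, e0, Store.natVar_setNatArr]
    have hsplit : ∀ x ≠ i + 1, (x ≤ i + 1 ↔ x ≤ i) := fun x hx => by omega
    refine ⟨fun h0 => ?_, fun h0 => ?_⟩
    · rw [if_pos h0] at hpar
      refine ⟨_, ⟨i + 1, by omega, rfl, by simp, fun x hx => by simpa [hx] using hv x hx, ?_,
        by simpa using hn, by simpa using hr, by simpa using ha⟩, ?_⟩
      · intro x
        rw [Store.natArr_setNatVar, hp x]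
        by_cases hx : x = i + 1
        · simp [hx, hpar]
        · simp only [hsplit x hx]
      · simp [Test.time, NatExp.time]
        omega
    · rw [if_neg h0] at hpar
      refine ⟨_, ⟨i + 1, by omega, rfl, by simp, fun x hx => by simpa [hx] using hv x hx, ?_,
        fun a ha => by simpa [ha] using hn a ha, by simpa using hr, by simpa using ha⟩, ?_⟩
      · intro x
        simp only [Store.natArr_setNatVar, Store.natArr_setNatArr, Function.update_self]
        by_cases hx : x = i + 1
        · simp [hx, hpar]
        · simp only [Function.update_of_ne hx, hsplit x hx, hp x]
      · simp [Test.time, NatExp.time]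
        omega
  · intro x
    rw [H.natArr 1 (by norm_num)]
    split_ifs with hx
    · rw [Nat.le_zero.1 hx, D.par_zero]
    · rfl
  · rintro t τ ⟨m, ⟨i, hi, rfl, h1, hv, hp, hn, hr, ha⟩, hb, ht⟩
    obtain rfl : i = D.n := by
      have : D.n ≤ i := by simpa [Test.Holds, NatExp.eval, h1, hv, H.natVar_zero] using hb
      omega
    refine ⟨?_, hv, ?_, hn, hr, ha⟩
    · simp [Test.time, NatExp.time] at ht ⊢
      omega
    · funext x
      rw [hp x]
      split_ifs with hx
      · rfl
      · rw [D.par_of_lt x (by omega)]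

theorem ensures_setUnit (hr : ∀ x ∈ D.V, σ.realArr 2 (x - 1) = D.r x) :
    Ensures setUnit σ fun t τ => t ≤ 20 ∧ ∃ u, (2 ≤ D.n → 0 < u) ∧ τ = σ.setRealVar 1 u := by
  have hne : 2 ≤ D.n → σ.realArr 2 0 ≠ σ.realArr 2 1 := fun h e => by
    have h1 : 1 ∈ D.V := Finset.mem_Icc.2 ⟨by omega, by omega⟩
    have h2 : 2 ∈ D.V := Finset.mem_Icc.2 ⟨by omega, by omega⟩
    have e1 := hr 1 h1
    have e2 := hr 2 h2
    norm_num at e1 e2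
    have := D.r_inj 1 h1 2 h2 (by rw [← e1, ← e2, e])
    omega
  simp only [setUnit, ensures_ite, ensures_setRealVar, Test.Holds, RealExp.eval, NatExp.eval]
  refine ⟨fun h => ⟨by simp [Test.time, RealExp.time, NatExp.time], _, fun h2 => ?_, rfl⟩,
    fun h => ⟨by simp [Test.time, RealExp.time, NatExp.time], _, fun _ => ?_, rfl⟩⟩
  · exact sub_pos.2 (lt_of_le_of_ne h (hne h2))
  · exact sub_pos.2 (not_le.1 h)

theorem ensures_solve (H : IsInput D σ) (hl : D.n < 2 ^ l) :
    Ensures solve σ fun t τ => t ≤ (7000 * l + 8000) * D.n + 200 ∧ ∃ (h : ℕ → ℝ) (b ℓ : ℕ → ℕ),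
      (∀ v ∈ D.V, D.Good h (b v) v) ∧ τ.realVar 0 = ∑ x ∈ D.V, h x ∧
      (∀ i < D.n, τ.natArr 0 i = ℓ (i + 1)) ∧ ∀ x ∈ D.V, ℓ x ∈ D.V ∧ IsLabelled D b ℓ x := by
  simp only [solve, ensures_seq]
  refine (ensures_copyParents H).mono ?_
  rintro t₁ σ₁ ⟨ht₁, hv₁, hp₁, hn₁, hrv₁, hra₁⟩
  refine (ensures_setUnit (D := D) (by rw [hra₁]; exact H.r_eq)).mono ?_
  rintro t₂ _ ⟨ht₂, u, hu, rfl⟩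
  refine (ensures_orderVertices (D := D) ?_ ?_ ?_ ?_ ?_ (by simpa using hp₁) ?_).mono ?_
  · simpa [hv₁] using H.natVar_zero
  · simpa [hv₁] using H.natVar 4 (by norm_num)
  · simpa [hv₁] using H.natVar 5 (by norm_num)
  · simpa [hn₁] using H.natArr 2 (by norm_num)
  · simpa [hra₁] using H.realArr 6 (by norm_num)
  · simpa [hra₁] using H.w_eq
  rintro t₃ σ₃ ⟨ht₃, H₃, hord⟩
  obtain ⟨c₁, -, c₃, c₄, c₅, -, -, -, c₉, c₁₀⟩ := H₃
  have c₁' : σ₃.natVar 0 = D.n := by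
    rw [c₁, Store.natVar_setRealVar, hv₁ 0 (by norm_num), H.natVar_zero]
  have hreal : ∀ a ≠ 6, σ₃.realArr a = σ.realArr a := fun a ha => by
    rw [c₅ a ha, Store.realArr_setRealVar, hra₁]
  have hnat : ∀ a, a ≠ 1 → a ≠ 2 → a ≠ 3 → a ≠ 4 → σ₃.natArr a = σ.natArr a := by
    intro a h1 h2 h3 h4
    rw [c₃ a h2 h3 h4, Store.natArr_setRealVar, hn₁ a h1]
  have hvar : ∀ x ≠ 1, σ₃.realVar x = σ.realVar x := fun x hx => by
    rw [c₄, Store.realVar_setRealVar, Function.update_of_ne hx, hrv₁]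
  rw [ensures_setNatVar]
  have hE : Env D (σ₃.natArr 4) u D.n (σ₃.natVar 2) (σ₃.setNatVar 1 D.n) := by
    refine ⟨?_, ?_, ?_, ?_, ?_, ?_, ?_, rfl, ?_, ?_, ?_, ?_, hu⟩
    · simpa using c₁'
    · simp
    · simp
    · simpa [hvar] using H.realVar_zero
    · simp [c₄]
    · simpa [hvar] using H.realVar 6 (by norm_num)
    · simpa [c₃] using hp₁
    · simpa [hreal] using H.w_eq
    · simpa [hreal] using H.s_eq
    · simpa [hreal] using H.r_eq
    · intro x hx
      refine c₁₀ x ((c₉ x).2 (.inr ?_))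
      exact hord.exists_eq hx
  have hS := State.of_empty hE ?_ ?_ ?_ ?_
  rotate_left
  · intro k q
    have hk : 4 < rootArr k := by simp only [rootArr]; omega
    rw [Store.natArr_setNatVar, hnat _ (by omega) (by omega) (by omega) (by omega)]
    exact H.natArr _ (by omega) _
  · intro k
    rw [Store.realArr_setNatVar, hreal _ (by simp only [sizeArr]; omega)]
    exact H.realArr _ (by simp only [sizeArr]; omega) _
  · intro d
    rw [Store.natArr_setNatVar, hnat _ (by simp) (by simp) (by simp) (by simp)]
    exact H.natArr _ (by simp) _
  · rw [Store.realVar_setNatVar, hvar _ (by norm_num)]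
    exact H.realVar _ (by norm_num)
  simp only [NatExp.eval, c₁']
  refine (ensures_processAll hord hl hS).mono ?_
  rintro t₄ σ₄ ⟨ht₄, g, v, H₄⟩
  refine (ensures_writeOutput hord H₄.env.n_eq H₄.env.par_eq H₄.env.ord_eq rfl
    fun v hv => ⟨(H₄.good v hv).mem, (H₄.good v hv).anc⟩).mono ?_
  rintro t₅ σ₅ ⟨ht₅, hr₅, ℓ, hℓ, hℓ'⟩
  refine ⟨?_, σ₄.realArr 7, σ₄.natArr 6, ℓ, H₄.good, hr₅.trans H₄.total, hℓ, hℓ'⟩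
  simp [Contents.pot, tot] at ht₄
  simp [NatExp.time]
  -- Six units per vertex go to the heaps; the linear phases take `350 * D.n` steps up to constants.
  have : (1000 * l + 1000) * (6 * D.n) + 1000 * D.n ≤ (7000 * l + 8000) * D.n := by nlinarith
  omega

end ChainPartition

end

noncomputable section

namespace ChainPartition

open scoped Classical

/-! ### From rooted trees to parent arrays -/

section Tree

variable {α : Type*} [PartialOrder α] [PredOrder α] {v u z : α}

/-- In a tree, a walk entering the vertices above `z` passes through `z`. -/
theorem mem_support_of_le (p : (SimpleGraph.hasse α).Walk v u) (hv : ¬ z ≤ v) (hu : z ≤ u) :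
    z ∈ p.support := by
  induction p with
  | nil => exact absurd hu hv
  | @cons a a' b h p ih =>
    rw [SimpleGraph.Walk.support_cons]
    refine List.mem_cons_of_mem _ ?_
    by_cases ha : z ≤ a'
    · rcases SimpleGraph.hasse_adj.1 h with hc | hc
      -- If `a'` covers `a`, then `a` is its predecessor, so the step can enter the set of elements
      -- above `z` only at `z`. A step in the other direction cannot enter this set.
      · rcases ha.eq_or_lt with rfl | hlt
        · exact p.start_mem_support
        · exact absurd (hc.pred_eq ▸ Order.le_pred_of_lt hlt) hv
      · exact absurd (ha.trans hc.le) hv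
    · exact ih ha hu

/-- The path from a vertex down to a descendant. -/
theorem exists_isPath_of_le [IsPredArchimedean α] (h : v ≤ u) :
    ∃ p : (SimpleGraph.hasse α).Walk v u, p.IsPath ∧ ∀ t, t ∈ p.support ↔ v ≤ t ∧ t ≤ u := by
  obtain ⟨k, hk⟩ := exists_pred_iterate_of_le h
  clear h
  induction k generalizing u with
  | zero =>
    obtain rfl : u = v := hk
    refine ⟨.nil, .nil, fun t => ?_⟩
    simp only [SimpleGraph.Walk.support_nil, List.mem_singleton]
    exact ⟨fun e => e ▸ ⟨le_rfl, le_rfl⟩, fun ht => le_antisymm ht.2 ht.1⟩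
  | succ k ih =>
    rw [Function.iterate_succ_apply] at hk
    obtain ⟨p, hp, hs⟩ := ih hk
    by_cases hmin : IsMin u
    · rw [hmin.pred_eq] at hk
      exact ih hk
    · have hlt : Order.pred u < u := Order.pred_lt_of_not_isMin hmin
      have hvu : v ≤ Order.pred u := ((hs v).1 p.start_mem_support).2
      have hadj : (SimpleGraph.hasse α).Adj (Order.pred u) u :=
        SimpleGraph.hasse_adj.2 (.inl (Order.pred_covBy_of_not_isMin hmin))
      refine ⟨p.concat hadj, hp.concat (fun hu => ?_) _, fun t => ?_⟩
      · exact hlt.not_ge ((hs u).1 hu).2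
      · rw [SimpleGraph.Walk.support_concat, List.mem_append, hs, List.mem_singleton]
        constructor
        · rintro (ht | rfl)
          · exact ⟨ht.1, ht.2.trans hlt.le⟩
          · exact ⟨hvu.trans hlt.le, le_rfl⟩
        · rintro ⟨h₁, h₂⟩
          rcases h₂.eq_or_lt with e | hlt
          · exact .inr e
          · exact .inl ⟨h₁, Order.le_pred_of_lt hlt⟩

end Tree

/-! ### The instance renumbered from `1`, its ancestors and its chains. -/

namespace Problem

variable {n : ℕ} (I : Problem.{u} n)

theorem node_parent (i : Fin n) : I.node (I.parent i) = Order.pred (I.node i) := by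
  simp [parent]

/-- The parents, with the vertices numbered from `1`. -/
def parArr (x : ℕ) : ℕ :=
  if x = 0 then 0
  else arrayOf (fun i => if I.parent i = i then 0 else (I.parent i : ℕ) + 1) (x - 1)

/-- The number of ancestors. -/
def depthArr (x : ℕ) : ℕ :=
  if x = 0 then 0
  else arrayOf (fun i => (Finset.univ.filter fun j => I.node j ≤ I.node i).card) (x - 1)

theorem parArr_succ (i : Fin n) :
    I.parArr (i + 1) = if I.parent i = i then 0 else (I.parent i : ℕ) + 1 := by
  simp [parArr, arrayOf]

theorem depthArr_succ (i : Fin n) :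
    I.depthArr (i + 1) = (Finset.univ.filter fun j => I.node j ≤ I.node i).card := by
  simp [depthArr, arrayOf]

theorem exists_fin {x : ℕ} (hx : x ∈ Finset.Icc 1 n) : ∃ i : Fin n, x = i + 1 := by
  rw [Finset.mem_Icc] at hx
  exact ⟨⟨x - 1, by omega⟩, by simp; omega⟩

theorem arrayOf_fin {α : Type*} [Zero α] (f : Fin n → α) (i : Fin n) : arrayOf f i = f i := by
  simp [arrayOf]

/-- The ancestors of the parent are ancestors of `i`, and `i` itself is missing among them. -/
theorem depthArr_parArr (i : Fin n) : I.depthArr (I.parArr (i + 1)) < I.depthArr (i + 1) := by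
  rw [parArr_succ, depthArr_succ]
  split_ifs with h
  · rw [depthArr, if_pos rfl]
    exact Finset.card_pos.2 ⟨i, by simp⟩
  · rw [depthArr_succ]
    refine Finset.card_lt_card (Finset.ssubset_iff_subset_ne.2 ⟨fun j hj => ?_, fun e => ?_⟩)
    · simp only [Finset.mem_filter, Finset.mem_univ, true_and, node_parent] at hj ⊢
      exact hj.trans (Order.pred_le _)
    · have : i ∈ Finset.univ.filter fun j => I.node j ≤ I.node (I.parent i) := by
        rw [e]
        simp
      simp only [Finset.mem_filter, Finset.mem_univ, true_and] at this
      refine h (I.node.injective (le_antisymm ?_ this))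
      rw [node_parent]
      exact Order.pred_le _

/-- The instance with the vertices numbered from `1`. -/
def toTreeData (h₁ : ∀ i, 0 ≤ I.weight i) (h₂ : ∀ i, I.weight i ≤ I.threshold)
    (h₃ : Function.Injective I.rank) : TreeData where
  n := n
  par := I.parArr
  depth := I.depthArr
  w x := arrayOf I.weight (x - 1)
  s x := arrayOf I.cost (x - 1)
  r x := arrayOf I.rank (x - 1)
  w₀ := I.threshold
  par_le x := by
    by_cases hx : x ∈ Finset.Icc 1 n
    · obtain ⟨i, rfl⟩ := exists_fin hx
      rw [parArr_succ]
      split_ifs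
      · exact Nat.zero_le _
      · exact (I.parent i).2
    · rw [Finset.mem_Icc] at hx
      unfold parArr arrayOf
      split_ifs <;> omega
  par_zero := by simp [parArr]
  depth_zero := by simp [depthArr]
  depth_par x hx := by
    obtain ⟨i, rfl⟩ := exists_fin hx
    exact I.depthArr_parArr i
  par_of_lt x hx := by
    unfold parArr arrayOf
    split_ifs <;> omega
  w_nonneg x := by
    unfold arrayOf
    split_ifs
    · exact h₁ _
    · exact le_rfl
  w_le x hx := by
    obtain ⟨i, rfl⟩ := exists_fin hx
    simpa [arrayOf] using h₂ i
  r_inj x hx y hy h := by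
    obtain ⟨i, rfl⟩ := exists_fin hx
    obtain ⟨j, rfl⟩ := exists_fin hy
    have : i = j := h₃ (by simpa [arrayOf] using h)
    rw [this]

variable {I}
variable {h₁ : ∀ i, 0 ≤ I.weight i} {h₂ : ∀ i, I.weight i ≤ I.threshold}
  {h₃ : Function.Injective I.rank}

theorem isInput : IsInput (I.toTreeData h₁ h₂ h₃) (inputStore I) where
  natVar_zero := by simp [inputStore, toTreeData]
  natVar x hx := by simp [inputStore, hx]
  par i hi := by
    change I.parArr (i + 1) = _
    rw [I.parArr_succ ⟨i, hi⟩]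
    have : (inputStore I).natArr 0 i = (I.parent ⟨i, hi⟩ : ℕ) := by
      simp only [inputStore, if_true]
      exact arrayOf_fin (fun i => (I.parent i : ℕ)) ⟨i, hi⟩
    rw [this]
    simp only [Fin.ext_iff]
  natArr a ha i := by simp [inputStore, ha]
  realVar_zero := by simp [inputStore, toTreeData]
  realVar x hx := by simp [inputStore, hx]
  w_eq x _ := by simp [inputStore, toTreeData]
  s_eq x _ := by simp [inputStore, toTreeData]
  r_eq x _ := by simp [inputStore, toTreeData]
  realArr a ha i := by
    have ha₀ : a ≠ 0 := by omega
    have ha₁ : a ≠ 1 := by omega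
    have ha₂ : a ≠ 2 := by omega
    simp [inputStore, ha₀, ha₁, ha₂]

theorem mem_V (i : Fin n) : (i : ℕ) + 1 ∈ (I.toTreeData h₁ h₂ h₃).V := by
  rw [Finset.mem_Icc]
  have := i.2
  exact ⟨by omega, this⟩

theorem anc_iff_le (i j : Fin n) :
    (I.toTreeData h₁ h₂ h₃).Anc (i + 1) (j + 1) ↔ I.node i ≤ I.node j := by
  have hpar : (I.toTreeData h₁ h₂ h₃).par = I.parArr := rfl
  constructor
  · rintro ⟨k, hk⟩
    induction k generalizing j with
    | zero =>
      have : j = i := Fin.ext (by simpa using hk)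
      rw [this]
    | succ k ih =>
      rw [Function.iterate_succ_apply, hpar, parArr_succ] at hk
      split_ifs at hk with hj
      · rw [← hpar, Function.iterate_fixed (TreeData.par_zero _)] at hk
        omega
      · refine (ih _ hk).trans ?_
        rw [node_parent]
        exact Order.pred_le _
  · intro hij
    obtain ⟨k, hk⟩ := exists_pred_iterate_of_le hij
    clear hij
    induction k generalizing j with
    | zero =>
      have : j = i := I.node.injective hk
      rw [this]
      exact TreeData.anc_refl _ _
    | succ k ih =>
      rw [Function.iterate_succ_apply, ← node_parent] at hk
      by_cases hj : I.parent j = j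
      · rw [hj] at hk
        exact ih j hk
      · have e : (I.toTreeData h₁ h₂ h₃).par (j + 1) = (I.parent j : ℕ) + 1 := by
          rw [hpar, parArr_succ, if_neg hj]
        exact (e ▸ ih _ hk).trans (TreeData.anc_par _ _)

theorem mem_path_iff (i v u : Fin n) : (i : ℕ) + 1 ∈ (I.toTreeData h₁ h₂ h₃).path (v + 1) (u + 1) ↔
    I.node v ≤ I.node i ∧ I.node i ≤ I.node u := by
  rw [TreeData.mem_path, anc_iff_le, anc_iff_le]
  exact and_iff_right (mem_V i)

/-- A chain consists of the vertices between its top and its bottom. -/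
theorem IsTreeChain.exists_eq {C : Finset (Fin n)} (hC : I.IsTreeChain C) :
    ∃ v u : Fin n, I.node v ≤ I.node u ∧
      ∀ i, i ∈ C ↔ I.node v ≤ I.node i ∧ I.node i ≤ I.node u := by
  obtain ⟨x, y, p, -, hp, htot⟩ := hC
  have hne : C.Nonempty := ⟨I.node.symm x, (hp _).2 (by simp)⟩
  obtain ⟨v, hv, hvmin⟩ := Finset.exists_minimalFor I.node C hne
  obtain ⟨u, hu, humax⟩ := Finset.exists_maximalFor I.node C hne
  have hvle : ∀ i ∈ C, I.node v ≤ I.node i := fun i hi =>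
    (htot v hv i hi).elim id fun h => hvmin hi h
  have hule : ∀ i ∈ C, I.node i ≤ I.node u := fun i hi =>
    (htot i hi u hu).elim id fun h => humax hi h
  refine ⟨v, u, hvle u hu, fun i => ⟨fun hi => ⟨hvle i hi, hule i hi⟩, fun ⟨h, h'⟩ => ?_⟩⟩
  by_cases hiv : I.node i ≤ I.node v
  · rwa [I.node.injective (le_antisymm hiv h)]
  · have hv' := (hp v).1 hv
    have hu' := (hp u).1 hu
    -- The given path may have any direction; going back from `v` to its start and on to `u` gives a
    -- walk from `v` to `u` within its support.
    have := mem_support_of_le ((p.takeUntil _ hv').reverse.append (p.takeUntil _ hu')) hiv h'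
    rw [SimpleGraph.Walk.mem_support_append_iff, SimpleGraph.Walk.support_reverse,
      List.mem_reverse] at this
    rw [hp]
    rcases this with h | h
    · exact p.support_takeUntil_subset_support hv' h
    · exact p.support_takeUntil_subset_support hu' h

theorem isTreeChain_of_forall {C : Finset (Fin n)} {v u : Fin n} (hvu : I.node v ≤ I.node u)
    (hC : ∀ i, i ∈ C ↔ I.node v ≤ I.node i ∧ I.node i ≤ I.node u)
    (htot : ∀ i j, I.node i ≤ I.node u → I.node j ≤ I.node u →
      I.node i ≤ I.node j ∨ I.node j ≤ I.node i) : I.IsTreeChain C := by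
  obtain ⟨p, hp, hs⟩ := exists_isPath_of_le hvu
  refine ⟨_, _, p, hp, fun i => by rw [hC, hs], fun i hi j hj => ?_⟩
  exact htot i j ((hC i).1 hi).2 ((hC j).1 hj).2

end Problem
end ChainPartition

end

noncomputable section

namespace ChainPartition

open scoped Classical

/-! ### Optimality -/

namespace Problem

variable {n : ℕ} {I : Problem.{u} n}
variable {h₁ : ∀ i, 0 ≤ I.weight i} {h₂ : ∀ i, I.weight i ≤ I.threshold}
  {h₃ : Function.Injective I.rank} {C : Finset (Fin n)} {v u x d : ℕ}

variable (h₁ h₂ h₃) in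
/-- `C` consists of the vertices on the way from `v` to `u`, numbered from `1`. -/
def IsInterval (C : Finset (Fin n)) (v u : ℕ) : Prop :=
  ∀ i : Fin n, i ∈ C ↔ (i : ℕ) + 1 ∈ (I.toTreeData h₁ h₂ h₃).path v u

theorem IsInterval.sum_eq (hC : IsInterval h₁ h₂ h₃ C v u) (f : ℕ → ℝ) :
    ∑ i ∈ C, f (i + 1) = ∑ x ∈ (I.toTreeData h₁ h₂ h₃).path v u, f x := by
  refine Finset.sum_bij (fun (i : Fin n) _ => (i : ℕ) + 1) (fun i hi => (hC i).1 hi) ?_ ?_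
    fun _ _ => rfl
  · intro i _ j _ e
    exact Fin.ext (by simpa using e)
  · intro x hx
    obtain ⟨i, rfl⟩ := exists_fin (n := n) (TreeData.mem_path.1 hx).1
    exact ⟨i, (hC i).2 hx, rfl⟩

theorem sum_univ_eq (f : ℕ → ℝ) :
    ∑ i : Fin n, f (i + 1) = ∑ x ∈ (I.toTreeData h₁ h₂ h₃).V, f x := by
  refine Finset.sum_bij (fun (i : Fin n) _ => (i : ℕ) + 1) (fun i _ => mem_V i) ?_ ?_
    fun _ _ => rfl
  · intro i _ j _ e
    exact Fin.ext (by simpa using e)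
  · intro x hx
    obtain ⟨i, rfl⟩ := exists_fin (n := n) hx
    exact ⟨i, Finset.mem_univ i, rfl⟩

theorem IsInterval.sum_weight (hC : IsInterval h₁ h₂ h₃ C v u)
    (hvu : (I.toTreeData h₁ h₂ h₃).Anc v u) (hv : v ∈ (I.toTreeData h₁ h₂ h₃).V) :
    ∑ i ∈ C, I.weight i = (I.toTreeData h₁ h₂ h₃).pw u - (I.toTreeData h₁ h₂ h₃).pw v +
      (I.toTreeData h₁ h₂ h₃).w v := by
  rw [TreeData.pw_sub hvu hv, ← hC.sum_eq]
  exact Finset.sum_congr rfl fun i _ => (arrayOf_fin I.weight i).symm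

/-- Distinct ranks make the vertex chosen by `dominant` the only one of largest rank. -/
theorem IsInterval.chainCost_eq (hC : IsInterval h₁ h₂ h₃ C v u)
    (hd : (I.toTreeData h₁ h₂ h₃).IsDom d v u) :
    I.chainCost C = (I.toTreeData h₁ h₂ h₃).s d := by
  obtain ⟨hd, hmax⟩ := hd
  obtain ⟨i, rfl⟩ := exists_fin (n := n) (TreeData.mem_path.1 hd).1
  have hi := (hC i).2 hd
  have hne : C.Nonempty := ⟨i, hi⟩
  obtain ⟨hj, hjmax⟩ := Classical.choose_spec (C.exists_max_image I.rank hne)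
  have hle := hmax _ ((hC _).1 hj)
  have hr : ∀ i : Fin n, (I.toTreeData h₁ h₂ h₃).r (i + 1) = I.rank i := arrayOf_fin I.rank
  rw [hr, hr] at hle
  have : I.dominant C hne = i := h₃ (le_antisymm hle (hjmax i hi))
  rw [chainCost, dif_pos hne, this]
  exact (arrayOf_fin I.cost i).symm

theorem IsTreeChain.exists_isInterval (hC : I.IsTreeChain C) :
    ∃ v ∈ (I.toTreeData h₁ h₂ h₃).V, ∃ u ∈ (I.toTreeData h₁ h₂ h₃).V,
      (I.toTreeData h₁ h₂ h₃).Anc v u ∧ IsInterval h₁ h₂ h₃ C v u := by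
  obtain ⟨v, u, hvu, h⟩ := hC.exists_eq
  exact ⟨v + 1, mem_V v, u + 1, mem_V u, (anc_iff_le v u).2 hvu, fun i => by
    rw [h, mem_path_iff]⟩

theorem IsInterval.isTreeChain (hC : IsInterval h₁ h₂ h₃ C v u)
    (hv : v ∈ (I.toTreeData h₁ h₂ h₃).V) (hu : u ∈ (I.toTreeData h₁ h₂ h₃).V)
    (hvu : (I.toTreeData h₁ h₂ h₃).Anc v u) : I.IsTreeChain C := by
  obtain ⟨v, rfl⟩ := exists_fin (n := n) hv
  obtain ⟨u, rfl⟩ := exists_fin (n := n) hu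
  refine isTreeChain_of_forall ((anc_iff_le v u).1 hvu) (fun i => by rw [hC i, mem_path_iff])
    fun i j hi hj => ?_
  rw [← anc_iff_le (h₁ := h₁) (h₂ := h₂) (h₃ := h₃)] at hi hj ⊢
  rw [← anc_iff_le (h₁ := h₁) (h₂ := h₂) (h₃ := h₃)]
  exact hi.total hj

theorem sum_parts (P : Finpartition (Finset.univ : Finset (Fin n))) (f : Fin n → ℝ) :
    ∑ C ∈ P.parts, ∑ i ∈ C, f i = ∑ i, f i := by
  have := Finset.sum_biUnion (f := f) P.disjoint
  rw [P.biUnion_parts] at this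
  exact this.symm

/-- Weak duality: the inequality on each chain is summed over the partition. -/
theorem sum_le_totalCost {h : ℕ → ℝ} {b : ℕ → ℕ}
    (hg : ∀ v ∈ (I.toTreeData h₁ h₂ h₃).V, (I.toTreeData h₁ h₂ h₃).Good h (b v) v)
    {P : Finpartition (Finset.univ : Finset (Fin n))} (hP : I.IsFeasible P) :
    ∑ x ∈ (I.toTreeData h₁ h₂ h₃).V, h x ≤ I.totalCost P := by
  rw [← sum_univ_eq, ← sum_parts P, totalCost]
  refine Finset.sum_le_sum fun C hC => ?_
  obtain ⟨hch, hw⟩ := hP C hC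
  obtain ⟨v, hv, u, hu, hvu, hI⟩ := hch.exists_isInterval (h₁ := h₁) (h₂ := h₂) (h₃ := h₃)
  obtain ⟨d, hd⟩ := TreeData.exists_isDom hvu hv
  rw [hI.chainCost_eq hd, hI.sum_eq h]
  rw [hI.sum_weight hvu hv] at hw
  exact (hg v hv).sum_le u hu hvu hw d hd

/-- The classes of equal labels are the chosen chains. Equality holds on each of them, so their
total cost meets the lower bound. -/
theorem exists_isOptimal {h : ℕ → ℝ} {b ℓ : ℕ → ℕ}
    (hg : ∀ v ∈ (I.toTreeData h₁ h₂ h₃).V, (I.toTreeData h₁ h₂ h₃).Good h (b v) v)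
    (hℓ : ∀ x ∈ (I.toTreeData h₁ h₂ h₃).V, ℓ x ∈ (I.toTreeData h₁ h₂ h₃).V ∧
      IsLabelled (I.toTreeData h₁ h₂ h₃) b ℓ x) :
    ∃ P : Finpartition (Finset.univ : Finset (Fin n)), I.IsOptimal P ∧
      ∑ x ∈ (I.toTreeData h₁ h₂ h₃).V, h x = I.totalCost P ∧
      ∀ i j : Fin n, ℓ (i + 1) = ℓ (j + 1) ↔ P.part i = P.part j := by
  let s : Setoid (Fin n) := Setoid.comap (fun i : Fin n => ℓ (i + 1)) ⊥
  have hs : ∀ i j, s i j ↔ ℓ (i + 1) = ℓ (j + 1) := fun i j => Iff.rfl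
  let P : Finpartition (Finset.univ : Finset (Fin n)) := Finpartition.ofSetoid s
  have hpart : ∀ C ∈ P.parts, ∃ v ∈ (I.toTreeData h₁ h₂ h₃).V, IsInterval h₁ h₂ h₃ C v (b v) := by
    intro C hC
    obtain ⟨i, hi⟩ := P.nonempty_of_mem_parts hC
    refine ⟨ℓ (i + 1), (hℓ _ (mem_V i)).1, fun j => ?_⟩
    rw [← P.part_eq_of_mem hC hi, Finpartition.mem_part_ofSetoid_iff_rel, hs]
    constructor
    · intro e
      rw [e]
      exact (hℓ _ (mem_V j)).2.1
    · intro hj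
      exact ((hℓ _ (mem_V i)).2.2 _ hj).symm
  have hfeas : I.IsFeasible P := by
    intro C hC
    obtain ⟨v, hv, hI⟩ := hpart C hC
    have hgv := hg v hv
    refine ⟨hI.isTreeChain hv hgv.mem hgv.anc, ?_⟩
    rw [hI.sum_weight hgv.anc hv]
    exact hgv.le
  have hcost : ∑ x ∈ (I.toTreeData h₁ h₂ h₃).V, h x = I.totalCost P := by
    rw [← sum_univ_eq, ← sum_parts P, totalCost]
    refine Finset.sum_congr rfl fun C hC => ?_
    obtain ⟨v, hv, hI⟩ := hpart C hC
    obtain ⟨d, hd, hsum⟩ := (hg v hv).eq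
    rw [hI.chainCost_eq hd, hI.sum_eq h, hsum]
  refine ⟨P, ⟨hfeas, fun Q hQ => hcost ▸ sum_le_totalCost hg hQ⟩, hcost, fun i j => ?_⟩
  rw [← P.mem_part_iff_part_eq_part (Finset.mem_univ i) (Finset.mem_univ j),
    Finpartition.mem_part_ofSetoid_iff_rel, hs, eq_comm]

end Problem

/-! ### The running time and the conclusion. -/

theorem isSolution_of_ensures {n l : ℕ} (I : Problem.{u} n) (h₁ : ∀ i, 0 ≤ I.weight i)
    (h₂ : ∀ i, I.weight i ≤ I.threshold) (h₃ : Function.Injective I.rank) (hl : n < 2 ^ l) :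
    Ensures solve (inputStore I) fun t τ => t ≤ (7000 * l + 8000) * n + 200 ∧ IsSolution I τ := by
  refine (ensures_solve (Problem.isInput (h₁ := h₁) (h₂ := h₂) (h₃ := h₃)) hl).mono ?_
  rintro t τ ⟨ht, h, b, ℓ, hg, hr, hℓ, hlab⟩
  obtain ⟨P, hP, hcost, hpart⟩ := Problem.exists_isOptimal hg hlab
  refine ⟨ht, P, hP, hr.trans hcost, fun i j => ?_⟩
  rw [hℓ i i.2, hℓ j j.2, hpart]

theorem isBigO_mul_log :
    (fun n : ℕ => (((7000 * (Nat.log 2 n + 1) + 8000) * n + 200 : ℕ) : ℝ)) =O[Filter.atTop]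
      fun n : ℕ => (n : ℝ) * Real.log n := by
  -- For `n ≥ 3` the logarithm is at least `1`, so `15000 * n + 200` is at most `15200` times `n *
  -- Real.log n`; the constant `30400` is generous. The other summand converts the binary logarithm.
  refine Asymptotics.IsBigO.of_bound (30400 + 7000 / Real.log 2) ?_
  filter_upwards [Filter.eventually_ge_atTop 3] with n hn
  have hn' : (3 : ℝ) ≤ n := by exact_mod_cast hn
  have hlog1 : 1 ≤ Real.log n := by
    rw [Real.le_log_iff_exp_le (by linarith)]
    linarith [Real.exp_one_lt_d9]
  have hlog2 : 0 < Real.log 2 := Real.log_pos (by norm_num)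
  have hl : (Nat.log 2 n : ℝ) ≤ Real.log n / Real.log 2 := by
    have := Real.natLog_le_logb n 2
    simpa [Real.logb] using this
  have hnn : (1 : ℝ) ≤ n * Real.log n := by nlinarith
  have hnl : (n : ℝ) ≤ n * Real.log n := by nlinarith
  have hnlog : (n : ℝ) * Nat.log 2 n ≤ n * Real.log n / Real.log 2 := by
    rw [mul_div_assoc]
    exact mul_le_mul_of_nonneg_left hl (by linarith)
  rw [Real.norm_of_nonneg (by positivity), Real.norm_of_nonneg (by linarith)]
  push_cast
  have : (30400 + 7000 / Real.log 2) * (n * Real.log n) =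
      7000 * (n * Real.log n / Real.log 2) + 30400 * (n * Real.log n) := by ring
  rw [this]
  nlinarith

end ChainPartition
end

open ChainPartition in
theorem theorem2 :
    ∃ (p : Program) (T : ℕ → ℕ),
      ((fun n : ℕ => (T n : ℝ)) =O[Filter.atTop] fun n : ℕ => (n : ℝ) * Real.log n) ∧
      ∀ (n : ℕ) (I : Problem.{u} n),
        (∀ i, 0 ≤ I.weight i) → (∀ i, I.weight i ≤ I.threshold) → Function.Injective I.rank →
        ∃ t ≤ T n, ∃ τ, Runs p (inputStore I) t τ ∧ IsSolution I τ := by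
  -- The time bound is read off from `isBigO_mul_log`; there `l` is `Nat.log 2 n + 1`, an exponent
  -- with `n < 2 ^ l`.
  refine ⟨solve, _, isBigO_mul_log, fun n I h₁ h₂ h₃ => ?_⟩
  obtain ⟨t, τ, hr, ht, hs⟩ := isSolution_of_ensures I h₁ h₂ h₃
    (Nat.lt_pow_succ_log_self (by norm_num) n)
  exact ⟨t, ht, τ, hr, hs⟩
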